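/- Let $d\in\{1,2\}$ and let $\xi_1,\xi_2,\dots$ be i.i.d. $\mathbb{Z}^d$-valued random variables, with the law of $\xi$, on a probability space $(\Omega,\mathcal F,\mathbb P)$, and let $\phi(t)=\mathbb E\,e^{it\cdot\xi}$. Assume that $\xi$ is strongly aperiodic: there are no proper subgroup $L$ of $\mathbb{Z}^d$ and no $x\in\mathbb{Z}^d$ with $\mathbb P(\xi-x\in L)=1$. Assume moreover one of the following. (A1) $d=1$ and, for some $\gamma>0$, $\phi(t)=1-\gamma|t|+o(|t|)$ as $t\to0$; put $\gamma_1=\pi\gamma$. (A2) $d=2$, $\mathbb E|\xi|^2<\infty$, $\mathbb E\,\xi=0$, and the covariance matrix $\Sigma$ of $\xi$ is non-singular; put $\gamma_2=2\pi\sqrt{\det\Sigma}$. Let $S(n)=\xi_1+\dots+\xi_n$, let $l(n,x)=\sum_{j=1}^n\mathbf 1\{S(j)=x\}$ for $x\in\mathbb{Z}^d$, and for $w\in\mathbb{Z}^d$ and an integer $\alpha\ge1$ let $$L_{n,w}(\alpha)=\sum_{x\in\mathbb{Z}^d} l(n,x)^\alpha\, l(n,x+w)^\alpha .$$ Then for every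 $w\in\mathbb{Z}^d$ and every integer $\alpha\ge1$, almost surely, $$\lim_{n\to\infty}\frac{L_{n,w}(\alpha)}{n(\log n)^{2\alpha-1}}=\frac{\Gamma(2\alpha+1)}{\gamma_d^{\,2\alpha-1}} .$$ -/

import Mathlib

open MeasureTheory ProbabilityTheory Filter Topology Asymptotics

namespace RandomWalkLocalTime

noncomputable section

/-- The jumps: independent, identically distributed random vectors with values in `ℤ^d`.
The term `ξ i` is the jump made at time `i + 1`. -/
structure IsIIDSequence {Ω : Type*} [MeasurableSpace Ω] (P : Measure Ω) {d : ℕ}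
    (ξ : ℕ → Ω → Fin d → ℤ) : Prop where
  measurable : ∀ i, Measurable (ξ i)
  indep : iIndepFun ξ P
  identDistrib : ∀ i, IdentDistrib (ξ i) (ξ 0) P P

/-- Strong aperiodicity: no translate of a proper subgroup of `ℤ^d` carries the whole law of
`X`. -/
def StronglyAperiodic {Ω : Type*} [MeasurableSpace Ω] (P : Measure Ω) {d : ℕ}
    (X : Ω → Fin d → ℤ) : Prop :=
  ¬ ∃ (L : AddSubgroup (Fin d → ℤ)) (x : Fin d → ℤ), L ≠ ⊤ ∧ P {ω | X ω - x ∈ L} = 1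

/-- The inclusion of `ℤ^d` in Euclidean space `ℝ^d`. -/
def latticeToReal {d : ℕ} (x : Fin d → ℤ) : EuclideanSpace ℝ (Fin d) :=
  WithLp.toLp 2 fun i => (x i : ℝ)

/-- The characteristic function `φ(t) = E exp(i t · X)`. -/
def charFn {Ω : Type*} [MeasurableSpace Ω] (P : Measure Ω) {d : ℕ}
    (X : Ω → Fin d → ℤ) (t : EuclideanSpace ℝ (Fin d)) : ℂ :=
  charFun (P.map fun ω => latticeToReal (X ω)) t

/-- Condition A1: `X` takes values in `ℤ`, `γ > 0` and `φ(t) = 1 - γ |t| + o(|t|)` as `t → 0`. -/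
structure ConditionA1 {Ω : Type*} [MeasurableSpace Ω] (P : Measure Ω)
    (X : Ω → Fin 1 → ℤ) (γ : ℝ) : Prop where
  pos : 0 < γ
  expansion : (fun t : EuclideanSpace ℝ (Fin 1) => charFn P X t - ((1 - γ * ‖t‖ : ℝ) : ℂ))
    =o[𝓝 0] fun t => ‖t‖

/-- The covariance matrix of a random vector with values in `ℤ^d`. -/
def covMatrix {Ω : Type*} [MeasurableSpace Ω] (P : Measure Ω) {d : ℕ}
    (X : Ω → Fin d → ℤ) : Matrix (Fin d) (Fin d) ℝ :=
  Matrix.of fun i j => covariance (fun ω => (X ω i : ℝ)) (fun ω => (X ω j : ℝ)) P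

/-- Condition A2: `X` takes values in `ℤ²`, is square integrable and centred, and its covariance
matrix is non-singular. -/
structure ConditionA2 {Ω : Type*} [MeasurableSpace Ω] (P : Measure Ω)
    (X : Ω → Fin 2 → ℤ) : Prop where
  secondMoment : Integrable (fun ω => ‖latticeToReal (X ω)‖ ^ 2) P
  centred : ∀ i, ∫ ω, (X ω i : ℝ) ∂P = 0
  nonsingular : (covMatrix P X).det ≠ 0

/-- The random walk `S(n)`, the sum of the first `n` jumps. -/
def walk {Ω : Type*} {d : ℕ} (ξ : ℕ → Ω → Fin d → ℤ) (n : ℕ) (ω : Ω) : Fin d → ℤ :=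
  ∑ i ∈ Finset.range n, ξ i ω

/-- The local time `l(n, x)`, the number of `j` with `1 ≤ j ≤ n` and `S(j) = x`. -/
def localTime {Ω : Type*} {d : ℕ} (ξ : ℕ → Ω → Fin d → ℤ) (n : ℕ) (x : Fin d → ℤ) (ω : Ω) : ℕ :=
  ∑ j ∈ Finset.Icc 1 n, if walk ξ j ω = x then 1 else 0

/-- `L_{n,w}(α) = ∑_x l(n, x)^α l(n, x + w)^α`. For `α ≥ 1` only finitely many terms of the sum
are different from zero. -/
def shiftedIntersection {Ω : Type*} {d : ℕ} (ξ : ℕ → Ω → Fin d → ℤ) (w : Fin d → ℤ) (α n : ℕ)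
    (ω : Ω) : ℝ :=
  ∑' x : Fin d → ℤ, (localTime ξ n x ω : ℝ) ^ α * (localTime ξ n (x + w) ω : ℝ) ^ α

end

end RandomWalkLocalTime

/-!
For a pattern `w : ι → ℤ^d` of `p` points let `tupleInter ξ w n = ∑_x ∏_i l(n, x + w i)`. The
intersection local time `L_{n,w}(α)` is the case of the pattern in which `0` and `w` occur `α`
times each, so that `p = 2 α`. It is shown that `tupleInter ξ w n / (n (log n)^(p-1))` converges
almost surely to `p! l^(p-1)` for every random walk whose transition probabilities satisfy
`k P(S(k) = x) → l` for each `x` and `k P(S(k) = x) ≤ C` uniformly (`LogRecurrent`).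

*Mean.* `tupleInter` counts the families of `p` times at which the walk visits the points of a
translate of the pattern. Sorting the times gives `p!` orders; the first visit fixes the translate
and contributes a factor `n`, and by the Markov property each of the `p - 1` gaps between
successive visits contributes a Green function `∑_{k ≤ n} P(S(k) = x) ~ l log n`. Ties of times are
negligible. The sorting is done by splitting off the earliest time, from above in
`prod_sum_Ico_le` and from below in `le_prod_sum_Ico`; upper bounds for mixed moments then
follow by induction from any solution of a one-step inequality (`lintegral_prod_visits_le`). The
outcome is `LogRecurrent.tendsto_lintegral_tupleInter`.

*Variance.* Cut the walk at time `m` and look at both parts from the point `S(m)`, the first one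
backwards. The count splits into the independent counts of the two parts and cross terms, in
which some points of the pattern are visited by the first part and the others by the second
(`tupleInter_add`). In the second moment of a cross term two translates of the pattern occur,
and each part of the walk has to reach one of them and to pass to the other. These four Green
functions are summed in square over the lattice, and `∑_x G(x)² = O(n)`, so that the second
moment is `O(n² (log n)^(2p-4))` (`lintegral_crossInter_sq_le`), less than the square of the mean
by a factor `(log n)²`. Halving the time interval repeatedly carries this bound over to the
variance (`exists_variance_tupleInter_le`).

*Almost sure convergence.* Along the times `exp(k^{3/4})` the relative variances are of the order
of `k^{-3/2}`, which is summable, and the ratios of successive times tend to one, so that the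
convergence along these times extends to all times by monotonicity
(`LogRecurrent.ae_tendsto_tupleInter`).

*Transition probabilities.* Both conditions on the jumps say that `φ = 1 - Q + o(Q)` at the origin,
where `Q` is homogeneous of degree `d` (`HasExpansion`): `Q(t) = γ |t|` or `Q(t) = t · Σ t / 2`.
By strong aperiodicity `|φ| < 1` elsewhere on the torus, so `|φ| ≤ exp(-c Q)`. In the inversion
formula `(2 π)^d P(S(k) = x) = ∫ φ(t)^k exp(-i t · x) dt` the substitution `t = k^{-1/d} s` produces
a factor `1 / k`, and dominated convergence gives `l = (2 π)^{-d} ∫ exp(-Q)`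
(`HasExpansion.logRecurrent`), which is `1 / (π γ)` and `1 / (2 π √(det Σ))` in the two cases.
-/

open scoped ENNReal

namespace RandomWalkLocalTime

section

/-! ### Splitting off the earliest factor of a product of sums -/

lemma prod_add_le {ι : Type*} [DecidableEq ι] (s : Finset ι) (c T : ι → ℝ≥0∞) :
    ∏ i ∈ s, (c i + T i) ≤
      ∏ i ∈ s, T i + ∑ i ∈ s, c i * ∏ j ∈ s.erase i, (c j + T j) := by
  induction s using Finset.induction_on with
  | empty => simp
  | insert a s ha ih =>
    have key : ∑ i ∈ s, T a * (c i * ∏ j ∈ s.erase i, (c j + T j)) ≤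
        ∑ i ∈ s, c i * ∏ j ∈ (insert a s).erase i, (c j + T j) := by
      refine Finset.sum_le_sum fun i hi => ?_
      have hia : a ≠ i := fun h => ha (h ▸ hi)
      rw [Finset.erase_insert_of_ne hia, Finset.prod_insert (by simp [ha])]
      calc _ = c i * (T a * ∏ j ∈ s.erase i, (c j + T j)) := by ring
        _ ≤ _ := by gcongr; exact le_add_self
    rw [Finset.prod_insert ha, Finset.prod_insert ha, Finset.sum_insert ha,
      Finset.erase_insert ha, add_mul]
    calc _ ≤ c a * ∏ i ∈ s, (c i + T i) + T a * (∏ i ∈ s, T i +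
          ∑ i ∈ s, c i * ∏ j ∈ s.erase i, (c j + T j)) := by gcongr
      _ = c a * ∏ i ∈ s, (c i + T i) + T a * ∏ i ∈ s, T i +
          ∑ i ∈ s, T a * (c i * ∏ j ∈ s.erase i, (c j + T j)) := by
            rw [mul_add, Finset.mul_sum, add_assoc]
      _ ≤ c a * ∏ i ∈ s, (c i + T i) + T a * ∏ i ∈ s, T i +
          ∑ i ∈ s, c i * ∏ j ∈ (insert a s).erase i, (c j + T j) := add_le_add le_rfl key
      _ = _ := by abel

lemma le_prod_add {ι : Type*} [DecidableEq ι] (s : Finset ι) (c T : ι → ℝ≥0∞) :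
    ∏ i ∈ s, T i + ∑ i ∈ s, c i * ∏ j ∈ s.erase i, T j ≤ ∏ i ∈ s, (c i + T i) := by
  induction s using Finset.induction_on with
  | empty => simp
  | insert a s ha ih =>
    have key : ∑ i ∈ s, c i * ∏ j ∈ (insert a s).erase i, T j =
        ∑ i ∈ s, T a * (c i * ∏ j ∈ s.erase i, T j) := by
      refine Finset.sum_congr rfl fun i hi => ?_
      have hia : a ≠ i := fun h => ha (h ▸ hi)
      rw [Finset.erase_insert_of_ne hia, Finset.prod_insert (by simp [ha])]
      ring
    rw [Finset.prod_insert ha, Finset.prod_insert ha, Finset.sum_insert ha,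
      Finset.erase_insert ha, add_mul, key, ← Finset.mul_sum]
    calc _ = c a * ∏ i ∈ s, T i + T a * (∏ i ∈ s, T i +
          ∑ i ∈ s, c i * ∏ j ∈ s.erase i, T j) := by ring
      _ ≤ _ := by
        gcongr
        exact le_add_self

/-- Expanding a product of sums over times `k ∈ [a, b)` according to the earliest time that
occurs, ties being counted more than once. -/
lemma prod_sum_Ico_le {ι : Type*} [DecidableEq ι] {s : Finset ι} (hs : s.Nonempty)
    (c : ι → ℕ → ℝ≥0∞) (a b : ℕ) :
    ∏ i ∈ s, ∑ k ∈ Finset.Ico a b, c i k ≤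
      ∑ k ∈ Finset.Ico a b, ∑ i ∈ s,
        c i k * ∏ j ∈ s.erase i, ∑ l ∈ Finset.Ico k b, c j l := by
  induction h : b - a generalizing a with
  | zero =>
    obtain ⟨i, hi⟩ := hs
    rw [Finset.Ico_eq_empty_of_le (by omega), Finset.sum_empty]
    exact (Finset.prod_eq_zero hi (by simp)).le
  | succ m ih =>
    have hab : a < b := by omega
    rw [Finset.sum_eq_sum_Ico_succ_bot hab]
    simp_rw [Finset.sum_eq_sum_Ico_succ_bot hab (c _)]
    refine (prod_add_le s _ _).trans ?_
    rw [add_comm]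
    gcongr
    exact ih (a + 1) (by omega)

/-- Expanding a product of sums over times `k ∈ [a, b)` according to the earliest time that
occurs, ties being left out. -/
lemma le_prod_sum_Ico {ι : Type*} [DecidableEq ι] (s : Finset ι)
    (c : ι → ℕ → ℝ≥0∞) (a b : ℕ) :
    ∑ k ∈ Finset.Ico a b, ∑ i ∈ s,
        c i k * ∏ j ∈ s.erase i, ∑ l ∈ Finset.Ico (k + 1) b, c j l ≤
      ∏ i ∈ s, ∑ k ∈ Finset.Ico a b, c i k := by
  induction h : b - a generalizing a with
  | zero => simp [Finset.Ico_eq_empty_of_le (show b ≤ a by omega)]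
  | succ m ih =>
    have hab : a < b := by omega
    rw [Finset.sum_eq_sum_Ico_succ_bot hab]
    simp_rw [Finset.sum_eq_sum_Ico_succ_bot hab (c _)]
    refine le_trans ?_ (le_prod_add s _ _)
    rw [add_comm]
    gcongr
    exact ih (a + 1) (by omega)

/-! ### The walk and its numbers of visits -/

variable {Ω : Type*} {d : ℕ} {ξ η : ℕ → Ω → Fin d → ℤ}

/-- The sequence of jumps seen from time `k` on. -/
def shiftSeq (ξ : ℕ → Ω → Fin d → ℤ) (k : ℕ) : ℕ → Ω → Fin d → ℤ := fun i => ξ (k + i)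

/-- The `σ`-algebra generated by the jumps with index in `S`. -/
@[reducible] def jumpSigma (ξ : ℕ → Ω → Fin d → ℤ) (S : Set ℕ) : MeasurableSpace Ω :=
  ⨆ i ∈ S, MeasurableSpace.comap (ξ i) inferInstance

lemma measurable_jumpSigma {S : Set ℕ} {i : ℕ} (hi : i ∈ S) :
    Measurable[jumpSigma ξ S] (ξ i) :=
  measurable_iff_comap_le.2 (le_iSup₂_of_le i hi le_rfl)

lemma walk_succ (ξ : ℕ → Ω → Fin d → ℤ) (n : ℕ) (ω : Ω) :
    walk ξ (n + 1) ω = walk ξ n ω + ξ n ω :=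
  Finset.sum_range_succ _ _

lemma walk_add (ξ : ℕ → Ω → Fin d → ℤ) (k n : ℕ) (ω : Ω) :
    walk ξ (k + n) ω = walk ξ k ω + walk (shiftSeq ξ k) n ω :=
  Finset.sum_range_add _ _ _

lemma measurable_walk {m : MeasurableSpace Ω} {n : ℕ} (h : ∀ i < n, Measurable[m] (ξ i)) :
    Measurable[m] (walk ξ n) := by
  unfold walk
  exact Finset.measurable_fun_sum _ fun i hi => h i (Finset.mem_range.1 hi)

/-- The number of times `k ∈ [a, b)` at which the walk is at `y`. -/
noncomputable def visits (ξ : ℕ → Ω → Fin d → ℤ) (a b : ℕ) (y : Fin d → ℤ) (ω : Ω) : ℝ≥0∞ :=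
  ∑ k ∈ Finset.Ico a b, if walk ξ k ω = y then 1 else 0

lemma measurable_visits {m : MeasurableSpace Ω} {a b : ℕ}
    (h : ∀ i, i + 1 < b → Measurable[m] (ξ i)) (y : Fin d → ℤ) :
    Measurable[m] (visits ξ a b y) := by
  unfold visits
  refine Finset.measurable_fun_sum _ fun k hk => ?_
  have hw : Measurable[m] (walk ξ k) :=
    measurable_walk fun i hi => h i (by have := (Finset.mem_Ico.1 hk).2; omega)
  exact Measurable.ite (hw (measurableSet_singleton y)) measurable_const measurable_const

lemma visits_le (ξ : ℕ → Ω → Fin d → ℤ) (a b : ℕ) (y : Fin d → ℤ) (ω : Ω) :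
    visits ξ a b y ω ≤ (b - a : ℕ) := by
  unfold visits
  calc _ ≤ ∑ k ∈ Finset.Ico a b, (1 : ℝ≥0∞) := Finset.sum_le_sum fun k _ => by split_ifs <;> simp
    _ = _ := by simp

lemma visits_mono (ξ : ℕ → Ω → Fin d → ℤ) {a a' b b' : ℕ} (ha : a' ≤ a) (hb : b ≤ b')
    (y : Fin d → ℤ) (ω : Ω) : visits ξ a b y ω ≤ visits ξ a' b' y ω :=
  Finset.sum_le_sum_of_subset (Finset.Ico_subset_Ico ha hb)

/-- From the time `k` at which the walk is at `y`, it goes on as the walk with the later jumps,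
started at `y`. -/
lemma visits_eq_visits_shiftSeq {k a b : ℕ} (hka : k ≤ a) {y : Fin d → ℤ} {ω : Ω}
    (hy : walk ξ k ω = y) (z : Fin d → ℤ) :
    visits ξ a b z ω = visits (shiftSeq ξ k) (a - k) (b - k) (z - y) ω := by
  unfold visits
  by_cases hb : b ≤ k
  · rw [Finset.Ico_eq_empty_of_le (by omega), Finset.Ico_eq_empty_of_le (by omega)]; rfl
  obtain ⟨a, rfl⟩ := Nat.exists_eq_add_of_le hka
  obtain ⟨b, rfl⟩ := Nat.exists_eq_add_of_le (show k ≤ b by omega)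
  rw [Nat.add_sub_cancel_left, Nat.add_sub_cancel_left, add_comm k a, add_comm k b,
    ← Finset.sum_Ico_add]
  refine Finset.sum_congr rfl fun j _ => ?_
  simp only [walk_add, hy, eq_sub_iff_add_eq, add_comm y]

/-! ### Independent increments -/

variable [mΩ : MeasurableSpace Ω] {P : Measure Ω}

namespace IsIIDSequence

lemma jumpSigma_le (h : IsIIDSequence P ξ) (S : Set ℕ) : jumpSigma ξ S ≤ mΩ :=
  iSup₂_le fun i (_ : i ∈ S) => measurable_iff_comap_le.1 (h.measurable i)

lemma indep_jumpSigma (h : IsIIDSequence P ξ) {S T : Set ℕ} (hST : Disjoint S T) :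
    Indep (jumpSigma ξ S) (jumpSigma ξ T) P :=
  indep_iSup_of_disjoint (fun i => measurable_iff_comap_le.1 (h.measurable i)) h.indep hST

/-- Functions of the first `k` jumps are independent of functions of the later ones. -/
lemma lintegral_mul_past_future (h : IsIIDSequence P ξ) {k : ℕ} {f g : Ω → ℝ≥0∞}
    (hf : Measurable[jumpSigma ξ (Set.Iio k)] f) (hg : Measurable[jumpSigma ξ (Set.Ici k)] g) :
    ∫⁻ ω, f ω * g ω ∂P = (∫⁻ ω, f ω ∂P) * ∫⁻ ω, g ω ∂P := by
  have hd : Disjoint (Set.Iio k) (Set.Ici k) :=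
    Set.disjoint_left.2 fun i hi hi' => not_lt.2 (Set.mem_Ici.1 hi') (Set.mem_Iio.1 hi)
  exact lintegral_mul_eq_lintegral_mul_lintegral_of_independent_measurableSpace
    (h.jumpSigma_le (Set.Iio k)) (h.jumpSigma_le (Set.Ici k)) (h.indep_jumpSigma hd) hf hg

lemma precomp (h : IsIIDSequence P ξ) {g : ℕ → ℕ} (hg : Function.Injective g) :
    IsIIDSequence P (fun i => ξ (g i)) where
  measurable i := h.measurable (g i)
  indep := h.indep.precomp hg
  identDistrib i := (h.identDistrib (g i)).trans (h.identDistrib (g 0)).symm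

lemma shiftSeq (h : IsIIDSequence P ξ) (k : ℕ) : IsIIDSequence P (shiftSeq ξ k) :=
  h.precomp (add_right_injective k)

lemma neg (h : IsIIDSequence P ξ) : IsIIDSequence P (fun i ω => -ξ i ω) where
  measurable i := (h.measurable i).neg
  indep := h.indep.comp (fun _ x => -x) fun _ => measurable_neg
  identDistrib i := (h.identDistrib i).comp measurable_neg

end IsIIDSequence

/-- The probability that the walk is at `x` at time `k`. -/
noncomputable def hitProb (P : Measure Ω) (ξ : ℕ → Ω → Fin d → ℤ) (k : ℕ) (x : Fin d → ℤ) :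
    ℝ≥0∞ :=
  P {ω | walk ξ k ω = x}

lemma map_walk_congr [IsProbabilityMeasure P] (h : IsIIDSequence P ξ) (h' : IsIIDSequence P η)
    (h0 : P.map (ξ 0) = P.map (η 0)) (n : ℕ) : P.map (walk ξ n) = P.map (walk η n) := by
  induction n with
  | zero => rfl
  | succ n ih =>
    have key : ∀ ζ : ℕ → Ω → Fin d → ℤ, IsIIDSequence P ζ →
        P.map (walk ζ (n + 1)) = (P.map (walk ζ n)) ∗ (P.map (ζ 0)) := by
      intro ζ hζ
      have hi : IndepFun (walk ζ n) (ζ n) P := by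
        refine indep_of_indep_of_le_left (indep_of_indep_of_le_right
          (hζ.indep_jumpSigma (S := Set.Iio n) (T := {n}) (by simp)) ?_) ?_
        · exact measurable_iff_comap_le.1 (measurable_jumpSigma rfl)
        · exact measurable_iff_comap_le.1
            (measurable_walk fun i hi => measurable_jumpSigma hi)
      have : walk ζ (n + 1) = walk ζ n + ζ n := funext fun ω => walk_succ ζ n ω
      rw [this, hi.map_add_eq_map_conv_map (measurable_walk fun i _ => hζ.measurable i)
        (hζ.measurable n), (hζ.identDistrib n).map_eq]
    rw [key ξ h, key η h', ih, h0]

lemma hitProb_congr [IsProbabilityMeasure P] (h : IsIIDSequence P ξ) (h' : IsIIDSequence P η)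
    (h0 : P.map (ξ 0) = P.map (η 0)) (n : ℕ) (x : Fin d → ℤ) :
    hitProb P ξ n x = hitProb P η n x := by
  have key : ∀ ζ : ℕ → Ω → Fin d → ℤ, IsIIDSequence P ζ →
      hitProb P ζ n x = P.map (walk ζ n) {x} := fun ζ hζ =>
    (Measure.map_apply (measurable_walk fun i _ => hζ.measurable i)
      (measurableSet_singleton x)).symm
  rw [key ξ h, key η h', map_walk_congr h h' h0]

lemma hitProb_shiftSeq [IsProbabilityMeasure P] (h : IsIIDSequence P ξ) (k n : ℕ)
    (x : Fin d → ℤ) : hitProb P (shiftSeq ξ k) n x = hitProb P ξ n x :=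
  hitProb_congr (h.shiftSeq k) h (h.identDistrib _).map_eq n x

lemma tsum_hitProb [IsProbabilityMeasure P] (h : IsIIDSequence P ξ) (k : ℕ) :
    ∑' x, hitProb P ξ k x = 1 := by
  have hm : Measurable (walk ξ k) := measurable_walk fun i _ => h.measurable i
  have : IsProbabilityMeasure (P.map (walk ξ k)) := Measure.isProbabilityMeasure_map hm.aemeasurable
  rw [← measure_univ (μ := P.map (walk ξ k)), ← Measure.tsum_indicator_apply_singleton _ _
    MeasurableSet.univ]
  refine tsum_congr fun x => ?_
  rw [Set.indicator_of_mem (Set.mem_univ x), Measure.map_apply hm (measurableSet_singleton x)]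
  rfl

/-! ### The Markov property and moments of numbers of visits -/

/-- The Markov property at time `k`, for products of numbers of visits. -/
lemma lintegral_hit_mul_prod_visits [IsProbabilityMeasure P] (h : IsIIDSequence P ξ) {ι : Type*}
    (s : Finset ι) (z : ι → Fin d → ℤ) {k a : ℕ} (b : ℕ) (hka : k ≤ a) (y : Fin d → ℤ) :
    ∫⁻ ω, (if walk ξ k ω = y then 1 else 0) * ∏ j ∈ s, visits ξ a b (z j) ω ∂P =
      hitProb P ξ k y *
        ∫⁻ ω, ∏ j ∈ s, visits (shiftSeq ξ k) (a - k) (b - k) (z j - y) ω ∂P := by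
  have hw : Measurable[jumpSigma ξ (Set.Iio k)] (walk ξ k) :=
    measurable_walk fun i hi => measurable_jumpSigma hi
  have h1 : Measurable[jumpSigma ξ (Set.Iio k)]
      (fun ω => if walk ξ k ω = y then (1 : ℝ≥0∞) else 0) :=
    Measurable.ite (hw (measurableSet_singleton y)) measurable_const measurable_const
  have h2 : Measurable[jumpSigma ξ (Set.Ici k)]
      (fun ω => ∏ j ∈ s, visits (shiftSeq ξ k) (a - k) (b - k) (z j - y) ω) :=
    Finset.measurable_fun_prod _ fun j _ =>
      measurable_visits (fun i _ => measurable_jumpSigma (ξ := ξ) (i := k + i) (by simp)) _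
  have h3 : ∫⁻ ω, (if walk ξ k ω = y then (1 : ℝ≥0∞) else 0) ∂P = hitProb P ξ k y := by
    rw [hitProb, ← lintegral_indicator_one
      (show MeasurableSet {ω | walk ξ k ω = y} from
        h.jumpSigma_le _ _ (hw (measurableSet_singleton y)))]
    refine lintegral_congr fun ω => ?_
    by_cases hy : walk ξ k ω = y <;> simp [hy]
  have h4 := h.lintegral_mul_past_future h1 h2
  rw [h3] at h4
  rw [← h4]
  refine lintegral_congr fun ω => ?_
  by_cases hy : walk ξ k ω = y
  · simp only [if_pos hy, one_mul]
    exact Finset.prod_congr rfl fun j _ => visits_eq_visits_shiftSeq hka hy _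
  · simp [hy]

/-- The Green function of the walk up to time `n`. -/
noncomputable def green (P : Measure Ω) (ξ : ℕ → Ω → Fin d → ℤ) (n : ℕ) (x : Fin d → ℤ) : ℝ≥0∞ :=
  ∑ k ∈ Finset.Ico 0 (n + 1), hitProb P ξ k x

lemma green_shiftSeq [IsProbabilityMeasure P] (h : IsIIDSequence P ξ) (k n : ℕ)
    (x : Fin d → ℤ) : green P (shiftSeq ξ k) n x = green P ξ n x := by
  simp only [green, hitProb_shiftSeq h]

lemma lintegral_prod_visits_le_sum [IsProbabilityMeasure P] (h : IsIIDSequence P ξ)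
    {ι : Type*} [DecidableEq ι] {s : Finset ι} (hs : s.Nonempty) (z : ι → Fin d → ℤ) (a b : ℕ) :
    ∫⁻ ω, ∏ i ∈ s, visits ξ a b (z i) ω ∂P ≤ ∑ k ∈ Finset.Ico a b, ∑ i ∈ s,
      hitProb P ξ k (z i) *
        ∫⁻ ω, ∏ j ∈ s.erase i, visits (shiftSeq ξ k) 0 (b - k) (z j - z i) ω ∂P := by
  calc _ ≤ ∫⁻ ω, ∑ k ∈ Finset.Ico a b, ∑ i ∈ s, (if walk ξ k ω = z i then 1 else 0) *
          ∏ j ∈ s.erase i, visits ξ k b (z j) ω ∂P :=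
        lintegral_mono fun ω => prod_sum_Ico_le hs _ a b
    _ = _ := by
      have hm : ∀ k i, Measurable fun ω => (if walk ξ k ω = z i then (1 : ℝ≥0∞) else 0) *
          ∏ j ∈ s.erase i, visits ξ k b (z j) ω := fun k i =>
        (Measurable.ite (measurable_walk (fun i _ => h.measurable i) (measurableSet_singleton _))
          measurable_const measurable_const).mul
        (Finset.measurable_fun_prod _ fun j _ => measurable_visits (fun i _ => h.measurable i) _)
      rw [lintegral_finsetSum _ fun k _ => Finset.measurable_fun_sum _ fun i _ => hm k i]
      refine Finset.sum_congr rfl fun k _ => ?_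
      rw [lintegral_finsetSum _ fun i _ => hm k i]
      refine Finset.sum_congr rfl fun i _ => ?_
      rw [lintegral_hit_mul_prod_visits h _ _ _ le_rfl, Nat.sub_self]

lemma sum_le_lintegral_prod_visits [IsProbabilityMeasure P] (h : IsIIDSequence P ξ)
    {ι : Type*} [DecidableEq ι] (s : Finset ι) (z : ι → Fin d → ℤ) (a b : ℕ) :
    ∑ k ∈ Finset.Ico a b, ∑ i ∈ s, hitProb P ξ k (z i) *
        ∫⁻ ω, ∏ j ∈ s.erase i, visits (shiftSeq ξ k) 1 (b - k) (z j - z i) ω ∂P ≤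
      ∫⁻ ω, ∏ i ∈ s, visits ξ a b (z i) ω ∂P := by
  refine le_trans (le_of_eq ?_) (lintegral_mono fun ω => le_prod_sum_Ico s _ a b)
  have hm : ∀ k i, Measurable fun ω => (if walk ξ k ω = z i then (1 : ℝ≥0∞) else 0) *
      ∏ j ∈ s.erase i, visits ξ (k + 1) b (z j) ω := fun k i =>
    (Measurable.ite (measurable_walk (fun i _ => h.measurable i) (measurableSet_singleton _))
      measurable_const measurable_const).mul
    (Finset.measurable_fun_prod _ fun j _ => measurable_visits (fun i _ => h.measurable i) _)
  have := lintegral_finsetSum (μ := P) (Finset.Ico a b)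
    fun k _ => Finset.measurable_fun_sum s fun i _ => hm k i
  refine Eq.trans ?_ this.symm
  refine Finset.sum_congr rfl fun k _ => ?_
  rw [lintegral_finsetSum _ fun i _ => hm k i]
  refine Finset.sum_congr rfl fun i _ => ?_
  rw [lintegral_hit_mul_prod_visits h _ _ _ k.le_succ, Nat.succ_eq_add_one,
    Nat.add_sub_cancel_left]

/-- Supersolutions bound mixed moments: a function `B` of the current position (a label of one of
the points `w i`) and of the set of points still to be visited that dominates its own one-step
expansion along the Green function dominates the mixed moments of the numbers of visits. -/
lemma lintegral_prod_visits_le [IsProbabilityMeasure P] {ι : Type*} [DecidableEq ι]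
    (w : ι → Fin d → ℤ) (n : ℕ) (B : ι → Finset ι → ℝ≥0∞) (hB0 : ∀ i, 1 ≤ B i ∅)
    {G : (Fin d → ℤ) → ℝ≥0∞}
    (hB : ∀ i₀ s, s.Nonempty →
      ∑ i ∈ s, G (w i - w i₀) * B i (s.erase i) ≤ B i₀ s)
    (s : Finset ι) (i₀ : ι) (h : IsIIDSequence P ξ) (hG : ∀ x, green P ξ n x = G x) :
    ∫⁻ ω, ∏ i ∈ s, visits ξ 0 (n + 1) (w i - w i₀) ω ∂P ≤ B i₀ s := by
  induction hc : s.card generalizing s i₀ ξ with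
  | zero => simpa [Finset.card_eq_zero.1 hc] using hB0 i₀
  | succ c ih =>
    have hs : s.Nonempty := Finset.card_pos.1 (by omega)
    refine (lintegral_prod_visits_le_sum h hs _ 0 (n + 1)).trans (le_trans ?_ (hB i₀ s hs))
    rw [Finset.sum_comm]
    refine Finset.sum_le_sum fun i hi => ?_
    rw [← hG, green, Finset.sum_mul]
    refine Finset.sum_le_sum fun k _ => ?_
    gcongr
    refine le_trans (lintegral_mono fun ω => ?_) (ih (s.erase i) i (h.shiftSeq k)
      (fun x => (green_shiftSeq h k n x).trans (hG x)) (by rw [Finset.card_erase_of_mem hi]; omega))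
    refine Finset.prod_le_prod' fun j _ => ?_
    rw [sub_sub_sub_cancel_right]
    exact visits_mono _ le_rfl (by omega) _ _

/-- There are `s.card !` orders in which the points can be visited, and each step between two
successive visits costs at most `K`. -/
lemma lintegral_prod_visits_le_factorial [IsProbabilityMeasure P] {ι : Type*} [DecidableEq ι]
    (w : ι → Fin d → ℤ) {n : ℕ} {K : ℝ≥0∞} (h : IsIIDSequence P ξ)
    (hK : ∀ i j, green P ξ n (w j - w i) ≤ K) (s : Finset ι) (i₀ : ι) :
    ∫⁻ ω, ∏ i ∈ s, visits ξ 0 (n + 1) (w i - w i₀) ω ∂P ≤ s.card.factorial * K ^ s.card := by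
  refine lintegral_prod_visits_le w n (fun _ s => s.card.factorial * K ^ s.card) (by simp)
    (fun i₀ s hs => ?_) s i₀ h fun _ => rfl
  obtain ⟨c, hc⟩ := Nat.exists_eq_add_of_le' (Finset.card_pos.2 hs)
  calc _ ≤ ∑ i ∈ s, K * (c.factorial * K ^ c) := by
        refine Finset.sum_le_sum fun i hi => ?_
        rw [Finset.card_erase_of_mem hi, hc, Nat.add_sub_cancel]
        gcongr
        exact hK _ _
    _ = _ := by
        rw [Finset.sum_const, hc, nsmul_eq_mul, Nat.factorial_succ]
        push_cast
        ring

/-- The counterpart from below: if every gap between successive visits is restricted to `[1, m]`,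
all the visits take place by time `s.card * m`, and ties do not occur. -/
lemma factorial_le_lintegral_prod_visits [IsProbabilityMeasure P] {ι : Type*} [DecidableEq ι]
    (w : ι → Fin d → ℤ) {m : ℕ} {g : ℝ≥0∞}
    (s : Finset ι) (i₀ : ι) {N : ℕ} (hN : s.card * m ≤ N) (h : IsIIDSequence P ξ)
    (hg : ∀ i j, g ≤ ∑ k ∈ Finset.Ico 1 (m + 1), hitProb P ξ k (w j - w i)) :
    s.card.factorial * g ^ s.card ≤
      ∫⁻ ω, ∏ i ∈ s, visits ξ 1 (N + 1) (w i - w i₀) ω ∂P := by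
  induction hc : s.card generalizing s i₀ ξ N with
  | zero => simp [Finset.card_eq_zero.1 hc]
  | succ c ih =>
    refine le_trans ?_ (sum_le_lintegral_prod_visits h s _ 1 (N + 1))
    have hmN : m ≤ N := le_trans (by rw [hc]; nlinarith) hN
    calc _ = ∑ i ∈ s, g * (c.factorial * g ^ c) := by
          rw [Finset.sum_const, hc, nsmul_eq_mul, Nat.factorial_succ]
          push_cast
          ring
      _ ≤ ∑ i ∈ s, ∑ k ∈ Finset.Ico 1 (m + 1),
            hitProb P ξ k (w i - w i₀) * (c.factorial * g ^ c) := by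
          gcongr with i
          rw [← Finset.sum_mul]
          gcongr
          exact hg _ _
      _ = ∑ k ∈ Finset.Ico 1 (m + 1), ∑ i ∈ s,
            hitProb P ξ k (w i - w i₀) * (c.factorial * g ^ c) := Finset.sum_comm
      _ ≤ ∑ k ∈ Finset.Ico 1 (m + 1), ∑ i ∈ s, hitProb P ξ k (w i - w i₀) *
        ∫⁻ ω, ∏ j ∈ s.erase i,
          visits (shiftSeq ξ k) 1 (N + 1 - k) ((w j - w i₀) - (w i - w i₀)) ω ∂P := by
          refine Finset.sum_le_sum fun k hk => Finset.sum_le_sum fun i hi => ?_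
          have hk' := Finset.mem_Ico.1 hk
          gcongr
          simp only [sub_sub_sub_cancel_right]
          rw [show N + 1 - k = (N - k) + 1 by omega]
          have hcard : (s.erase i).card = c := by rw [Finset.card_erase_of_mem hi]; omega
          refine ih (s.erase i) i ?_ (h.shiftSeq k) (fun i j => ?_) hcard
          · rw [hc] at hN
            rw [hcard]
            have : (c + 1) * m = c * m + m := by ring
            omega
          · simpa only [hitProb_shiftSeq h] using hg i j
      _ ≤ _ := Finset.sum_le_sum_of_subset (Finset.Ico_subset_Ico le_rfl (by omega))

end

section

/-! ### Sums over the lattice of products of numbers of visits -/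

section Pointwise

variable {Ω : Type*} {d : ℕ} {ι : Type*} [Fintype ι]

/-- The sum over the base point `x` of the products of the numbers of visits, up to time `n`, to
the points `x + w i`. It counts the families of times at which the walk shows the pattern `w`. -/
noncomputable def tupleInter (ξ : ℕ → Ω → Fin d → ℤ) (w : ι → Fin d → ℤ) (n : ℕ) (ω : Ω) :
    ℝ≥0∞ :=
  ∑' x, ∏ i, visits ξ 1 (n + 1) (x + w i) ω

lemma tsum_add_right_eq (f : (Fin d → ℤ) → ℝ≥0∞) (z : Fin d → ℤ) :
    ∑' x, f (x + z) = ∑' x, f x :=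
  (Equiv.addRight z).tsum_eq f

lemma tsum_visits (ξ : ℕ → Ω → Fin d → ℤ) (a b : ℕ) (ω : Ω) :
    ∑' x, visits ξ a b x ω = (b - a : ℕ) := by
  unfold visits
  rw [Summable.tsum_finsetSum fun _ _ => ENNReal.summable]
  have : ∀ k, ∑' x, (if walk ξ k ω = x then (1 : ℝ≥0∞) else 0) = 1 := fun k => by
    rw [tsum_eq_single (walk ξ k ω) fun x hx => if_neg hx.symm]
    simp
  simp [this]

lemma tupleInter_le [Nonempty ι] (ξ : ℕ → Ω → Fin d → ℤ) (w : ι → Fin d → ℤ) (n : ℕ) (ω : Ω) :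
    tupleInter ξ w n ω ≤ (n : ℝ≥0∞) ^ Fintype.card ι := by
  classical
  obtain ⟨i₀⟩ := ‹Nonempty ι›
  obtain ⟨c, hc : _ = c + 1⟩ := Nat.exists_eq_add_of_le' (Fintype.card_pos_iff.2 ⟨i₀⟩)
  have hle : ∀ y, visits ξ 1 (n + 1) y ω ≤ n := fun y => by
    simpa using visits_le ξ 1 (n + 1) y ω
  calc tupleInter ξ w n ω ≤ ∑' x, visits ξ 1 (n + 1) (x + w i₀) ω * (n : ℝ≥0∞) ^ c := by
        refine ENNReal.tsum_le_tsum fun x => ?_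
        rw [← Finset.mul_prod_erase _ _ (Finset.mem_univ i₀)]
        gcongr
        refine (Finset.prod_le_prod' fun i _ => hle _).trans ?_
        rw [Finset.prod_const, Finset.card_erase_of_mem (Finset.mem_univ _), Finset.card_univ, hc,
          Nat.add_sub_cancel]
    _ = n ^ Fintype.card ι := by
        rw [ENNReal.tsum_mul_right, tsum_add_right_eq (fun x => visits ξ 1 (n + 1) x ω),
          tsum_visits, hc, pow_succ']
        simp

lemma tupleInter_ne_top [Nonempty ι] (ξ : ℕ → Ω → Fin d → ℤ) (w : ι → Fin d → ℤ) (n : ℕ)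
    (ω : Ω) : tupleInter ξ w n ω ≠ ∞ :=
  ((tupleInter_le ξ w n ω).trans_lt (ENNReal.pow_lt_top (ENNReal.natCast_lt_top n))).ne

lemma tupleInter_mono (ξ : ℕ → Ω → Fin d → ℤ) (w : ι → Fin d → ℤ) (ω : Ω) :
    Monotone fun n => tupleInter ξ w n ω := fun _ _ hmn =>
  ENNReal.tsum_le_tsum fun _ => Finset.prod_le_prod' fun _ _ =>
    visits_mono _ le_rfl (by omega) _ _

lemma measurable_tupleInter {m : MeasurableSpace Ω} {ξ : ℕ → Ω → Fin d → ℤ} {n : ℕ}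
    (h : ∀ i < n, Measurable[m] (ξ i)) (w : ι → Fin d → ℤ) :
    Measurable[m] (tupleInter ξ w n) :=
  Measurable.tsum fun _ => Finset.measurable_fun_prod _ fun _ _ =>
    measurable_visits (fun i hi => h i (by omega)) _

end Pointwise

variable {Ω : Type*} [mΩ : MeasurableSpace Ω] {P : Measure Ω} {d : ℕ}
  {ξ : ℕ → Ω → Fin d → ℤ} {ι : Type*} [Fintype ι]

lemma lintegral_tupleInter (h : IsIIDSequence P ξ) (w : ι → Fin d → ℤ) (n : ℕ) :
    ∫⁻ ω, tupleInter ξ w n ω ∂P =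
      ∑' x, ∫⁻ ω, ∏ i, visits ξ 1 (n + 1) (x + w i) ω ∂P :=
  lintegral_tsum fun _ => (Finset.measurable_fun_prod _ fun _ _ =>
    measurable_visits (fun i _ => h.measurable i) _).aemeasurable

/-- Summing over the translates of the pattern, the first visit contributes the number of times
available for it. -/
lemma tsum_sum_sum_hitProb [IsProbabilityMeasure P] (h : IsIIDSequence P ξ)
    (w : ι → Fin d → ℤ) (m : ℕ) (B : ℝ≥0∞) :
    ∑' x, ∑ k ∈ Finset.Ico 1 (m + 1), ∑ i, hitProb P ξ k (x + w i) * B =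
      m * (Fintype.card ι * B) := by
  rw [Summable.tsum_finsetSum fun _ _ => ENNReal.summable]
  have : ∀ k ∈ Finset.Ico 1 (m + 1), ∑' x, ∑ i, hitProb P ξ k (x + w i) * B =
      Fintype.card ι * B := fun k _ => by
    rw [Summable.tsum_finsetSum fun _ _ => ENNReal.summable]
    simp_rw [ENNReal.tsum_mul_right, tsum_add_right_eq (hitProb P ξ k), tsum_hitProb h]
    simp
  rw [Finset.sum_congr rfl this]
  simp

lemma lintegral_tupleInter_le [Nonempty ι] [IsProbabilityMeasure P] (h : IsIIDSequence P ξ)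
    (w : ι → Fin d → ℤ) {n : ℕ} {K : ℝ≥0∞} (hK : ∀ i j, green P ξ n (w j - w i) ≤ K) :
    ∫⁻ ω, tupleInter ξ w n ω ∂P ≤
      (Fintype.card ι).factorial * n * K ^ (Fintype.card ι - 1) := by
  classical
  obtain ⟨c, hc : _ = c + 1⟩ := Nat.exists_eq_add_of_le' (Fintype.card_pos (α := ι))
  rw [lintegral_tupleInter h]
  calc _ ≤ ∑' x, ∑ k ∈ Finset.Ico 1 (n + 1), ∑ i,
          hitProb P ξ k (x + w i) * (c.factorial * K ^ c) := by
        refine ENNReal.tsum_le_tsum fun x =>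
          (lintegral_prod_visits_le_sum h Finset.univ_nonempty _ _ _).trans ?_
        refine Finset.sum_le_sum fun k _ => Finset.sum_le_sum fun i _ => ?_
        have hcard : (Finset.univ.erase i).card = c := by
          rw [Finset.card_erase_of_mem (Finset.mem_univ i), Finset.card_univ, hc]; simp
        gcongr
        rw [← hcard]
        refine le_trans (lintegral_mono fun ω => ?_) (lintegral_prod_visits_le_factorial w
          (h.shiftSeq k) (n := n) (fun i j => (green_shiftSeq h k n _).trans_le (hK i j)) _ i)
        refine Finset.prod_le_prod' fun j _ => ?_
        rw [add_sub_add_left_eq_sub]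
        exact visits_mono _ le_rfl (by omega) _ _
    _ = _ := by
        rw [tsum_sum_sum_hitProb h, hc, Nat.factorial_succ]
        rw [Nat.add_sub_cancel]
        push_cast
        ring

lemma le_lintegral_tupleInter [Nonempty ι] [IsProbabilityMeasure P] (h : IsIIDSequence P ξ)
    (w : ι → Fin d → ℤ) {n m : ℕ} {g : ℝ≥0∞}
    (hg : ∀ i j, g ≤ ∑ k ∈ Finset.Ico 1 (m + 1), hitProb P ξ k (w j - w i)) :
    (Fintype.card ι).factorial * ((n - Fintype.card ι * m : ℕ) : ℝ≥0∞) *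
      g ^ (Fintype.card ι - 1) ≤ ∫⁻ ω, tupleInter ξ w n ω ∂P := by
  classical
  obtain ⟨c, hc : _ = c + 1⟩ := Nat.exists_eq_add_of_le' (Fintype.card_pos (α := ι))
  rw [lintegral_tupleInter h]
  calc _ = ∑' x, ∑ k ∈ Finset.Ico 1 (n - Fintype.card ι * m + 1), ∑ i,
          hitProb P ξ k (x + w i) * (c.factorial * g ^ c) := by
        rw [tsum_sum_sum_hitProb h, hc, Nat.factorial_succ]
        rw [Nat.add_sub_cancel]
        push_cast
        ring
    _ ≤ ∑' x, ∑ k ∈ Finset.Ico 1 (n + 1), ∑ i, hitProb P ξ k (x + w i) *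
        ∫⁻ ω, ∏ j ∈ Finset.univ.erase i,
          visits (shiftSeq ξ k) 1 (n + 1 - k) ((x + w j) - (x + w i)) ω ∂P := by
        refine ENNReal.tsum_le_tsum fun x => ?_
        refine le_trans (Finset.sum_le_sum fun k hk => Finset.sum_le_sum fun i _ => ?_)
          (Finset.sum_le_sum_of_subset (Finset.Ico_subset_Ico le_rfl (by omega)))
        have hk' := Finset.mem_Ico.1 hk
        have hcard : (Finset.univ.erase i).card = c := by
          rw [Finset.card_erase_of_mem (Finset.mem_univ i), Finset.card_univ, hc]; simp
        gcongr
        simp only [add_sub_add_left_eq_sub]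
        rw [show n + 1 - k = (n - k) + 1 by omega, ← hcard]
        refine factorial_le_lintegral_prod_visits w (Finset.univ.erase i) i (m := m) ?_
          (h.shiftSeq k) fun i j => ?_
        · rw [hc] at hk'
          rw [hcard]
          have : (c + 1) * m = c * m + m := by ring
          omega
        · simpa only [hitProb_shiftSeq h] using hg i j
    _ ≤ _ := ENNReal.tsum_le_tsum fun x => sum_le_lintegral_prod_visits h _ _ _ _

/-! ### Asymptotics of the mean -/

lemma tendsto_harmonic_div_log :
    Tendsto (fun n : ℕ => (harmonic n : ℝ) / Real.log n) atTop (𝓝 1) := by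
  have hlog : Tendsto (fun n : ℕ => Real.log n) atTop atTop :=
    Real.tendsto_log_atTop.comp tendsto_natCast_atTop_atTop
  have h1 : Tendsto (fun n : ℕ => ((harmonic n : ℝ) - Real.log n) / Real.log n) atTop (𝓝 0) :=
    Real.tendsto_harmonic_sub_log.div_atTop hlog
  have h2 := h1.add_const 1
  rw [zero_add] at h2
  refine h2.congr' ?_
  filter_upwards [hlog.eventually_gt_atTop 0] with n hn
  field_simp
  ring

lemma tendsto_sum_div_log {a : ℕ → ℝ} {l : ℝ}
    (ha : Tendsto (fun k : ℕ => k * a k) atTop (𝓝 l)) :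
    Tendsto (fun n : ℕ => (∑ k ∈ Finset.Ico 1 (n + 1), a k) / Real.log n) atTop (𝓝 l) := by
  have hH : ∀ n : ℕ, (harmonic n : ℝ) = ∑ k ∈ Finset.range n, ((k : ℝ) + 1)⁻¹ := fun n => by
    simp [harmonic]
  have hlog : Tendsto (fun n : ℕ => Real.log n) atTop atTop :=
    Real.tendsto_log_atTop.comp tendsto_natCast_atTop_atTop
  have hHtop : Tendsto (fun n : ℕ => (harmonic n : ℝ)) atTop atTop :=
    tendsto_atTop_mono (fun n => log_add_one_le_harmonic n) <| Real.tendsto_log_atTop.comp <|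
      tendsto_natCast_atTop_atTop.comp (tendsto_add_atTop_nat 1)
  have ho : (fun k : ℕ => a (k + 1) - l * ((k : ℝ) + 1)⁻¹) =o[atTop]
      fun k : ℕ => ((k : ℝ) + 1)⁻¹ := by
    rw [isLittleO_iff_tendsto fun k hk => by
      have : ((k : ℝ) + 1)⁻¹ ≠ 0 := by positivity
      exact absurd hk this]
    have := ((tendsto_add_atTop_iff_nat 1).2 ha).sub_const l
    rw [sub_self] at this
    refine this.congr fun k => ?_
    push_cast
    field_simp
  have hs := ho.sum_range (fun k => by positivity) (by simpa only [← hH] using hHtop)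
  simp only [Finset.sum_sub_distrib, ← Finset.mul_sum, ← hH] at hs
  have h1 := hs.tendsto_div_nhds_zero
  have h2 := (h1.add_const l).mul tendsto_harmonic_div_log
  rw [zero_add, mul_one] at h2
  refine h2.congr' ?_
  filter_upwards [hHtop.eventually_gt_atTop 0] with n hn
  rw [Finset.sum_Ico_eq_sum_range, Nat.add_sub_cancel]
  simp only [add_comm 1]
  field_simp
  ring

/-- A random walk whose return probabilities behave as those of a recurrent walk in the domain
of attraction of a two-dimensional normal or one-dimensional Cauchy law. -/
structure LogRecurrent (P : Measure Ω) (ξ : ℕ → Ω → Fin d → ℤ) (l C : ℝ) : Prop where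
  pos : 0 < l
  bound : ∀ (k : ℕ) x, k * (hitProb P ξ k x).toReal ≤ C
  tendsto : ∀ x, Tendsto (fun k : ℕ => k * (hitProb P ξ k x).toReal) atTop (𝓝 l)

lemma hitProb_ne_top [IsProbabilityMeasure P] (k : ℕ) (x : Fin d → ℤ) :
    hitProb P ξ k x ≠ ∞ := measure_ne_top _ _

lemma toReal_sum_hitProb [IsProbabilityMeasure P] (s : Finset ℕ) (x : Fin d → ℤ) :
    (∑ k ∈ s, hitProb P ξ k x).toReal = ∑ k ∈ s, (hitProb P ξ k x).toReal :=
  ENNReal.toReal_sum fun k _ => hitProb_ne_top k x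

lemma tendsto_log_natCast : Tendsto (fun n : ℕ => Real.log n) atTop atTop :=
  Real.tendsto_log_atTop.comp tendsto_natCast_atTop_atTop

lemma tendsto_log_div_const (M : ℕ) (hM : 0 < M) :
    Tendsto (fun n : ℕ => Real.log ((n / M : ℕ) : ℝ) / Real.log n) atTop (𝓝 1) := by
  have hM' : (0 : ℝ) < M := by exact_mod_cast hM
  have h2 : Tendsto (fun n : ℕ => (Real.log n - Real.log (2 * M)) / Real.log n) atTop (𝓝 1) := by
    have : Tendsto (fun n : ℕ => 1 - Real.log (2 * M) / Real.log n) atTop (𝓝 (1 - 0)) :=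
      tendsto_const_nhds.sub (tendsto_const_nhds.div_atTop tendsto_log_natCast)
    rw [sub_zero] at this
    refine this.congr' ?_
    filter_upwards [tendsto_log_natCast.eventually_gt_atTop 0] with n hn
    rw [sub_div, div_self hn.ne']
  refine tendsto_of_tendsto_of_tendsto_of_le_of_le' h2 tendsto_const_nhds ?_ ?_
  all_goals
    filter_upwards [tendsto_log_natCast.eventually_gt_atTop 0, eventually_ge_atTop M] with n hn hnM
    have h1 : 1 ≤ n / M := (Nat.one_le_div_iff hM).2 hnM
    have h1' : (1 : ℝ) ≤ (n / M : ℕ) := by exact_mod_cast h1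
    have hn0 : (0 : ℝ) < n := by exact_mod_cast hM.trans_le hnM
  · gcongr
    rw [← Real.log_div hn0.ne' (by positivity)]
    refine Real.log_le_log (by positivity) ?_
    rw [div_le_iff₀ (by positivity)]
    have h3 : n < (n / M + 1) * M := Nat.lt_mul_of_div_lt (Nat.lt_succ_self _) hM
    have h4 : (n : ℝ) < ((n / M : ℕ) + 1) * M := by exact_mod_cast h3
    nlinarith
  · rw [div_le_one hn]
    exact Real.log_le_log (by positivity) (by exact_mod_cast Nat.div_le_self n M)

lemma LogRecurrent.tendsto_green [IsProbabilityMeasure P] {l C : ℝ} (hl : LogRecurrent P ξ l C)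
    (x : Fin d → ℤ) :
    Tendsto (fun n : ℕ => (green P ξ n x).toReal / Real.log n) atTop (𝓝 l) := by
  have h1 := tendsto_sum_div_log (hl.tendsto x)
  have h2 : Tendsto (fun n : ℕ => (hitProb P ξ 0 x).toReal / Real.log n) atTop (𝓝 0) :=
    tendsto_const_nhds.div_atTop tendsto_log_natCast
  have := h2.add h1
  rw [zero_add] at this
  refine this.congr fun n => ?_
  rw [green, toReal_sum_hitProb, Finset.sum_eq_sum_Ico_succ_bot (Nat.succ_pos n), zero_add,
    add_div]

/-- The mean of the sum over the lattice of products of `p` numbers of visits is asymptotic to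
`p! lᵖ⁻¹ n (log n)ᵖ⁻¹`: there are `p!` orders in which the `p` points can be visited, and every gap
between successive visits contributes a factor `l log n`. -/
lemma LogRecurrent.tendsto_lintegral_tupleInter [IsProbabilityMeasure P] [Nonempty ι] {l C : ℝ}
    (hl : LogRecurrent P ξ l C) (h : IsIIDSequence P ξ) (w : ι → Fin d → ℤ) :
    Tendsto (fun n : ℕ => (∫⁻ ω, tupleInter ξ w n ω ∂P).toReal /
        (n * Real.log n ^ (Fintype.card ι - 1))) atTop
      (𝓝 ((Fintype.card ι).factorial * l ^ (Fintype.card ι - 1))) := by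
  obtain ⟨c, hc : _ = c + 1⟩ := Nat.exists_eq_add_of_le' (Fintype.card_pos (α := ι))
  simp only [hc, Nat.add_sub_cancel]
  have hfin : ∀ n, ∫⁻ ω, tupleInter ξ w n ω ∂P ≠ ∞ := fun n => by
    refine ((lintegral_mono fun ω => tupleInter_le ξ w n ω).trans_lt ?_).ne
    rw [lintegral_const, measure_univ, mul_one]
    exact ENNReal.pow_lt_top (ENNReal.natCast_lt_top n)
  refine tendsto_order.2 ⟨fun a ha => ?_, fun b hb => ?_⟩
  · -- leave out the times within distance `(c + 1) n / M` of the end, and the gaps over `n / M`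
    have hlim : Tendsto (fun M : ℕ => ((c + 1).factorial : ℝ) * (1 - (c + 1) * (M : ℝ)⁻¹) *
        (l - (M : ℝ)⁻¹) ^ c) atTop (𝓝 ((c + 1).factorial * (1 - (c + 1) * 0) * (l - 0) ^ c)) := by
      have := tendsto_inv_atTop_nhds_zero_nat (𝕜 := ℝ)
      exact (tendsto_const_nhds.mul (tendsto_const_nhds.sub (this.const_mul _))).mul
        ((tendsto_const_nhds.sub this).pow c)
    rw [mul_zero, sub_zero, sub_zero, mul_one] at hlim
    obtain ⟨M, hMa, hM0, hMl⟩ := ((hlim.eventually_const_lt ha).and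
      ((eventually_gt_atTop 0).and ((tendsto_inv_atTop_nhds_zero_nat (𝕜 := ℝ)).eventually_lt_const
        hl.pos))).exists
    have hM0' : (0 : ℝ) < M := by exact_mod_cast hM0
    have hev : ∀ i j, ∀ᶠ n : ℕ in atTop, (l - (M : ℝ)⁻¹) * Real.log n ≤
        ∑ k ∈ Finset.Ico 1 (n / M + 1), (hitProb P ξ k (w j - w i)).toReal := fun i j => by
      have h1 := (tendsto_sum_div_log (hl.tendsto (w j - w i))).comp
        (Nat.tendsto_div_const_atTop hM0.ne')
      have h2 := h1.mul (tendsto_log_div_const M hM0)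
      rw [mul_one] at h2
      filter_upwards [h2.eventually_const_lt (sub_lt_self l (inv_pos.2 hM0')),
        tendsto_log_natCast.eventually_gt_atTop 0, (tendsto_log_natCast.comp
          (Nat.tendsto_div_const_atTop hM0.ne')).eventually_gt_atTop 0] with n hn hn0 hn1
      simp only [Function.comp] at hn hn1
      rw [div_mul_div_cancel₀ hn1.ne', lt_div_iff₀ hn0] at hn
      exact hn.le
    filter_upwards [eventually_all.2 fun i => eventually_all.2 (hev i),
      tendsto_log_natCast.eventually_gt_atTop 0, eventually_gt_atTop 0] with n hn hlog hn0
    have hn0' : (0 : ℝ) < n := by exact_mod_cast hn0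
    have hg : ∀ i j, ENNReal.ofReal ((l - (M : ℝ)⁻¹) * Real.log n) ≤
        ∑ k ∈ Finset.Ico 1 (n / M + 1), hitProb P ξ k (w j - w i) := fun i j => by
      rw [← ENNReal.ofReal_toReal (ENNReal.sum_ne_top.2 fun k _ => hitProb_ne_top k _),
        toReal_sum_hitProb]
      exact ENNReal.ofReal_le_ofReal (hn i j)
    have key := ENNReal.toReal_mono (hfin n) (le_lintegral_tupleInter h w (n := n) hg)
    have hgpos : 0 < (l - (M : ℝ)⁻¹) * Real.log n := mul_pos (sub_pos.2 hMl) hlog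
    simp only [hc, Nat.add_sub_cancel, ENNReal.toReal_mul, ENNReal.toReal_natCast,
      ENNReal.toReal_pow, ENNReal.toReal_ofReal hgpos.le] at key
    rw [lt_div_iff₀ (by positivity)]
    refine lt_of_lt_of_le ?_ key
    have h3 : (n : ℝ) * (1 - (c + 1) * (M : ℝ)⁻¹) ≤ ((n - (c + 1) * (n / M) : ℕ) : ℝ) := by
      have h4 : (n : ℝ) ≤ ((n - (c + 1) * (n / M) : ℕ) : ℝ) + (c + 1) * (n / M : ℕ) := by
        exact_mod_cast (le_tsub_add : n ≤ n - (c + 1) * (n / M) + (c + 1) * (n / M))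
      have h5 : ((n / M : ℕ) : ℝ) ≤ n * (M : ℝ)⁻¹ := Nat.cast_div_le
      nlinarith
    calc a * (n * Real.log n ^ c) < ((c + 1).factorial : ℝ) * (1 - (c + 1) * (M : ℝ)⁻¹) *
        (l - (M : ℝ)⁻¹) ^ c * (n * Real.log n ^ c) := by gcongr
      _ = (c + 1).factorial * (n * (1 - (c + 1) * (M : ℝ)⁻¹)) *
          ((l - (M : ℝ)⁻¹) * Real.log n) ^ c := by rw [mul_pow]; ring
      _ ≤ _ := by gcongr
  · have hcont : Tendsto (fun K : ℝ => ((c + 1).factorial : ℝ) * K ^ c) (𝓝[>] l)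
        (𝓝 ((c + 1).factorial * l ^ c)) :=
      ((continuous_const.mul (continuous_pow c)).tendsto l).mono_left nhdsWithin_le_nhds
    obtain ⟨K, hKb, hKl⟩ := ((hcont.eventually_lt_const hb).and self_mem_nhdsWithin).exists
    have hKl : l < K := hKl
    have hev : ∀ i j, ∀ᶠ n : ℕ in atTop,
        (green P ξ n (w j - w i)).toReal / Real.log n < K := fun i j =>
      (hl.tendsto_green (w j - w i)).eventually_lt_const hKl
    filter_upwards [eventually_all.2 fun i => eventually_all.2 (hev i),
      tendsto_log_natCast.eventually_gt_atTop 0, eventually_gt_atTop 0] with n hn hlog hn0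
    have hn0' : (0 : ℝ) < n := by exact_mod_cast hn0
    have hg : ∀ i j, green P ξ n (w j - w i) ≤ ENNReal.ofReal (K * Real.log n) := fun i j => by
      rw [← ENNReal.ofReal_toReal (a := green P ξ n (w j - w i))
        (ENNReal.sum_ne_top.2 fun k _ => hitProb_ne_top k _)]
      exact ENNReal.ofReal_le_ofReal ((div_lt_iff₀ hlog).1 (hn i j)).le
    have hKpos : 0 < K * Real.log n := mul_pos (hl.pos.trans hKl) hlog
    have key := ENNReal.toReal_mono ?_ (lintegral_tupleInter_le h w hg)
    · simp only [hc, Nat.add_sub_cancel, ENNReal.toReal_mul, ENNReal.toReal_natCast,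
        ENNReal.toReal_pow, ENNReal.toReal_ofReal hKpos.le] at key
      rw [div_lt_iff₀ (by positivity)]
      refine key.trans_lt ?_
      calc _ = ((c + 1).factorial : ℝ) * K ^ c * (n * Real.log n ^ c) := by rw [mul_pow]; ring
        _ < _ := by gcongr
    · exact ENNReal.mul_ne_top (ENNReal.mul_ne_top (by simp) (by simp)) (by simp)

end

section

/-! ### Elementary inequalities for squares -/

lemma mul_le_sq_add_sq (a b : ℝ≥0∞) : a * b ≤ a ^ 2 + b ^ 2 := by
  rcases le_total a b with h | h
  · exact (mul_le_mul_left h b).trans (by rw [← sq]; exact le_add_self)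
  · exact (mul_le_mul_right h a).trans (by rw [← sq]; exact le_self_add)

lemma sq_sum_le {κ : Type*} (s : Finset κ) (f : κ → ℝ≥0∞) :
    (∑ i ∈ s, f i) ^ 2 ≤ 2 * s.card * ∑ i ∈ s, f i ^ 2 := by
  calc (∑ i ∈ s, f i) ^ 2 = ∑ i ∈ s, ∑ j ∈ s, f i * f j := by rw [sq, Finset.sum_mul_sum]
    _ ≤ ∑ i ∈ s, ∑ j ∈ s, (f i ^ 2 + f j ^ 2) :=
        Finset.sum_le_sum fun i _ => Finset.sum_le_sum fun j _ => mul_le_sq_add_sq _ _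
    _ = _ := by
        simp only [Finset.sum_add_distrib, Finset.sum_const, nsmul_eq_mul, ← Finset.mul_sum]
        ring

lemma sq_add_le (a b : ℝ≥0∞) : (a + b) ^ 2 ≤ 3 * (a ^ 2 + b ^ 2) := by
  calc (a + b) ^ 2 = a ^ 2 + b ^ 2 + 2 * (a * b) := by ring
    _ ≤ a ^ 2 + b ^ 2 + 2 * (a ^ 2 + b ^ 2) := by gcongr; exact mul_le_sq_add_sq a b
    _ = _ := by ring

lemma tsum_sub_right_eq {d : ℕ} (f : (Fin d → ℤ) → ℝ≥0∞) (z : Fin d → ℤ) :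
    ∑' x, f (x - z) = ∑' x, f x :=
  (Equiv.subRight z).tsum_eq f

/-! ### Moments of the numbers of visits to the neighbourhoods of two points -/

section TwoPoints

variable {Ω : Type*} [mΩ : MeasurableSpace Ω] {P : Measure Ω} [IsProbabilityMeasure P] {d : ℕ}
  {ξ : ℕ → Ω → Fin d → ℤ}

/-- If the points to be visited have two colours, and passing from colour `c i` to the other one
costs at most `H (c i) ≤ K` while every passage costs at most `K`, then one of the passages may be
counted with the smaller cost. -/
lemma lintegral_prod_visits_le_of_colour (h : IsIIDSequence P ξ) {κ : Type*} [DecidableEq κ]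
    (z : κ → Fin d → ℤ) (c : κ → Bool) {n : ℕ} {K : ℝ≥0∞} {H : Bool → ℝ≥0∞}
    (hK : ∀ i j, green P ξ n (z j - z i) ≤ K) (hHK : ∀ b, H b ≤ K)
    (hH : ∀ i j, c j ≠ c i → green P ξ n (z j - z i) ≤ H (c i))
    (s : Finset κ) (hs : ∀ i ∈ s, ∃ j ∈ s, c j ≠ c i) {q : ℕ} (hq : s.card = q + 2) :
    ∫⁻ ω, ∏ i ∈ s, visits ξ 0 (n + 1) (z i) ω ∂P ≤
      (q + 1).factorial * K ^ q * ∑ i ∈ s, green P ξ n (z i) * H (c i) := by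
  classical
  have hs0 : s.Nonempty := Finset.card_pos.1 (by omega)
  set B : κ → Finset κ → ℝ≥0∞ := fun i s =>
    s.card.factorial * (if ∃ j ∈ s, c j ≠ c i then K ^ (s.card - 1) * H (c i) else K ^ s.card)
    with hB
  have hBle : ∀ i s, B i s ≤ s.card.factorial * K ^ s.card := by
    intro i s
    simp only [hB]
    gcongr
    split_ifs with hex
    · obtain ⟨j, hj, -⟩ := hex
      obtain ⟨r, hr⟩ := Nat.exists_eq_add_of_le' (Finset.card_pos.2 ⟨j, hj⟩)
      rw [hr, Nat.succ_eq_add_one, zero_add, Nat.add_sub_cancel, pow_succ]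
      gcongr
      exact hHK _
    · exact le_rfl
  have hsuper : ∀ i₀ s, s.Nonempty →
      ∑ i ∈ s, green P ξ n (z i - z i₀) * B i (s.erase i) ≤ B i₀ s := by
    intro i₀ s hs
    obtain ⟨r, hr : _ = r + 1⟩ := Nat.exists_eq_add_of_le' (Finset.card_pos.2 hs)
    have hcard : ∀ i ∈ s, (s.erase i).card = r := fun i hi => by
      rw [Finset.card_erase_of_mem hi, hr, Nat.add_sub_cancel]
    have hsum : ∀ D : ℝ≥0∞, (∀ i ∈ s, green P ξ n (z i - z i₀) * B i (s.erase i) ≤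
        r.factorial * D) → ∑ i ∈ s, green P ξ n (z i - z i₀) * B i (s.erase i) ≤
        s.card.factorial * D := fun D hD => by
      refine (Finset.sum_le_sum hD).trans (le_of_eq ?_)
      rw [Finset.sum_const, hr, nsmul_eq_mul, Nat.factorial_succ]
      push_cast
      ring
    refine hsum _ fun i hi => ?_
    have hle := hBle i (s.erase i)
    rw [hcard i hi] at hle
    split_ifs with hex
    · rw [hr, Nat.add_sub_cancel]
      by_cases hi0 : c i = c i₀
      · obtain ⟨j, hj, hji⟩ := hex
        have hjmem : j ∈ s.erase i :=
          Finset.mem_erase.2 ⟨fun hji' => hji (by rw [hji', hi0]), hj⟩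
        have hr1 : 1 ≤ r := hcard i hi ▸ Finset.card_pos.2 ⟨j, hjmem⟩
        obtain ⟨t, rfl⟩ := Nat.exists_eq_add_of_le' hr1
        have hBi : B i (s.erase i) = (t + 1).factorial * (K ^ t * H (c i₀)) := by
          simp only [hB, hcard i hi]
          rw [if_pos ⟨j, hjmem, hi0 ▸ hji⟩, hi0, Nat.add_sub_cancel]
        rw [hBi]
        calc _ ≤ K * ((t + 1).factorial * (K ^ t * H (c i₀))) := by gcongr; exact hK _ _
          _ = _ := by ring
      · calc _ ≤ H (c i₀) * (r.factorial * K ^ r) := by gcongr; exact hH _ _ hi0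
          _ = _ := by ring
    · rw [hr]
      calc _ ≤ K * (r.factorial * K ^ r) := by gcongr; exact hK _ _
        _ = _ := by ring
  refine (lintegral_prod_visits_le_sum h hs0 _ 0 (n + 1)).trans ?_
  rw [Finset.sum_comm, Finset.mul_sum]
  refine Finset.sum_le_sum fun i hi => ?_
  have hcard : (s.erase i).card = q + 1 := by rw [Finset.card_erase_of_mem hi, hq]; rfl
  have hBi : B i (s.erase i) = (q + 1).factorial * (K ^ q * H (c i)) := by
    obtain ⟨j, hj, hji⟩ := hs i hi
    simp only [hB, hcard]
    rw [if_pos ⟨j, Finset.mem_erase.2 ⟨fun hji' => hji (by rw [hji']), hj⟩, hji⟩,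
      Nat.add_sub_cancel]
  calc _ ≤ ∑ k ∈ Finset.Ico 0 (n + 1), hitProb P ξ k (z i) * B i (s.erase i) := by
        gcongr with k
        refine le_trans (lintegral_mono fun ω => ?_) (lintegral_prod_visits_le z n B (by simp [hB])
          hsuper (s.erase i) i (h.shiftSeq k) fun x => green_shiftSeq h k n x)
        exact Finset.prod_le_prod' fun j _ => visits_mono _ le_rfl (by omega) _ _
    _ = _ := by rw [← Finset.sum_mul, hBi, green]; ring

variable {ι : Type*} [Fintype ι]

/-- The Green function summed over the points of the pattern `w`, translated by `x`. -/
noncomputable def patternGreen (P : Measure Ω) (ξ : ℕ → Ω → Fin d → ℤ) (w : ι → Fin d → ℤ)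
    (n : ℕ) (x : Fin d → ℤ) : ℝ≥0∞ :=
  ∑ i, green P ξ n (x + w i)

/-- The differences of the points of the pattern `w`, indexed by the pairs of labels. -/
def diffPattern (w : ι → Fin d → ℤ) : ι × ι → Fin d → ℤ := fun i => w i.2 - w i.1

/-- The walk has to reach the neighbourhood of one of the points `x` and `y` and then to pass to
that of the other; all further steps are estimated by the largest Green function. -/
lemma lintegral_two_point_le (h : IsIIDSequence P ξ) (w : ι → Fin d → ℤ) {n : ℕ} {K : ℝ≥0∞}
    (hK : ∀ u, patternGreen P ξ (diffPattern w) n u ≤ K) (A : Finset ι) {r : ℕ}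
    (hA : A.card = r + 1) (x y : Fin d → ℤ) :
    ∫⁻ ω, (∏ i ∈ A, visits ξ 0 (n + 1) (x + w i) ω) *
        ∏ i ∈ A, visits ξ 0 (n + 1) (y + w i) ω ∂P ≤
      (2 * r + 1).factorial * K ^ (2 * r) *
        (patternGreen P ξ w n x * patternGreen P ξ (diffPattern w) n (y - x) +
          patternGreen P ξ w n y * patternGreen P ξ (diffPattern w) n (x - y)) := by
  classical
  have hle : ∀ u i j, green P ξ n (u + (w j - w i)) ≤ patternGreen P ξ (diffPattern w) n u :=
    fun u i j => Finset.single_le_sum (f := fun p : ι × ι => green P ξ n (u + diffPattern w p))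
      (fun _ _ => zero_le) (Finset.mem_univ (i, j))
  set z : ι ⊕ ι → Fin d → ℤ := Sum.elim (fun i => x + w i) (fun i => y + w i) with hz
  obtain ⟨i₀, hi₀⟩ : A.Nonempty := Finset.card_pos.1 (by omega)
  have key := lintegral_prod_visits_le_of_colour h z Sum.isRight (n := n) (K := K)
    (H := fun b => patternGreen P ξ (diffPattern w) n (if b then x - y else y - x)) ?_
    (fun b => hK _) ?_ (A.disjSum A) ?_ (q := 2 * r) (by rw [Finset.card_disjSum, hA]; ring)
  · simp only [Finset.prod_disjSum, Finset.sum_disjSum, hz, Sum.elim_inl, Sum.elim_inr,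
      Sum.isRight_inl, Sum.isRight_inr, if_true, Bool.false_eq_true, if_false,
      ← Finset.sum_mul] at key
    refine key.trans ?_
    gcongr <;> exact Finset.sum_le_sum_of_subset (Finset.subset_univ A)
  · rintro (i | i) (j | j)
    · simpa [hz] using (hle 0 i j).trans (hK 0)
    · simpa [hz, add_sub_add_comm] using (hle (y - x) i j).trans (hK _)
    · simpa [hz, add_sub_add_comm] using (hle (x - y) i j).trans (hK _)
    · simpa [hz] using (hle 0 i j).trans (hK 0)
  · rintro (i | i) (j | j) hij
    · simp at hij
    · simpa [hz, add_sub_add_comm] using hle (y - x) i j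
    · simpa [hz, add_sub_add_comm] using hle (x - y) i j
    · simp at hij
  · rintro (i | i) -
    · exact ⟨Sum.inr i₀, by simpa using hi₀, by simp⟩
    · exact ⟨Sum.inl i₀, by simpa using hi₀, by simp⟩

/-! ### Bounds for the Green function -/

/-- The transition probabilities are at most of the order of the inverse of time. -/
def HitBound (P : Measure Ω) (ξ : ℕ → Ω → Fin d → ℤ) (D : ℝ≥0∞) : Prop :=
  ∀ (k : ℕ) x, (k : ℝ≥0∞) * hitProb P ξ k x ≤ D

lemma hitProb_le_one (k : ℕ) (x : Fin d → ℤ) : hitProb P ξ k x ≤ 1 := prob_le_one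

omit [IsProbabilityMeasure P] in
lemma green_succ (n : ℕ) (x : Fin d → ℤ) :
    green P ξ (n + 1) x = green P ξ n x + hitProb P ξ (n + 1) x :=
  Finset.sum_Ico_succ_top (Nat.zero_le _) _

lemma HitBound.green_le {D : ℝ≥0∞} (hD : HitBound P ξ D) (n : ℕ) (x : Fin d → ℤ) :
    green P ξ n x ≤ (1 + D) * ENNReal.ofReal (1 + Real.log n) := by
  have h1 : ∀ n : ℕ, green P ξ n x ≤ 1 + D * ENNReal.ofReal (harmonic n : ℝ) := fun n => by
    induction n with
    | zero => simpa [green] using hitProb_le_one 0 x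
    | succ n ih =>
      rw [green_succ, harmonic_succ]
      push_cast
      have h0 : (0 : ℝ) ≤ (harmonic n : ℝ) := by
        exact_mod_cast Finset.sum_nonneg fun i _ => by positivity
      rw [ENNReal.ofReal_add h0 (by positivity), mul_add, ← add_assoc]
      gcongr
      rw [ENNReal.ofReal_inv_of_pos (by positivity), ← div_eq_mul_inv,
        ENNReal.le_div_iff_mul_le (Or.inl (by simp; norm_cast; omega)) (Or.inl (by simp)), mul_comm]
      have := hD (n + 1) x
      convert this
      rw [← Nat.cast_add_one, ENNReal.ofReal_natCast]
  have h2 : 0 ≤ Real.log n := Real.log_natCast_nonneg n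
  calc green P ξ n x ≤ 1 + D * ENNReal.ofReal (harmonic n : ℝ) := h1 n
    _ ≤ 1 * ENNReal.ofReal (1 + Real.log n) + D * ENNReal.ofReal (1 + Real.log n) := by
        gcongr
        · rw [one_mul, ENNReal.one_le_ofReal]; linarith
        · exact_mod_cast harmonic_le_one_add_log n
    _ = _ := by ring

lemma tsum_green (h : IsIIDSequence P ξ) (n : ℕ) : ∑' x, green P ξ n x = n + 1 := by
  unfold green
  rw [Summable.tsum_finsetSum fun _ _ => ENNReal.summable]
  simp [tsum_hitProb h]

/-- The sum of the squares of the Green function is the mean number of pairs of times at which two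
independent walks are at the same point. It grows by `O(1)` with each step, the Green function having total mass `n + 1` and the
transition probability being at most `D / (n + 1)`. -/
lemma HitBound.tsum_green_sq_le {D : ℝ≥0∞} (hD : HitBound P ξ D) (h : IsIIDSequence P ξ)
    (n : ℕ) : ∑' x, green P ξ n x ^ 2 ≤ 1 + 3 * D * n := by
  induction n with
  | zero =>
    calc ∑' x, green P ξ 0 x ^ 2 ≤ ∑' x, hitProb P ξ 0 x := by
          refine ENNReal.tsum_le_tsum fun x => ?_
          simp only [green, zero_add, Nat.Ico_zero_eq_range, Finset.range_one,
            Finset.sum_singleton]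
          exact pow_le_of_le_one zero_le (hitProb_le_one 0 x) two_ne_zero
      _ ≤ _ := by simp [tsum_hitProb h]
  | succ n ih =>
    have hstep : ∀ x, green P ξ (n + 1) x ^ 2 =
        green P ξ n x ^ 2 + (2 * green P ξ n x + hitProb P ξ (n + 1) x) *
          hitProb P ξ (n + 1) x := fun x => by rw [green_succ]; ring
    have hn : ((n + 1 : ℕ) : ℝ≥0∞) ≠ 0 := by simp
    have hsmall : ∑' x, (2 * green P ξ n x + hitProb P ξ (n + 1) x) * hitProb P ξ (n + 1) x ≤
        3 * D := by
      calc _ ≤ ∑' x, (2 * green P ξ n x + hitProb P ξ (n + 1) x) * (D / (n + 1 : ℕ)) := by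
            gcongr with x
            rw [ENNReal.le_div_iff_mul_le (Or.inl hn) (Or.inl (by finiteness)), mul_comm]
            exact hD (n + 1) x
        _ = (2 * (n + 1) + 1) * (D / (n + 1 : ℕ)) := by
            rw [ENNReal.tsum_mul_right, ENNReal.tsum_add, ENNReal.tsum_mul_left, tsum_green h,
              tsum_hitProb h]
        _ ≤ (2 * (n + 1) + (n + 1)) * (D / (n + 1 : ℕ)) := by gcongr; exact le_add_self
        _ = 3 * (((n + 1 : ℕ) : ℝ≥0∞) * (D / (n + 1 : ℕ))) := by push_cast; ring
        _ = 3 * D := by rw [ENNReal.mul_div_cancel hn (by finiteness)]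
    simp_rw [hstep]
    rw [ENNReal.tsum_add]
    calc _ ≤ 1 + 3 * D * n + 3 * D := by gcongr
      _ = _ := by push_cast; ring

lemma HitBound.patternGreen_le {D : ℝ≥0∞} (hD : HitBound P ξ D) (n : ℕ)
    (w : ι → Fin d → ℤ) (x : Fin d → ℤ) :
    patternGreen P ξ w n x ≤
      Fintype.card ι * ((1 + D) * ENNReal.ofReal (1 + Real.log n)) := by
  unfold patternGreen
  refine (Finset.sum_le_sum fun i _ => hD.green_le n _).trans ?_
  simp

lemma HitBound.tsum_patternGreen_sq_le {D : ℝ≥0∞} (hD : HitBound P ξ D) (h : IsIIDSequence P ξ)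
    {n : ℕ} (hn : 1 ≤ n) (w : ι → Fin d → ℤ) :
    ∑' x, patternGreen P ξ w n x ^ 2 ≤
      2 * (Fintype.card ι : ℝ≥0∞) ^ 2 * ((1 + 3 * D) * n) := by
  have hn' : (1 : ℝ≥0∞) ≤ n := by exact_mod_cast hn
  calc _ ≤ ∑' x, 2 * (Fintype.card ι : ℝ≥0∞) * ∑ i, green P ξ n (x + w i) ^ 2 :=
        ENNReal.tsum_le_tsum fun x => sq_sum_le _ _
    _ = 2 * (Fintype.card ι : ℝ≥0∞) * ∑ i : ι, ∑' x, green P ξ n x ^ 2 := by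
        rw [ENNReal.tsum_mul_left, Summable.tsum_finsetSum fun _ _ => ENNReal.summable]
        simp_rw [tsum_add_right_eq (fun x => green P ξ n x ^ 2)]
    _ ≤ 2 * (Fintype.card ι : ℝ≥0∞) * ∑ i : ι, (1 + 3 * D * n) := by
        gcongr
        exact hD.tsum_green_sq_le h n
    _ = 2 * (Fintype.card ι : ℝ≥0∞) ^ 2 * (1 + 3 * D * n) := by
        rw [Finset.sum_const, Finset.card_univ, nsmul_eq_mul]; ring
    _ ≤ 2 * (Fintype.card ι : ℝ≥0∞) ^ 2 * (1 * n + 3 * D * n) := by gcongr; rwa [one_mul]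
    _ = _ := by ring

end TwoPoints

end

section

/-! ### The walk seen from an intermediate time -/

section Reversal

variable {Ω : Type*} {d : ℕ}

/-- The involution of `ℕ` that reverses `{0, …, m - 1}` and fixes the other numbers. -/
def revIdx (m i : ℕ) : ℕ := if i < m then m - 1 - i else i

lemma revIdx_injective (m : ℕ) : Function.Injective (revIdx m) := by
  intro i j hij
  unfold revIdx at hij
  split_ifs at hij <;> omega

/-- The jumps of the walk run backwards from time `m`. Only the first `m` of them matter; the
others are chosen so that the sequence is again independent and identically distributed. -/
def revSeq (ξ : ℕ → Ω → Fin d → ℤ) (m : ℕ) : ℕ → Ω → Fin d → ℤ :=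
  fun i ω => -ξ (revIdx m i) ω

lemma walk_revSeq (ξ : ℕ → Ω → Fin d → ℤ) {m k : ℕ} (hk : k ≤ m) (ω : Ω) :
    walk (revSeq ξ m) k ω = walk ξ (m - k) ω - walk ξ m ω := by
  induction k with
  | zero => simp [walk]
  | succ k ih =>
    obtain ⟨r, rfl⟩ := Nat.exists_eq_add_of_le' hk
    rw [walk_succ, ih (by omega), show r + (k + 1) - k = r + 1 by omega, walk_succ,
      Nat.add_sub_cancel, revSeq, revIdx, if_pos (by omega),
      show r + (k + 1) - 1 - k = r by omega]
    abel

lemma visits_eq_visits_revSeq (ξ : ℕ → Ω → Fin d → ℤ) (m : ℕ) (z : Fin d → ℤ) (ω : Ω) :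
    visits ξ 1 (m + 1) z ω = visits (revSeq ξ m) 0 m (z - walk ξ m ω) ω := by
  unfold visits
  have h := Finset.sum_Ico_reflect (fun k => if walk ξ k ω = z then (1 : ℝ≥0∞) else 0) 0
    (Nat.le_succ m)
  rw [Nat.add_sub_cancel_left, Nat.sub_zero] at h
  rw [← h]
  refine Finset.sum_congr rfl fun k hk => ?_
  simp only [walk_revSeq ξ (Finset.mem_Ico.1 hk).2.le, sub_left_inj]

lemma visits_add (ξ : ℕ → Ω → Fin d → ℤ) (m n : ℕ) (z : Fin d → ℤ) (ω : Ω) :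
    visits ξ 1 (m + n + 1) z ω = visits (revSeq ξ m) 0 m (z - walk ξ m ω) ω +
      visits (shiftSeq ξ m) 1 (n + 1) (z - walk ξ m ω) ω := by
  have h2 : visits ξ (m + 1) (m + n + 1) z ω =
      visits (shiftSeq ξ m) 1 (n + 1) (z - walk ξ m ω) ω := by
    rw [visits_eq_visits_shiftSeq (Nat.le_succ m) rfl]
    congr 1 <;> omega
  rw [← visits_eq_visits_revSeq, ← h2]
  exact (Finset.sum_Ico_consecutive _ (by omega) (by omega)).symm

variable {ι : Type*} [Fintype ι] [DecidableEq ι]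

/-- The part of the pattern count in which the points with label in `A` are visited before
time `m` and the other ones in the `n` steps after it. -/
noncomputable def crossInter (ξ : ℕ → Ω → Fin d → ℤ) (w : ι → Fin d → ℤ) (m n : ℕ)
    (A : Finset ι) (ω : Ω) : ℝ≥0∞ :=
  ∑' x, (∏ i ∈ A, visits (revSeq ξ m) 0 m (x + w i) ω) *
    ∏ i ∈ Aᶜ, visits (shiftSeq ξ m) 1 (n + 1) (x + w i) ω

/-- Every factor `l(m + n, x + w i)` is a sum of visits before and after time `m`. Expanding the
product, the set `A` of the points visited before time `m` is everything, nothing, or a proper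
non-empty subset. -/
lemma tupleInter_add [Nonempty ι] (ξ : ℕ → Ω → Fin d → ℤ) (w : ι → Fin d → ℤ) (m n : ℕ) (ω : Ω) :
    tupleInter ξ w (m + n) ω = tupleInter ξ w m ω + tupleInter (shiftSeq ξ m) w n ω +
      ∑ A ∈ (Finset.univ.erase ∅).erase Finset.univ, crossInter ξ w m n A ω := by
  have h1 : tupleInter ξ w (m + n) ω = ∑ A, crossInter ξ w m n A ω := by
    unfold tupleInter crossInter
    rw [← Summable.tsum_finsetSum fun _ _ => ENNReal.summable]
    refine Eq.trans (tsum_congr fun x => ?_) (tsum_sub_right_eq _ (walk ξ m ω))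
    simp_rw [visits_add, Finset.prod_add, Finset.powerset_univ, Finset.compl_eq_univ_sdiff,
      add_sub_right_comm]
  have h2 : crossInter ξ w m n Finset.univ ω = tupleInter ξ w m ω := by
    unfold tupleInter crossInter
    rw [← tsum_sub_right_eq _ (walk ξ m ω)]
    simp_rw [visits_eq_visits_revSeq, add_sub_right_comm]
    simp
  have h3 : crossInter ξ w m n ∅ ω = tupleInter (shiftSeq ξ m) w n ω := by
    simp [tupleInter, crossInter]
  rw [h1, ← h2, ← h3, ← Finset.add_sum_erase _ _ (Finset.mem_univ (∅ : Finset ι)),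
    ← Finset.add_sum_erase (Finset.univ.erase ∅) _ (Finset.mem_erase.2
      ⟨Finset.univ_nonempty.ne_empty, Finset.mem_univ (Finset.univ : Finset ι)⟩)]
  ring

end Reversal

variable {Ω : Type*} [mΩ : MeasurableSpace Ω] {P : Measure Ω} {d : ℕ}
  {ξ : ℕ → Ω → Fin d → ℤ}

lemma IsIIDSequence.revSeq (h : IsIIDSequence P ξ) (m : ℕ) : IsIIDSequence P (revSeq ξ m) :=
  (h.precomp (revIdx_injective m)).neg

lemma HitBound.shiftSeq [IsProbabilityMeasure P] {D : ℝ≥0∞} (hD : HitBound P ξ D)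
    (h : IsIIDSequence P ξ) (m : ℕ) : HitBound P (shiftSeq ξ m) D := fun k x => by
  rw [hitProb_shiftSeq h]
  exact hD k x

lemma HitBound.revSeq [IsProbabilityMeasure P] {D : ℝ≥0∞} (hD : HitBound P ξ D)
    (h : IsIIDSequence P ξ) (m : ℕ) : HitBound P (revSeq ξ m) D := fun k x => by
  have h1 : hitProb P (RandomWalkLocalTime.revSeq ξ m) k x =
      hitProb P (fun i => ξ (revIdx m i)) k (-x) := by
    unfold hitProb
    congr 1
    ext ω
    simp [walk, RandomWalkLocalTime.revSeq, neg_eq_iff_eq_neg]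
  rw [h1, hitProb_congr (h.precomp (revIdx_injective m)) h (h.identDistrib _).map_eq]
  exact hD k (-x)

/-! ### Second moments of the cross terms -/

/-- The Cauchy–Schwarz inequality for the sums over two base points `x` and `y`, one of which is
reached first, with weight `u`, and the other one from there, with weight `p`. -/
lemma tsum_tsum_mul_le {d : ℕ} (u p u' p' : (Fin d → ℤ) → ℝ≥0∞) {U Q : ℝ≥0∞}
    (hu : ∑' x, u x ^ 2 ≤ U) (hp : ∑' x, p x ^ 2 ≤ Q)
    (hu' : ∑' x, u' x ^ 2 ≤ U) (hp' : ∑' x, p' x ^ 2 ≤ Q) :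
    ∑' x, ∑' y, (u x * p (y - x) + u y * p (x - y)) * (u' x * p' (y - x) + u' y * p' (x - y)) ≤
      12 * (U * Q) := by
  have key : ∀ u p : (Fin d → ℤ) → ℝ≥0∞, ∑' x, u x ^ 2 ≤ U → ∑' x, p x ^ 2 ≤ Q →
      ∑' x, ∑' y, (u x * p (y - x) + u y * p (x - y)) ^ 2 ≤ 6 * (U * Q) := by
    intro u p hu hp
    have h1 : ∑' x, ∑' y, u x ^ 2 * p (y - x) ^ 2 ≤ U * Q := by
      simp_rw [ENNReal.tsum_mul_left, tsum_sub_right_eq (fun y => p y ^ 2),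
        ENNReal.tsum_mul_right]
      gcongr
    have h2 : ∑' x, ∑' y, u y ^ 2 * p (x - y) ^ 2 ≤ U * Q := by
      rw [ENNReal.tsum_comm]; exact h1
    calc _ ≤ ∑' x, ∑' y, 3 * (u x ^ 2 * p (y - x) ^ 2 + u y ^ 2 * p (x - y) ^ 2) := by
          gcongr with x y
          refine (sq_add_le _ _).trans_eq ?_
          ring
      _ = 3 * (∑' x, ∑' y, u x ^ 2 * p (y - x) ^ 2 + ∑' x, ∑' y, u y ^ 2 * p (x - y) ^ 2) := by
          simp_rw [ENNReal.tsum_mul_left (a := 3), ENNReal.tsum_add]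
      _ ≤ 3 * (U * Q + U * Q) := by gcongr
      _ = _ := by ring
  calc _ ≤ ∑' x, ∑' y, ((u x * p (y - x) + u y * p (x - y)) ^ 2 +
        (u' x * p' (y - x) + u' y * p' (x - y)) ^ 2) := by
        gcongr; exact mul_le_sq_add_sq _ _
    _ ≤ 6 * (U * Q) + 6 * (U * Q) := by
        simp_rw [ENNReal.tsum_add]
        exact add_le_add (key u p hu hp) (key u' p' hu' hp')
    _ = _ := by ring

variable {ι : Type*} [Fintype ι] [DecidableEq ι]

lemma measurable_crossInter (h : IsIIDSequence P ξ) (w : ι → Fin d → ℤ) (m n : ℕ)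
    (A : Finset ι) : Measurable (crossInter ξ w m n A) :=
  Measurable.tsum fun _ =>
    (Finset.measurable_fun_prod _ fun _ _ =>
      measurable_visits (fun i _ => (h.revSeq m).measurable i) _).mul
    (Finset.measurable_fun_prod _ fun _ _ =>
      measurable_visits (fun i _ => (h.shiftSeq m).measurable i) _)

/-- The constant in the bound for the second moments of the cross terms. -/
noncomputable def crossConst (D : ℝ≥0∞) (p : ℕ) : ℝ≥0∞ :=
  ((2 * p).factorial : ℝ≥0∞) ^ 2 * ((p : ℝ≥0∞) ^ 2 * (1 + D)) ^ (2 * p - 4) *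
    (12 * ((2 * (p : ℝ≥0∞) ^ 2 * (1 + 3 * D)) * (2 * ((p : ℝ≥0∞) ^ 2) ^ 2 * (1 + 3 * D))))

lemma crossConst_ne_top {D : ℝ≥0∞} (hD : D ≠ ∞) (p : ℕ) : crossConst D p ≠ ∞ := by
  unfold crossConst
  finiteness

/-- The cross terms are smaller, by a factor of order `log N`, than the whole count. In their
second moment there are two translates of the pattern, with base points `x` and `y`. Each of the
two independent parts of the walk has to reach one of them and to pass to the other, which gives
four Green functions depending on `x` and `y`. The squares of each have a sum of order `N`, so that
the double sum is of order `N²`; the other `2 p - 4` Green functions are of order `log N`. -/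
lemma lintegral_crossInter_sq_le [IsProbabilityMeasure P] {D : ℝ≥0∞} (hD : HitBound P ξ D)
    (h : IsIIDSequence P ξ) (w : ι → Fin d → ℤ) {m n N : ℕ} (hm : m ≤ N) (hn : n ≤ N)
    (hN : 1 ≤ N) {A : Finset ι} (hA : A.Nonempty) (hA' : A ≠ Finset.univ) :
    ∫⁻ ω, crossInter ξ w m n A ω ^ 2 ∂P ≤ crossConst D (Fintype.card ι) * (N : ℝ≥0∞) ^ 2 *
      ENNReal.ofReal (1 + Real.log N) ^ (2 * Fintype.card ι - 4) := by
  set p := Fintype.card ι with hp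
  have hη := h.revSeq m
  have hζ := h.shiftSeq m
  have hDη := hD.revSeq h m
  have hDζ := hD.shiftSeq h m
  obtain ⟨r, hr : _ = r + 1⟩ := Nat.exists_eq_add_of_le' (Finset.card_pos.2 hA)
  obtain ⟨r', hr' : _ = r' + 1⟩ := Nat.exists_eq_add_of_le' (Finset.card_pos.2
    (Finset.nonempty_iff_ne_empty.2 ((Finset.compl_eq_empty_iff A).not.2 hA')))
  have hrr : r + r' + 2 = p := by
    have := Finset.card_add_card_compl A
    omega
  set f : (Fin d → ℤ) → Ω → ℝ≥0∞ := fun x ω =>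
    ∏ i ∈ A, visits (revSeq ξ m) 0 m (x + w i) ω with hf
  set g : (Fin d → ℤ) → Ω → ℝ≥0∞ := fun x ω =>
    ∏ i ∈ Aᶜ, visits (shiftSeq ξ m) 1 (n + 1) (x + w i) ω with hg
  have hfm : ∀ x, Measurable[jumpSigma ξ (Set.Iio m)] (f x) := fun x =>
    Finset.measurable_fun_prod _ fun i _ => measurable_visits (fun j hj =>
      (measurable_jumpSigma (ξ := ξ) (i := revIdx m j) (by
        unfold revIdx; simp only [Set.mem_Iio]; split_ifs <;> omega)).neg) _
  have hgm : ∀ x, Measurable[jumpSigma ξ (Set.Ici m)] (g x) := fun x =>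
    Finset.measurable_fun_prod _ fun i _ => measurable_visits (fun j _ =>
      measurable_jumpSigma (ξ := ξ) (i := m + j) (by simp)) _
  have hfm' : ∀ x, Measurable (f x) := fun x => (hfm x).mono (h.jumpSigma_le _) le_rfl
  have hgm' : ∀ x, Measurable (g x) := fun x => (hgm x).mono (h.jumpSigma_le _) le_rfl
  set K : ℝ≥0∞ := (p : ℝ≥0∞) ^ 2 * (1 + D) * ENNReal.ofReal (1 + Real.log N) with hKdef
  have hK : ∀ ζ : ℕ → Ω → Fin d → ℤ, HitBound P ζ D →
      ∀ u, patternGreen P ζ (diffPattern w) N u ≤ K := fun ζ hζ u => by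
    refine (hζ.patternGreen_le N _ u).trans_eq ?_
    rw [Fintype.card_prod, hKdef]
    push_cast
    ring
  have hfbound : ∀ x y, ∫⁻ ω, f x ω * f y ω ∂P ≤ (2 * p).factorial * K ^ (2 * r) *
      (patternGreen P (revSeq ξ m) w N x * patternGreen P (revSeq ξ m) (diffPattern w) N (y - x) +
      patternGreen P (revSeq ξ m) w N y * patternGreen P (revSeq ξ m) (diffPattern w) N (x - y)) :=
    fun x y => by
      refine (lintegral_mono fun ω => ?_).trans ((lintegral_two_point_le hη w (hK _ hDη) A hr
        x y).trans ?_)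
      · exact mul_le_mul' (Finset.prod_le_prod' fun i _ => visits_mono _ le_rfl (by omega) _ _)
          (Finset.prod_le_prod' fun i _ => visits_mono _ le_rfl (by omega) _ _)
      · gcongr
        omega
  have hgbound : ∀ x y, ∫⁻ ω, g x ω * g y ω ∂P ≤ (2 * p).factorial * K ^ (2 * r') *
      (patternGreen P (shiftSeq ξ m) w N x *
          patternGreen P (shiftSeq ξ m) (diffPattern w) N (y - x) +
        patternGreen P (shiftSeq ξ m) w N y *
          patternGreen P (shiftSeq ξ m) (diffPattern w) N (x - y)) :=
    fun x y => by
      refine (lintegral_mono fun ω => ?_).trans ((lintegral_two_point_le hζ w (hK _ hDζ) Aᶜ hr'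
        x y).trans ?_)
      · exact mul_le_mul' (Finset.prod_le_prod' fun i _ => visits_mono _ (by omega) (by omega) _ _)
          (Finset.prod_le_prod' fun i _ => visits_mono _ (by omega) (by omega) _ _)
      · gcongr
        omega
  have hexp : ∫⁻ ω, crossInter ξ w m n A ω ^ 2 ∂P =
      ∑' x, ∑' y, (∫⁻ ω, f x ω * f y ω ∂P) * ∫⁻ ω, g x ω * g y ω ∂P := by
    have : ∀ ω, crossInter ξ w m n A ω ^ 2 =
        ∑' x, ∑' y, (f x ω * f y ω) * (g x ω * g y ω) := fun ω => by
      rw [sq, crossInter, ← ENNReal.tsum_mul_right]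
      refine tsum_congr fun x => ?_
      rw [← ENNReal.tsum_mul_left]
      exact tsum_congr fun y => mul_mul_mul_comm _ _ _ _
    simp_rw [this]
    have hmeas : ∀ x y, Measurable fun ω => (f x ω * f y ω) * (g x ω * g y ω) := fun x y =>
      ((hfm' x).mul (hfm' y)).mul ((hgm' x).mul (hgm' y))
    rw [lintegral_tsum fun x => (Measurable.tsum fun y => hmeas x y).aemeasurable]
    refine tsum_congr fun x => ?_
    rw [lintegral_tsum fun y => (hmeas x y).aemeasurable]
    refine tsum_congr fun y => ?_
    exact h.lintegral_mul_past_future ((hfm x).mul (hfm y)) ((hgm x).mul (hgm y))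
  have hU : ∀ ζ : ℕ → Ω → Fin d → ℤ, HitBound P ζ D → IsIIDSequence P ζ →
      ∑' x, patternGreen P ζ w N x ^ 2 ≤ 2 * (p : ℝ≥0∞) ^ 2 * ((1 + 3 * D) * N) :=
    fun ζ h1 h2 => h1.tsum_patternGreen_sq_le h2 hN w
  have hQ : ∀ ζ : ℕ → Ω → Fin d → ℤ, HitBound P ζ D → IsIIDSequence P ζ →
      ∑' x, patternGreen P ζ (diffPattern w) N x ^ 2 ≤
        2 * ((p : ℝ≥0∞) ^ 2) ^ 2 * ((1 + 3 * D) * N) :=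
    fun ζ h1 h2 => by
      refine (h1.tsum_patternGreen_sq_le h2 hN _).trans_eq ?_
      rw [Fintype.card_prod]
      push_cast
      ring
  rw [hexp]
  calc _ ≤ ∑' x, ∑' y, ((2 * p).factorial : ℝ≥0∞) ^ 2 * K ^ (2 * p - 4) *
        ((patternGreen P (revSeq ξ m) w N x *
            patternGreen P (revSeq ξ m) (diffPattern w) N (y - x) +
          patternGreen P (revSeq ξ m) w N y *
            patternGreen P (revSeq ξ m) (diffPattern w) N (x - y)) *
        (patternGreen P (shiftSeq ξ m) w N x *
            patternGreen P (shiftSeq ξ m) (diffPattern w) N (y - x) +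
          patternGreen P (shiftSeq ξ m) w N y *
            patternGreen P (shiftSeq ξ m) (diffPattern w) N (x - y))) := by
        refine ENNReal.tsum_le_tsum fun x => ENNReal.tsum_le_tsum fun y => ?_
        refine (mul_le_mul' (hfbound x y) (hgbound x y)).trans_eq ?_
        rw [show 2 * p - 4 = 2 * r + 2 * r' by omega, pow_add]
        ring
    _ ≤ ((2 * p).factorial : ℝ≥0∞) ^ 2 * K ^ (2 * p - 4) *
        (12 * ((2 * (p : ℝ≥0∞) ^ 2 * ((1 + 3 * D) * N)) *
          (2 * ((p : ℝ≥0∞) ^ 2) ^ 2 * ((1 + 3 * D) * N)))) := by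
        simp_rw [ENNReal.tsum_mul_left]
        gcongr
        exact tsum_tsum_mul_le _ _ _ _ (hU _ hDη hη) (hQ _ hDη hη) (hU _ hDζ hζ) (hQ _ hDζ hζ)
    _ = _ := by
        rw [crossConst, hKdef, mul_pow _ (ENNReal.ofReal _)]
        ring

end

section

/-! ### The variance of the pattern count -/

variable {Ω : Type*} [mΩ : MeasurableSpace Ω] {P : Measure Ω} [IsProbabilityMeasure P] {d : ℕ}
  {ξ : ℕ → Ω → Fin d → ℤ}

/-- A constant less than two in front of the variance of `X` is what makes the recursion by
halving contract. -/
lemma variance_add_le {X R : Ω → ℝ} (hX : MemLp X 2 P) (hR : MemLp R 2 P) :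
    Var[fun ω => X ω + R ω; P] ≤ 3 / 2 * Var[X; P] + 3 * ∫ ω, R ω ^ 2 ∂P := by
  set c := ∫ ω, X ω ∂P with hc
  have hXc : MemLp (fun ω => X ω - c) 2 P := hX.sub (memLp_const c)
  have hsum : MemLp (fun ω => X ω - c + R ω) 2 P := hXc.add hR
  calc Var[fun ω => X ω + R ω; P] = Var[fun ω => X ω - c + R ω; P] := by
        rw [← variance_sub_const (X := fun ω => X ω + R ω) (hX.add hR).aestronglyMeasurable c]
        congr 1
        ext ω
        ring
    _ ≤ ∫ ω, (X ω - c + R ω) ^ 2 ∂P := variance_le_expectation_sq hsum.aestronglyMeasurable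
    _ ≤ ∫ ω, (3 / 2 * (X ω - c) ^ 2 + 3 * R ω ^ 2) ∂P := by
        refine integral_mono hsum.integrable_sq
          ((hXc.integrable_sq.const_mul _).add (hR.integrable_sq.const_mul _)) fun ω => ?_
        nlinarith [sq_nonneg (X ω - c - 2 * R ω)]
    _ = _ := by
        rw [integral_add (hXc.integrable_sq.const_mul _) (hR.integrable_sq.const_mul _),
          integral_const_mul, integral_const_mul, variance_eq_integral hX.aemeasurable]

variable {ι : Type*} [Fintype ι]

lemma memLp_tupleInter [Nonempty ι] (h : IsIIDSequence P ξ) (w : ι → Fin d → ℤ) (n : ℕ) :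
    MemLp (fun ω => (tupleInter ξ w n ω).toReal) 2 P := by
  refine MemLp.of_bound
    (measurable_tupleInter (fun i _ => h.measurable i) w).ennreal_toReal.aestronglyMeasurable
    ((n : ℝ) ^ Fintype.card ι) (ae_of_all _ fun ω => ?_)
  rw [Real.norm_of_nonneg ENNReal.toReal_nonneg]
  have := ENNReal.toReal_mono (by finiteness) (tupleInter_le ξ w n ω)
  simpa using this

omit [IsProbabilityMeasure P] in
lemma IsIIDSequence.indepFun_past_future (h : IsIIDSequence P ξ) {m : ℕ} {X Y : Ω → ℝ}
    (hX : Measurable[jumpSigma ξ (Set.Iio m)] X) (hY : Measurable[jumpSigma ξ (Set.Ici m)] Y) :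
    IndepFun X Y P := by
  have hd : Disjoint (Set.Iio m) (Set.Ici m) :=
    Set.disjoint_left.2 fun i hi hi' => not_lt.2 (Set.mem_Ici.1 hi') (Set.mem_Iio.1 hi)
  exact indep_of_indep_of_le_left (indep_of_indep_of_le_right (h.indep_jumpSigma hd)
    (measurable_iff_comap_le.1 hY)) (measurable_iff_comap_le.1 hX)

/-- Splitting the time interval at `m`: apart from the independent counts of the two parts, only
the cross terms enter the variance. -/
lemma variance_tupleInter_add_le [Nonempty ι] {D : ℝ≥0∞} (hDtop : D ≠ ∞) (hD : HitBound P ξ D)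
    (h : IsIIDSequence P ξ) (w : ι → Fin d → ℤ) {m n : ℕ} (hmn : 1 ≤ m + n) :
    Var[fun ω => (tupleInter ξ w (m + n) ω).toReal; P] ≤
      3 / 2 * (Var[fun ω => (tupleInter ξ w m ω).toReal; P] +
        Var[fun ω => (tupleInter (shiftSeq ξ m) w n ω).toReal; P]) +
      3 * ((2 * 2 ^ Fintype.card ι * 2 ^ Fintype.card ι *
        (crossConst D (Fintype.card ι)).toReal) * ((m + n : ℕ) : ℝ) ^ 2 *
        (1 + Real.log (m + n : ℕ)) ^ (2 * Fintype.card ι - 4)) := by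
  classical
  set p := Fintype.card ι with hp
  set N := m + n with hN
  have hζ := h.shiftSeq m
  set S : Finset (Finset ι) := (Finset.univ.erase ∅).erase Finset.univ with hS
  have hScard : (S.card : ℝ≥0∞) ≤ 2 ^ p := by
    have : S.card ≤ 2 ^ p := by
      refine (Finset.card_le_univ _).trans_eq ?_
      rw [Fintype.card_finset]
    exact_mod_cast this
  set R : Ω → ℝ≥0∞ := fun ω => ∑ A ∈ S, crossInter ξ w m n A ω with hR
  have hdec : ∀ ω, tupleInter ξ w N ω = tupleInter ξ w m ω + tupleInter (shiftSeq ξ m) w n ω +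
      R ω := fun ω => tupleInter_add ξ w m n ω
  have hRtop : ∀ ω, R ω ≠ ∞ := fun ω =>
    ne_top_of_le_ne_top (tupleInter_ne_top ξ w N ω) (by rw [hdec]; exact le_add_self)
  have hRm : Measurable R := Finset.measurable_fun_sum _ fun A _ => measurable_crossInter h w m n A
  have hlog : 0 ≤ 1 + Real.log N := by have := Real.log_natCast_nonneg N; linarith
  have hRsq : ∫⁻ ω, R ω ^ 2 ∂P ≤ 2 * 2 ^ p * 2 ^ p * crossConst D p * (N : ℝ≥0∞) ^ 2 *
      ENNReal.ofReal (1 + Real.log N) ^ (2 * p - 4) := by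
    calc ∫⁻ ω, R ω ^ 2 ∂P ≤ ∫⁻ ω, 2 * S.card * ∑ A ∈ S, crossInter ξ w m n A ω ^ 2 ∂P :=
          lintegral_mono fun ω => sq_sum_le _ _
      _ = 2 * S.card * ∑ A ∈ S, ∫⁻ ω, crossInter ξ w m n A ω ^ 2 ∂P := by
          rw [lintegral_const_mul _ (Finset.measurable_fun_sum _ fun A _ =>
            (measurable_crossInter h w m n A).pow_const 2),
            lintegral_finsetSum _ fun A _ => (measurable_crossInter h w m n A).pow_const 2]
      _ ≤ 2 * S.card * ∑ A ∈ S, (crossConst D p * (N : ℝ≥0∞) ^ 2 *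
          ENNReal.ofReal (1 + Real.log N) ^ (2 * p - 4)) := by
          gcongr with A hA
          simp only [hS, Finset.mem_erase] at hA
          exact lintegral_crossInter_sq_le hD h w (by omega) (by omega) hmn
            (Finset.nonempty_iff_ne_empty.2 hA.2.1) hA.1
      _ = 2 * S.card * S.card * (crossConst D p * (N : ℝ≥0∞) ^ 2 *
          ENNReal.ofReal (1 + Real.log N) ^ (2 * p - 4)) := by
          rw [Finset.sum_const, nsmul_eq_mul]; ring
      _ ≤ 2 * 2 ^ p * 2 ^ p * (crossConst D p * (N : ℝ≥0∞) ^ 2 *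
          ENNReal.ofReal (1 + Real.log N) ^ (2 * p - 4)) := by gcongr
      _ = _ := by ring
  have hX := memLp_tupleInter h w m
  have hY := memLp_tupleInter hζ w n
  have hRL : MemLp (fun ω => (R ω).toReal) 2 P := by
    refine (memLp_tupleInter h w N).mono hRm.ennreal_toReal.aestronglyMeasurable
      (ae_of_all _ fun ω => ?_)
    rw [Real.norm_of_nonneg ENNReal.toReal_nonneg, Real.norm_of_nonneg ENNReal.toReal_nonneg]
    exact ENNReal.toReal_mono (tupleInter_ne_top ξ w N ω) (by rw [hdec]; exact le_add_self)
  have hRint : ∫ ω, (R ω).toReal ^ 2 ∂P ≤ (2 * 2 ^ p * 2 ^ p * (crossConst D p).toReal) *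
      (N : ℝ) ^ 2 * (1 + Real.log N) ^ (2 * p - 4) := by
    have h1 : ∫ ω, (R ω).toReal ^ 2 ∂P = (∫⁻ ω, R ω ^ 2 ∂P).toReal := by
      simp_rw [← ENNReal.toReal_pow]
      exact integral_toReal (hRm.pow_const 2).aemeasurable
        (ae_of_all _ fun ω => ENNReal.pow_lt_top (hRtop ω).lt_top)
    rw [h1]
    refine (ENNReal.toReal_mono ?_ hRsq).trans_eq ?_
    · have := crossConst_ne_top hDtop p
      finiteness
    · simp [ENNReal.toReal_ofReal hlog]
  have hpast : Measurable[jumpSigma ξ (Set.Iio m)] (tupleInter ξ w m) :=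
    measurable_tupleInter (fun i hi => measurable_jumpSigma hi) w
  have hfuture : Measurable[jumpSigma ξ (Set.Ici m)] (tupleInter (shiftSeq ξ m) w n) :=
    measurable_tupleInter (fun i _ => measurable_jumpSigma (ξ := ξ) (i := m + i) (by simp)) w
  have hind := h.indepFun_past_future hpast.ennreal_toReal hfuture.ennreal_toReal
  have heq : (fun ω => (tupleInter ξ w N ω).toReal) = fun ω =>
      ((tupleInter ξ w m ω).toReal + (tupleInter (shiftSeq ξ m) w n ω).toReal) +
        (R ω).toReal := by
    ext ω
    rw [hdec, ENNReal.toReal_add (ENNReal.add_ne_top.2 ⟨tupleInter_ne_top _ _ _ _,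
      tupleInter_ne_top _ _ _ _⟩) (hRtop ω), ENNReal.toReal_add (tupleInter_ne_top _ _ _ _)
      (tupleInter_ne_top _ _ _ _)]
  have hvar := hind.variance_add hX hY
  rw [heq]
  refine (variance_add_le (hX.add hY) hRL).trans ?_
  rw [hvar]
  gcongr

/-- The variance of the pattern count is smaller than the square of its mean by a factor of
order `(log n)²`. Halving the time interval again and again, the contributions of the cross terms
form a geometric series. -/
lemma exists_variance_tupleInter_le [Nonempty ι] {D : ℝ≥0∞} (hDtop : D ≠ ∞)
    (w : ι → Fin d → ℤ) :
    ∃ K : ℝ, ∀ (ξ : ℕ → Ω → Fin d → ℤ), IsIIDSequence P ξ → HitBound P ξ D → ∀ n : ℕ,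
      Var[fun ω => (tupleInter ξ w n ω).toReal; P] ≤
        K * (n : ℝ) ^ 2 * (1 + Real.log n) ^ (2 * Fintype.card ι - 4) := by
  set c : ℝ := 2 * 2 ^ Fintype.card ι * 2 ^ Fintype.card ι *
    (crossConst D (Fintype.card ι)).toReal with hc
  have hc0 : 0 ≤ c := by positivity
  set q := 2 * Fintype.card ι - 4 with hq
  refine ⟨18 * c + 1, fun ξ h hD n => ?_⟩
  induction n using Nat.strong_induction_on generalizing ξ with
  | _ n ih =>
  rcases Nat.lt_or_ge n 2 with hn | hn
  · refine (variance_le_expectation_sq (memLp_tupleInter h w n).aestronglyMeasurable).trans ?_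
    have hle : ∀ ω, (tupleInter ξ w n ω).toReal ^ 2 ≤ (n : ℝ) ^ 2 := fun ω => by
      have := ENNReal.toReal_mono (by finiteness) (tupleInter_le ξ w n ω)
      gcongr
      refine this.trans ?_
      have h1 : Fintype.card ι ≠ 0 := Fintype.card_ne_zero
      interval_cases n <;> simp
    have h1 : ∫ ω, (tupleInter ξ w n ω).toReal ^ 2 ∂P ≤ ∫ _ : Ω, (n : ℝ) ^ 2 ∂P :=
      integral_mono (memLp_tupleInter h w n).integrable_sq (integrable_const _) hle
    refine h1.trans ?_
    interval_cases n <;> simp [hc0]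
  · obtain ⟨a, b, rfl, ha, hb, hab, hba⟩ : ∃ a b, n = a + b ∧ 1 ≤ a ∧ 1 ≤ b ∧ a ≤ b ∧ b ≤ a + 1 :=
      ⟨n / 2, n - n / 2, by omega, by omega, by omega, by omega, by omega⟩
    have hL : ∀ r : ℕ, 1 ≤ r → r ≤ a + b → (1 + Real.log r) ^ q ≤
        (1 + Real.log (a + b : ℕ)) ^ q := fun r hr hrn => by
      have h0 : 0 ≤ Real.log r := Real.log_natCast_nonneg r
      have h1 : Real.log r ≤ Real.log (a + b : ℕ) :=
        Real.log_le_log (by exact_mod_cast hr) (by exact_mod_cast hrn)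
      gcongr
    set Λ := (1 + Real.log (a + b : ℕ)) ^ q with hΛ
    have hΛ0 : 0 ≤ Λ := by
      have h0 : 0 ≤ Real.log (a + b : ℕ) := Real.log_natCast_nonneg _
      positivity
    have h1 := (ih a (by omega) ξ h hD).trans
      (mul_le_mul_of_nonneg_left (hL a ha (by omega)) (by positivity))
    have h2 := (ih b (by omega) (shiftSeq ξ a) (h.shiftSeq a) (hD.shiftSeq h a)).trans
      (mul_le_mul_of_nonneg_left (hL b hb (by omega)) (by positivity))
    have h3 := variance_tupleInter_add_le hDtop hD h w (show 1 ≤ a + b by omega)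
    refine h3.trans ?_
    rw [← hc, ← hΛ]
    have ha' : (1 : ℝ) ≤ a := by exact_mod_cast ha
    have hab' : (a : ℝ) ≤ b := by exact_mod_cast hab
    have hba' : (b : ℝ) ≤ a + 1 := by exact_mod_cast hba
    -- for equal halves the factor is `3 / 4`, and the unequal halves `1 + 2` of `3` give the
    -- worst case `5 / 6`
    have hsq : 3 / 2 * ((a : ℝ) ^ 2 + (b : ℝ) ^ 2) ≤ 5 / 6 * ((a : ℝ) + b) ^ 2 := by
      nlinarith
    push_cast
    calc _ ≤ 3 / 2 * ((18 * c + 1) * (a : ℝ) ^ 2 * Λ + (18 * c + 1) * (b : ℝ) ^ 2 * Λ) +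
          3 * (c * ((a : ℝ) + b) ^ 2 * Λ) := by gcongr
      _ = (18 * c + 1) * Λ * (3 / 2 * ((a : ℝ) ^ 2 + (b : ℝ) ^ 2)) +
          3 * (c * ((a : ℝ) + b) ^ 2 * Λ) := by ring
      _ ≤ (18 * c + 1) * Λ * (5 / 6 * ((a : ℝ) + b) ^ 2) +
          3 * (c * ((a : ℝ) + b) ^ 2 * Λ) := by gcongr
      _ ≤ (18 * c + 1) * Λ * (5 / 6 * ((a : ℝ) + b) ^ 2) +
          (3 * c + 1 / 6) * ((a : ℝ) + b) ^ 2 * Λ := by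
          have : 0 ≤ ((a : ℝ) + b) ^ 2 * Λ := by positivity
          nlinarith
      _ = _ := by ring

end

section

/-! ### Almost sure convergence along a subsequence, and interpolation -/

/-- A monotone function may be compared with a monotone normalization along a subsequence, if
the normalization has ratios tending to one along it. -/
lemma tendsto_div_of_monotone_of_subseq {u f : ℕ → ℝ} {c κ : ℕ → ℕ} {A : ℝ}
    (hu : Monotone u) (hu0 : ∀ n, 0 ≤ u n) (hf : Monotone f)
    (hfpos : ∀ᶠ k in atTop, 0 < f (c k)) (hκ : Tendsto κ atTop atTop)
    (hle : ∀ᶠ n in atTop, c (κ n) ≤ n) (hge : ∀ᶠ n in atTop, n ≤ c (κ n + 1))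
    (hratio : Tendsto (fun k => f (c (k + 1)) / f (c k)) atTop (𝓝 1))
    (hconv : Tendsto (fun k => u (c k) / f (c k)) atTop (𝓝 A)) :
    Tendsto (fun n => u n / f n) atTop (𝓝 A) := by
  have h1 : Tendsto (fun k => u (c k) / f (c (k + 1))) atTop (𝓝 A) := by
    have := hconv.div hratio one_ne_zero
    rw [div_one] at this
    refine this.congr' ?_
    filter_upwards [hfpos, (tendsto_add_atTop_nat 1).eventually hfpos] with k hk hk1
    simp only [Pi.div_apply]
    field_simp
  have h2 : Tendsto (fun k => u (c (k + 1)) / f (c k)) atTop (𝓝 A) := by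
    have := (hconv.comp (tendsto_add_atTop_nat 1)).mul hratio
    rw [mul_one] at this
    refine this.congr' ?_
    filter_upwards [hfpos, (tendsto_add_atTop_nat 1).eventually hfpos] with k hk hk1
    simp only [Function.comp]
    field_simp
  refine tendsto_of_tendsto_of_tendsto_of_le_of_le' (h1.comp hκ) (h2.comp hκ) ?_ ?_
  · filter_upwards [hle, hge, hκ.eventually hfpos] with n hn hn' hpos
    simp only [Function.comp]
    exact div_le_div₀ (hu0 _) (hu hn) (hpos.trans_le (hf hn)) (hf hn')
  · filter_upwards [hle, hge, hκ.eventually hfpos] with n hn hn' hpos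
    simp only [Function.comp]
    exact div_le_div₀ (hu0 _) (hu hn') hpos (hf hn)

/-- The logarithms of the times of the subsequence. The exponent is less than one, so that the
ratios of successive times tend to one, and more than one half, so that the inverses of the squares
are summable. -/
noncomputable def logTime (k : ℕ) : ℝ := (k : ℝ) ^ (3 / 4 : ℝ)

/-- The times of the subsequence. -/
noncomputable def subTime (k : ℕ) : ℕ := ⌊Real.exp (logTime k)⌋₊

lemma tendsto_logTime : Tendsto logTime atTop atTop :=
  (tendsto_rpow_atTop (by norm_num)).comp tendsto_natCast_atTop_atTop

lemma tendsto_logTime_sub : Tendsto (fun k => logTime (k + 1) - logTime k) atTop (𝓝 0) := by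
  have h0 : Tendsto (fun k : ℕ => (3 / 4 : ℝ) * (k : ℝ) ^ (-(1 / 4) : ℝ)) atTop (𝓝 0) := by
    have := ((tendsto_rpow_neg_atTop (y := 1 / 4) (by norm_num)).comp
      tendsto_natCast_atTop_atTop).const_mul (3 / 4 : ℝ)
    rwa [mul_zero] at this
  refine tendsto_of_tendsto_of_tendsto_of_le_of_le' tendsto_const_nhds h0 ?_ ?_
  · filter_upwards with k
    rw [sub_nonneg, logTime, logTime]
    gcongr
    simp
  · filter_upwards [eventually_gt_atTop 0] with k hk
    have hk' : (0 : ℝ) < k := by exact_mod_cast hk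
    have h1 : ((k + 1 : ℕ) : ℝ) = k * (1 + (k : ℝ)⁻¹) := by push_cast; field_simp
    have h2 := rpow_one_add_le_one_add_mul_self (s := (k : ℝ)⁻¹) (p := 3 / 4)
      (by have : 0 < (k : ℝ)⁻¹ := by positivity
          linarith) (by norm_num) (by norm_num)
    have h3 : (k : ℝ) ^ (3 / 4 : ℝ) * (k : ℝ)⁻¹ = (k : ℝ) ^ (-(1 / 4) : ℝ) := by
      rw [← Real.rpow_neg_one, ← Real.rpow_add hk']
      norm_num
    rw [logTime, logTime, h1, Real.mul_rpow hk'.le (by positivity), ← h3]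
    have h4 : 0 ≤ (k : ℝ) ^ (3 / 4 : ℝ) := by positivity
    nlinarith [mul_le_mul_of_nonneg_left h2 h4]

lemma tendsto_exp_logTime : Tendsto (fun k => Real.exp (logTime k)) atTop atTop :=
  Real.tendsto_exp_atTop.comp tendsto_logTime

lemma tendsto_subTime : Tendsto subTime atTop atTop :=
  tendsto_nat_floor_atTop.comp tendsto_exp_logTime

lemma exp_logTime_le (k : ℕ) : Real.exp (logTime k) ≤ 2 * subTime k := by
  have h1 : 1 ≤ Real.exp (logTime k) := Real.one_le_exp (by unfold logTime; positivity)
  have h2 : Real.exp (logTime k) < subTime k + 1 := Nat.lt_floor_add_one _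
  have h3 : (1 : ℝ) ≤ subTime k := by exact_mod_cast (Nat.one_le_floor_iff _).2 h1
  linarith

lemma subTime_le (k : ℕ) : (subTime k : ℝ) ≤ Real.exp (logTime k) :=
  Nat.floor_le (Real.exp_pos _).le

lemma subTime_pos (k : ℕ) : (0 : ℝ) < subTime k := by
  have := (Real.exp_pos (logTime k)).trans_le (exp_logTime_le k)
  linarith

lemma log_subTime_le (k : ℕ) : Real.log (subTime k) ≤ logTime k :=
  (Real.log_le_iff_le_exp (subTime_pos k)).2 (subTime_le k)

lemma le_log_subTime (k : ℕ) : logTime k - Real.log 2 ≤ Real.log (subTime k) := by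
  have := (Real.le_log_iff_exp_le (by have := subTime_pos k; positivity)).2 (exp_logTime_le k)
  rw [Real.log_mul two_ne_zero (subTime_pos k).ne'] at this
  linarith

lemma tendsto_log_subTime_div : Tendsto (fun k => Real.log (subTime k) / logTime k) atTop (𝓝 1) := by
  have h1 : Tendsto (fun k => 1 - Real.log 2 / logTime k) atTop (𝓝 (1 - 0)) :=
    tendsto_const_nhds.sub (tendsto_const_nhds.div_atTop tendsto_logTime)
  rw [sub_zero] at h1
  refine tendsto_of_tendsto_of_tendsto_of_le_of_le' h1 tendsto_const_nhds ?_ ?_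
  · filter_upwards [tendsto_logTime.eventually_gt_atTop 0] with k hk
    rw [← div_self hk.ne', ← sub_div]
    gcongr
    exact le_log_subTime k
  · filter_upwards [tendsto_logTime.eventually_gt_atTop 0] with k hk
    rw [div_le_one hk]
    exact log_subTime_le k

lemma tendsto_subTime_ratio (q : ℕ) :
    Tendsto (fun k => ((subTime (k + 1) : ℝ) * Real.log (subTime (k + 1)) ^ q) /
      ((subTime k : ℝ) * Real.log (subTime k) ^ q)) atTop (𝓝 1) := by
  have h1 : Tendsto (fun k => (subTime k : ℝ) / Real.exp (logTime k)) atTop (𝓝 1) :=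
    (tendsto_nat_floor_div_atTop (R := ℝ)).comp tendsto_exp_logTime
  have h2 : Tendsto (fun k => Real.exp (logTime (k + 1) - logTime k)) atTop (𝓝 1) := by
    have := (Real.continuous_exp.tendsto 0).comp tendsto_logTime_sub
    rwa [Real.exp_zero] at this
  have h3 : Tendsto (fun k => logTime (k + 1) / logTime k) atTop (𝓝 1) := by
    have := (tendsto_logTime_sub.div_atTop tendsto_logTime).add_const 1
    rw [zero_add] at this
    refine this.congr' ?_
    filter_upwards [tendsto_logTime.eventually_gt_atTop 0] with k hk
    field_simp
    ring
  have h4 := tendsto_log_subTime_div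
  have h5 := ((((h1.comp (tendsto_add_atTop_nat 1)).mul h2).div h1 one_ne_zero)).mul
    ((((h4.comp (tendsto_add_atTop_nat 1)).mul h3).div h4 one_ne_zero).pow q)
  simp only [mul_one, div_one, one_pow] at h5
  refine h5.congr' ?_
  filter_upwards [tendsto_logTime.eventually_gt_atTop 1,
    (tendsto_add_atTop_nat 1).eventually (tendsto_logTime.eventually_gt_atTop 1)] with k hk hk1
  have hlog2 : Real.log 2 < 1 := by have := Real.log_two_lt_d9; linarith
  have e1 : 0 < Real.log (subTime k) := by have := le_log_subTime k; linarith
  have e2 : 0 < Real.log (subTime (k + 1)) := by have := le_log_subTime (k + 1); linarith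
  have e3 := subTime_pos k
  have e4 := subTime_pos (k + 1)
  have e5 : 0 < logTime k := by linarith
  have e6 : 0 < logTime (k + 1) := by linarith
  simp only [Pi.div_apply, Function.comp]
  rw [Real.exp_sub]
  have e7 : Real.log (subTime (k + 1)) / logTime (k + 1) * (logTime (k + 1) / logTime k) /
      (Real.log (subTime k) / logTime k) =
      Real.log (subTime (k + 1)) / Real.log (subTime k) := by
    field_simp
  have e8 : (subTime (k + 1) : ℝ) / Real.exp (logTime (k + 1)) *
      (Real.exp (logTime (k + 1)) / Real.exp (logTime k)) /
      ((subTime k : ℝ) / Real.exp (logTime k)) = (subTime (k + 1) : ℝ) / subTime k := by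
    field_simp
  rw [e7, e8, div_pow, div_mul_div_comm]

/-- The index of the last time of the subsequence that is not after `n`. -/
noncomputable def subIdx (n : ℕ) : ℕ := ⌊Real.log n ^ (4 / 3 : ℝ)⌋₊

lemma tendsto_subIdx : Tendsto subIdx atTop atTop :=
  tendsto_nat_floor_atTop.comp ((tendsto_rpow_atTop (by norm_num)).comp tendsto_log_natCast)

lemma rpow_log_rpow (n : ℕ) : (Real.log n ^ (4 / 3 : ℝ)) ^ (3 / 4 : ℝ) = Real.log n := by
  rw [← Real.rpow_mul (Real.log_natCast_nonneg n)]
  norm_num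

lemma subTime_subIdx_le {n : ℕ} (hn : 1 ≤ n) : subTime (subIdx n) ≤ n := by
  have hn' : (0 : ℝ) < n := by exact_mod_cast hn
  have h0 := Real.log_natCast_nonneg n
  refine Nat.floor_le_of_le ((Real.le_log_iff_exp_le hn').1 ?_)
  rw [← rpow_log_rpow n, logTime]
  gcongr
  exact Nat.floor_le (by positivity)

lemma le_subTime_subIdx {n : ℕ} (hn : 1 ≤ n) : n ≤ subTime (subIdx n + 1) := by
  have hn' : (0 : ℝ) < n := by exact_mod_cast hn
  have h0 := Real.log_natCast_nonneg n
  refine Nat.le_floor ((Real.log_le_iff_le_exp hn').1 ?_)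
  rw [← rpow_log_rpow n, logTime]
  gcongr
  push_cast
  exact (Nat.lt_floor_add_one _).le

variable {Ω : Type*} [mΩ : MeasurableSpace Ω] {P : Measure Ω} {d : ℕ}
  {ξ : ℕ → Ω → Fin d → ℤ}

lemma ae_tendsto_zero_of_summable_integral_sq {Y : ℕ → Ω → ℝ} (hY : ∀ k, MemLp (Y k) 2 P)
    {b : ℕ → ℝ} (hb : Summable b) (hle : ∀ᶠ k in atTop, ∫ ω, Y k ω ^ 2 ∂P ≤ b k) :
    ∀ᵐ ω ∂P, Tendsto (fun k => Y k ω) atTop (𝓝 0) := by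
  have hs : Summable fun k => ∫ ω, Y k ω ^ 2 ∂P := by
    refine hb.of_norm_bounded_eventually_nat ?_
    filter_upwards [hle] with k hk
    rwa [Real.norm_of_nonneg (integral_nonneg fun ω => sq_nonneg _)]
  have hm : ∀ k, AEMeasurable (fun ω => ENNReal.ofReal (Y k ω ^ 2)) P := fun k =>
    ((hY k).aestronglyMeasurable.aemeasurable.pow_const 2).ennreal_ofReal
  have hfin : ∫⁻ ω, ∑' k, ENNReal.ofReal (Y k ω ^ 2) ∂P ≠ ∞ := by
    rw [lintegral_tsum hm]
    simp_rw [← ofReal_integral_eq_lintegral_ofReal (hY _).integrable_sq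
      (ae_of_all _ fun ω => sq_nonneg _)]
    rw [← ENNReal.ofReal_tsum_of_nonneg (fun k => integral_nonneg fun ω => sq_nonneg _) hs]
    exact ENNReal.ofReal_ne_top
  filter_upwards [ae_lt_top' (AEMeasurable.tsum hm) hfin] with ω hω
  have h1 := ENNReal.tendsto_atTop_zero_of_tsum_ne_top hω.ne
  have h2 : Tendsto (fun k => Y k ω ^ 2) atTop (𝓝 0) := by
    have := (ENNReal.tendsto_toReal ENNReal.zero_ne_top).comp h1
    refine this.congr fun k => ?_
    simp [ENNReal.toReal_ofReal (sq_nonneg (Y k ω))]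
  have h3 := h2.sqrt
  simp only [Real.sqrt_sq_eq_abs, Real.sqrt_zero] at h3
  exact (tendsto_zero_iff_abs_tendsto_zero _).2 h3

variable [IsProbabilityMeasure P]

lemma LogRecurrent.hitBound {l C : ℝ} (hl : LogRecurrent P ξ l C) :
    HitBound P ξ (ENNReal.ofReal C) := fun k x => by
  have := ENNReal.ofReal_le_ofReal (hl.bound k x)
  rwa [ENNReal.ofReal_mul (Nat.cast_nonneg k), ENNReal.ofReal_natCast,
    ENNReal.ofReal_toReal (hitProb_ne_top k x)] at this

/-- The strong law of large numbers for pattern counts. -/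
theorem LogRecurrent.ae_tendsto_tupleInter {ι : Type*} [Fintype ι] {l C : ℝ}
    (hl : LogRecurrent P ξ l C) (h : IsIIDSequence P ξ) (w : ι → Fin d → ℤ)
    (hι : 2 ≤ Fintype.card ι) :
    ∀ᵐ ω ∂P, Tendsto (fun n : ℕ => (tupleInter ξ w n ω).toReal /
        (n * Real.log n ^ (Fintype.card ι - 1))) atTop
      (𝓝 ((Fintype.card ι).factorial * l ^ (Fintype.card ι - 1))) := by
  have : Nonempty ι := Fintype.card_pos_iff.1 (by omega)
  obtain ⟨q, hq : _ = q + 2⟩ := Nat.exists_eq_add_of_le' hι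
  obtain ⟨K, hK⟩ := exists_variance_tupleInter_le (P := P) (ENNReal.ofReal_ne_top (r := C)) w
  have hmean := hl.tendsto_lintegral_tupleInter h w
  simp only [hq, show q + 2 - 1 = q + 1 by omega] at hmean ⊢
  have hvar := fun n => hK ξ h hl.hitBound n
  simp only [hq, show 2 * (q + 2) - 4 = 2 * q by omega] at hvar
  have hint : ∀ n, (∫⁻ ω, tupleInter ξ w n ω ∂P).toReal = ∫ ω, (tupleInter ξ w n ω).toReal ∂P :=
    fun n => (integral_toReal (measurable_tupleInter (fun i _ => h.measurable i) w).aemeasurable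
      (ae_of_all _ fun ω => (tupleInter_ne_top ξ w n ω).lt_top)).symm
  set f : ℕ → ℝ := fun n => n * Real.log n ^ (q + 1) with hf
  set Y : ℕ → Ω → ℝ := fun k ω => ((tupleInter ξ w (subTime k) ω).toReal -
    ∫ ω', (tupleInter ξ w (subTime k) ω').toReal ∂P) / f (subTime k) with hYdef
  have hY : ∀ k, MemLp (Y k) 2 P := fun k => by
    have := ((memLp_tupleInter h w (subTime k)).sub (memLp_const
      (∫ ω', (tupleInter ξ w (subTime k) ω').toReal ∂P))).mul_const (f (subTime k))⁻¹
    exact this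
  have hlog2 : Real.log 2 < 1 := by have := Real.log_two_lt_d9; linarith
  have hsum : Summable fun k : ℕ => K * 2 ^ (2 * q) * 4 * (k : ℝ) ^ (-(3 / 2) : ℝ) :=
    (Real.summable_nat_rpow.2 (by norm_num)).mul_left _
  have hsmall := ae_tendsto_zero_of_summable_integral_sq hY hsum (by
    filter_upwards [tendsto_logTime.eventually_ge_atTop 2, eventually_gt_atTop 0] with k hk hk0
    set N := subTime k with hN
    have hk' : (0 : ℝ) < k := by exact_mod_cast hk0
    have hN0 := subTime_pos k
    have hlogN : logTime k / 2 ≤ Real.log N := by have := le_log_subTime k; linarith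
    have hlogN1 : 1 ≤ Real.log N := by linarith
    have hfN : 0 < f N := by positivity
    have h1 : ∫ ω, Y k ω ^ 2 ∂P =
        Var[fun ω => (tupleInter ξ w N ω).toReal; P] / f N ^ 2 := by
      rw [variance_eq_integral (memLp_tupleInter h w N).aemeasurable, ← integral_div]
      simp only [hYdef, div_pow]
      rfl
    have hK0 : 0 ≤ K := by
      have h2 := (variance_nonneg (fun ω => (tupleInter ξ w N ω).toReal) P).trans (hvar N)
      by_contra! hneg
      have : K * (N : ℝ) ^ 2 * (1 + Real.log N) ^ (2 * q) < 0 := by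
        have h3 : 0 < (N : ℝ) ^ 2 * (1 + Real.log N) ^ (2 * q) := by positivity
        nlinarith
      linarith
    have hsq : logTime k ^ 2 = (k : ℝ) ^ (3 / 2 : ℝ) := by
      rw [logTime, ← Real.rpow_natCast, ← Real.rpow_mul hk'.le]
      norm_num
    have hinv : (k : ℝ) ^ (-(3 / 2) : ℝ) = (logTime k ^ 2)⁻¹ := by
      rw [hsq, Real.rpow_neg hk'.le]
    rw [h1, hinv, div_le_iff₀ (by positivity)]
    calc _ ≤ K * (N : ℝ) ^ 2 * (1 + Real.log N) ^ (2 * q) := hvar N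
      _ ≤ K * (N : ℝ) ^ 2 * (2 * Real.log N) ^ (2 * q) := by gcongr; linarith
      _ = K * 2 ^ (2 * q) * 4 * ((2 * Real.log N) ^ 2)⁻¹ * f N ^ 2 := by
          simp only [hf]
          field_simp
          ring
      _ ≤ K * 2 ^ (2 * q) * 4 * (logTime k ^ 2)⁻¹ * f N ^ 2 := by
          gcongr
          linarith)
  filter_upwards [hsmall] with ω hω
  have hconv : Tendsto (fun k => (tupleInter ξ w (subTime k) ω).toReal / f (subTime k)) atTop
      (𝓝 ((q + 2).factorial * l ^ (q + 1))) := by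
    have := hω.add (hmean.comp tendsto_subTime)
    rw [zero_add] at this
    refine this.congr fun k => ?_
    simp only [Function.comp, hint, hYdef]
    rw [← add_div, sub_add_cancel]
  refine tendsto_div_of_monotone_of_subseq (f := f) (c := subTime) (κ := subIdx)
    (fun m n hmn => ENNReal.toReal_mono (tupleInter_ne_top _ _ _ _) (tupleInter_mono ξ w ω hmn))
    (fun n => ENNReal.toReal_nonneg) (fun m n hmn => ?_) ?_ tendsto_subIdx ?_ ?_
    (tendsto_subTime_ratio (q + 1)) hconv
  · simp only [hf]
    rcases Nat.eq_zero_or_pos m with rfl | hm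
    · have := Real.log_natCast_nonneg n
      simp only [Nat.cast_zero, zero_mul]
      positivity
    · have h1 := Real.log_natCast_nonneg m
      have h2 : Real.log m ≤ Real.log n := Real.log_le_log (by exact_mod_cast hm)
        (by exact_mod_cast hmn)
      gcongr
  · filter_upwards [tendsto_logTime.eventually_ge_atTop 2] with k hk
    have h1 : 0 < Real.log (subTime k) := by have := le_log_subTime k; linarith
    have := subTime_pos k
    positivity
  · filter_upwards [eventually_ge_atTop 1] with n hn using subTime_subIdx_le hn
  · filter_upwards [eventually_ge_atTop 1] with n hn using le_subTime_subIdx hn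

end

section

/-! ### Fourier inversion -/

variable {Ω : Type*} [mΩ : MeasurableSpace Ω] {P : Measure Ω} {d : ℕ}
  {ξ : ℕ → Ω → Fin d → ℤ}

/-- The phase `t · x`. -/
def phase (t : Fin d → ℝ) (x : Fin d → ℤ) : ℝ := ∑ i, t i * x i

/-- The characteristic function as a function on `ℝ^d` with its product structure. -/
noncomputable def phi (P : Measure Ω) (X : Ω → Fin d → ℤ) (t : Fin d → ℝ) : ℂ :=
  charFn P X (WithLp.toLp 2 t)

lemma measurable_latticeToReal : Measurable (latticeToReal : (Fin d → ℤ) → _) :=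
  Measurable.of_discrete

lemma phi_eq_integral {X : Ω → Fin d → ℤ} (hX : Measurable X) (t : Fin d → ℝ) :
    phi P X t = ∫ ω, Complex.exp (phase t (X ω) * Complex.I) ∂P := by
  have hm : Measurable fun ω => latticeToReal (X ω) := measurable_latticeToReal.comp hX
  rw [phi, charFn, charFun_apply, integral_map hm.aemeasurable
    (by fun_prop : Continuous fun x : EuclideanSpace ℝ (Fin d) =>
      Complex.exp (inner ℝ x (WithLp.toLp 2 t) * Complex.I)).aestronglyMeasurable]
  refine integral_congr_ae (ae_of_all _ fun ω => ?_)
  simp only [phase, latticeToReal, PiLp.inner_apply]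
  simp

lemma norm_exp_mul_I_eq_one (u : ℝ) : ‖Complex.exp (u * Complex.I)‖ = 1 :=
  Complex.norm_exp_ofReal_mul_I u

lemma phi_walk [IsProbabilityMeasure P] (h : IsIIDSequence P ξ) (k : ℕ) (t : Fin d → ℝ) :
    phi P (walk ξ k) t = phi P (ξ 0) t ^ k := by
  have hm : ∀ i, Measurable fun ω => latticeToReal (ξ i ω) := fun i =>
    measurable_latticeToReal.comp (h.measurable i)
  have hind : iIndepFun (fun i ω => latticeToReal (ξ i ω)) P :=
    h.indep.comp (fun _ => latticeToReal) fun _ => measurable_latticeToReal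
  have hsum : (fun ω => latticeToReal (walk ξ k ω)) =
      fun ω => ∑ i ∈ Finset.range k, latticeToReal (ξ i ω) := by
    ext ω j
    simp [latticeToReal, walk]
  have hid : ∀ i, P.map (fun ω => latticeToReal (ξ i ω)) =
      P.map (fun ω => latticeToReal (ξ 0 ω)) := fun i =>
    ((h.identDistrib i).comp measurable_latticeToReal).map_eq
  rw [phi, charFn, hsum, (hind.restrict _).charFun_map_fun_finsetSum_eq_prod
    (fun i _ => (hm i).aemeasurable)]
  simp [hid, phi, charFn]

/-- The fundamental domain of the characters of the lattice. -/
def box (d : ℕ) : Set (Fin d → ℝ) := Set.univ.pi fun _ => Set.Ioc (-Real.pi) Real.pi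

lemma measurableSet_box : MeasurableSet (box d) :=
  MeasurableSet.univ_pi fun _ => measurableSet_Ioc

instance : IsFiniteMeasure ((volume : Measure (Fin d → ℝ)).restrict (box d)) := by
  rw [volume_pi, box, Measure.restrict_pi_pi]
  infer_instance

lemma integral_exp_int_mul (n : ℤ) :
    ∫ s in Set.Ioc (-Real.pi) Real.pi, Complex.exp ((s * n : ℝ) * Complex.I) =
      if n = 0 then 2 * (Real.pi : ℂ) else 0 := by
  rw [← intervalIntegral.integral_of_le (by have := Real.pi_pos; linarith)]
  split_ifs with hn
  · simp [hn]
    ring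
  · have hc : (n : ℂ) * Complex.I ≠ 0 := mul_ne_zero (by exact_mod_cast hn) Complex.I_ne_zero
    have h1 : ∀ s : ℝ, Complex.exp ((s * n : ℝ) * Complex.I) =
        Complex.exp (n * Complex.I * s) := fun s => by
      push_cast
      ring_nf
    simp_rw [h1]
    rw [integral_exp_mul_complex hc]
    have h2 : Complex.exp (n * Complex.I * (Real.pi : ℝ)) =
        Complex.exp (n * Complex.I * ((-Real.pi : ℝ) : ℂ)) := by
      rw [Complex.exp_eq_exp_iff_exists_int]
      exact ⟨n, by push_cast; ring⟩
    rw [h2, sub_self, zero_div]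

lemma integral_box_phase (x : Fin d → ℤ) :
    ∫ t in box d, Complex.exp (phase t x * Complex.I) =
      if x = 0 then (2 * (Real.pi : ℂ)) ^ d else 0 := by
  have h1 : ∀ t : Fin d → ℝ, Complex.exp (phase t x * Complex.I) =
      ∏ i, Complex.exp ((t i * x i : ℝ) * Complex.I) := fun t => by
    rw [← Complex.exp_sum, phase, ← Finset.sum_mul]
    push_cast
    rfl
  simp_rw [h1]
  rw [volume_pi, box, Measure.restrict_pi_pi,
    integral_fintype_prod_eq_prod (fun i s => Complex.exp ((s * x i : ℝ) * Complex.I))]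
  simp_rw [integral_exp_int_mul]
  split_ifs with hx
  · simp [hx]
  · obtain ⟨i, hi⟩ := Function.ne_iff.1 hx
    exact Finset.prod_eq_zero (Finset.mem_univ i) (if_neg hi)

lemma measurable_phase_comp {X : Ω → Fin d → ℤ} (hX : Measurable X) :
    Measurable fun p : (Fin d → ℝ) × Ω => phase p.1 (X p.2) := by
  unfold phase
  refine Finset.measurable_fun_sum _ fun i _ => ?_
  have h1 : Measurable fun p : (Fin d → ℝ) × Ω => p.1 i :=
    (measurable_pi_apply i).comp measurable_fst
  have h2 : Measurable fun p : (Fin d → ℝ) × Ω => ((X p.2 i : ℤ) : ℝ) :=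
    (Measurable.of_discrete (f := fun n : ℤ => (n : ℝ))).comp
      ((measurable_pi_apply i).comp (hX.comp measurable_snd))
  exact h1.mul h2

lemma integral_box_phi [IsProbabilityMeasure P] {X : Ω → Fin d → ℤ} (hX : Measurable X)
    (x : Fin d → ℤ) :
    ∫ t in box d, phi P X t * Complex.exp (-(phase t x) * Complex.I) =
      (2 * (Real.pi : ℂ)) ^ d * (P {ω | X ω = x}).toReal := by
  have hsub : ∀ t y, phase t (y - x) = phase t y - phase t x := fun t y => by
    simp [phase, mul_sub]
  have h1 : ∀ t, phi P X t * Complex.exp (-(phase t x) * Complex.I) =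
      ∫ ω, Complex.exp (phase t (X ω - x) * Complex.I) ∂P := fun t => by
    rw [phi_eq_integral hX, ← integral_mul_const]
    refine integral_congr_ae (ae_of_all _ fun ω => ?_)
    simp only [hsub]
    rw [← Complex.exp_add]
    push_cast
    ring_nf
  have hm : Measurable fun p : (Fin d → ℝ) × Ω =>
      Complex.exp (phase p.1 (X p.2 - x) * Complex.I) := by
    have := measurable_phase_comp (hX.sub_const x)
    fun_prop
  simp_rw [h1]
  rw [integral_integral_swap]
  · simp_rw [integral_box_phase, sub_eq_zero]
    have hs : MeasurableSet {ω | X ω = x} := hX (measurableSet_singleton x)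
    have h2 : ∀ ω, (if X ω = x then (2 * (Real.pi : ℂ)) ^ d else 0) =
        {ω | X ω = x}.indicator (fun _ => (2 * (Real.pi : ℂ)) ^ d) ω := fun ω => by
      by_cases hω : X ω = x <;> simp [hω]
    simp_rw [h2]
    rw [integral_indicator hs, setIntegral_const, Measure.real, Complex.real_smul, mul_comm]
  · exact (integrable_const (1 : ℝ)).mono' hm.aestronglyMeasurable
      (ae_of_all _ fun p => (norm_exp_mul_I_eq_one _).le)

lemma hitProb_fourier [IsProbabilityMeasure P] (h : IsIIDSequence P ξ) (k : ℕ)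
    (x : Fin d → ℤ) :
    ∫ t in box d, phi P (ξ 0) t ^ k * Complex.exp (-(phase t x) * Complex.I) =
      (2 * (Real.pi : ℂ)) ^ d * (hitProb P ξ k x).toReal := by
  simp_rw [← phi_walk h]
  exact integral_box_phi (measurable_walk fun i _ => h.measurable i) x

/-! ### Aperiodicity -/

/-- If `|φ(t)| = 1`, the character `exp(i t · x)` is constant on the support of the law of `X`, so
that a translate of the kernel of the character, which is a proper subgroup, carries the law. -/
lemma norm_phi_lt_one [IsProbabilityMeasure P] {X : Ω → Fin d → ℤ} (hX : Measurable X)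
    (hap : StronglyAperiodic P X) {t : Fin d → ℝ} (ht : ∀ i, |t i| ≤ Real.pi) (ht0 : t ≠ 0) :
    ‖phi P X t‖ < 1 := by
  set e : Ω → ℂ := fun ω => Complex.exp (phase t (X ω) * Complex.I) with he
  have hem : Measurable e := by
    have : Measurable fun ω => phase t (X ω) :=
      (Measurable.of_discrete (f := fun y : Fin d → ℤ => phase t y)).comp hX
    fun_prop
  have henorm : ∀ ω, ‖e ω‖ = 1 := fun ω => norm_exp_mul_I_eq_one _
  have hint : Integrable e P :=
    (integrable_const (1 : ℝ)).mono' hem.aestronglyMeasurable (ae_of_all _ fun ω => (henorm ω).le)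
  have hphi : phi P X t = ∫ ω, e ω ∂P := phi_eq_integral hX t
  have hle : ‖phi P X t‖ ≤ 1 := by
    rw [hphi]
    refine (norm_integral_le_of_norm_le_const (ae_of_all _ fun ω => (henorm ω).le)).trans ?_
    simp
  refine lt_of_le_of_ne hle fun hone => hap ?_
  set z := phi P X t with hz
  -- `e` has modulus one, and so has its mean `z`: almost surely `e = z`
  have hrei : Integrable (fun ω => (starRingEnd ℂ z * e ω).re) P := (hint.const_mul _).re
  have hre : ∫ ω, (1 - (starRingEnd ℂ z * e ω).re) ∂P = 0 := by
    have h1 : ∫ ω, (starRingEnd ℂ z * e ω).re ∂P = (∫ ω, starRingEnd ℂ z * e ω ∂P).re :=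
      integral_re (hint.const_mul _)
    rw [integral_sub (integrable_const _) hrei, h1, integral_const_mul, ← hphi,
      mul_comm, Complex.mul_conj, Complex.normSq_eq_norm_sq, hone]
    simp
  have hzn : ∀ ω, ‖starRingEnd ℂ z * e ω‖ = 1 := fun ω => by
    rw [norm_mul, henorm, RCLike.norm_conj, hone, one_mul]
  have hae : ∀ᵐ ω ∂P, e ω = z := by
    have h0 := (integral_eq_zero_iff_of_nonneg_ae (ae_of_all P fun ω => by
      have := Complex.re_le_norm (starRingEnd ℂ z * e ω)
      rw [hzn] at this
      simpa using this) ((integrable_const (1 : ℝ)).sub hrei)).1 hre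
    filter_upwards [h0] with ω hω
    have h2 : (starRingEnd ℂ z * e ω).re = 1 := by
      simp only [Pi.zero_apply, Pi.sub_apply] at hω
      linarith
    have h3 : starRingEnd ℂ z * e ω = 1 := by
      have h4 := Complex.sq_norm (starRingEnd ℂ z * e ω)
      rw [hzn, Complex.normSq_apply, h2] at h4
      refine Complex.ext h2 ?_
      simpa using h4
    have h5 : z * starRingEnd ℂ z = 1 := by
      rw [Complex.mul_conj, Complex.normSq_eq_norm_sq, hone]; simp
    calc e ω = z * starRingEnd ℂ z * e ω := by rw [h5, one_mul]
      _ = z := by rw [mul_assoc, h3, mul_one]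
  obtain ⟨ω₀, hω₀⟩ := hae.exists
  let L : AddSubgroup (Fin d → ℤ) :=
    { carrier := {y | Complex.exp (phase t y * Complex.I) = 1}
      zero_mem' := by simp [phase]
      add_mem' := fun {a b} ha hb => by
        have : phase t (a + b) = phase t a + phase t b := by
          simp [phase, mul_add, Finset.sum_add_distrib]
        simp only [Set.mem_ofPred_eq] at ha hb ⊢
        rw [this, Complex.ofReal_add, add_mul, Complex.exp_add, ha, hb, one_mul]
      neg_mem' := fun {a} ha => by
        have : phase t (-a) = -phase t a := by simp [phase]
        simp only [Set.mem_ofPred_eq] at ha ⊢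
        rw [this, Complex.ofReal_neg, neg_mul, Complex.exp_neg, ha, inv_one] }
  refine ⟨L, X ω₀, fun hL => ht0 ?_, ?_⟩
  · ext j
    have hj : Pi.single j 1 ∈ L := hL ▸ AddSubgroup.mem_top _
    have h1 : Complex.exp (phase t (Pi.single j 1) * Complex.I) = 1 := hj
    have h2 : phase t (Pi.single j 1) = t j := by simp [phase, Pi.single_apply]
    rw [h2, Complex.exp_eq_one_iff] at h1
    obtain ⟨n, hn⟩ := h1
    have h3 : t j = n * (2 * Real.pi) := by
      have h4 : (t j : ℂ) * Complex.I = ((n * (2 * Real.pi) : ℝ) : ℂ) * Complex.I := by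
        rw [hn]; push_cast; ring
      exact_mod_cast mul_right_cancel₀ Complex.I_ne_zero h4
    have h4 := ht j
    have hpi := Real.pi_pos
    rw [h3, abs_mul, abs_of_pos (by positivity : 0 < 2 * Real.pi)] at h4
    have h5 : |(n : ℝ)| < 1 := by nlinarith
    have h6 : n = 0 := Int.abs_lt_one_iff.1 (by exact_mod_cast h5)
    simp [h3, h6]
  · have hmeas : MeasurableSet {ω | X ω - X ω₀ ∈ L} :=
      hX (MeasurableSet.of_discrete (s := {y | y - X ω₀ ∈ L}))
    refine (mem_ae_iff_prob_eq_one hmeas).1 ?_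
    filter_upwards [hae] with ω hω
    have hsub : phase t (X ω - X ω₀) = phase t (X ω) - phase t (X ω₀) := by simp [phase, mul_sub]
    change Complex.exp (phase t (X ω - X ω₀) * Complex.I) = 1
    rw [hsub, Complex.ofReal_sub, sub_mul, Complex.exp_sub]
    change e ω / e ω₀ = 1
    rw [hω, hω₀, div_self]
    intro h0
    simp [h0] at hone

end

section

/-! ### The local limit theorem -/

/-- The function `ψ` on `ℝ^d` is `1 - Q + o(Q)` at the origin, where `Q` is non-negative and
homogeneous of degree `d`. As the degree of `Q` is the dimension, the random walks with
characteristic function `ψ` have transition probabilities of order `1 / k`. -/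
structure HasExpansion {d : ℕ} (ψ : (Fin d → ℝ) → ℂ) (Q : (Fin d → ℝ) → ℝ) : Prop where
  continuous : Continuous Q
  nonneg : ∀ t, 0 ≤ Q t
  homogeneous : ∀ (r : ℝ), 0 < r → ∀ t, Q (r • t) = r ^ d * Q t
  integrable : Integrable fun t => Real.exp (-Q t)
  expansion : (fun t => ψ t - (1 - Q t : ℝ)) =o[𝓝 0] Q

namespace HasExpansion

variable {d : ℕ} {ψ : (Fin d → ℝ) → ℂ} {Q : (Fin d → ℝ) → ℝ}

lemma apply_zero (hQ : HasExpansion ψ Q) (hd : d ≠ 0) : Q 0 = 0 := by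
  have h1 := hQ.homogeneous 2 two_pos 0
  rw [smul_zero] at h1
  have h2 : (2 : ℝ) ≤ 2 ^ d := le_self_pow₀ (by norm_num) hd
  nlinarith [hQ.nonneg 0]

lemma integrable_mul (hQ : HasExpansion ψ Q) (hd : d ≠ 0) {c : ℝ} (hc : 0 < c) :
    Integrable fun t => Real.exp (-(c * Q t)) := by
  have hr : 0 < c ^ (d : ℝ)⁻¹ := Real.rpow_pos_of_pos hc _
  have h1 := hQ.integrable.comp_smul hr.ne'
  simp_rw [hQ.homogeneous _ hr, Real.rpow_inv_natCast_pow hc.le hd] at h1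
  exact h1

/-- On the whole fundamental domain the characteristic function of an aperiodic law is bounded by
`exp(-c Q)`, which serves as the dominating function after the scaling. -/
lemma exists_norm_le (hQ : HasExpansion ψ Q) (hd : d ≠ 0) (hψ : Continuous ψ)
    (hlt : ∀ t : Fin d → ℝ, (∀ i, |t i| ≤ Real.pi) → t ≠ 0 → ‖ψ t‖ < 1) :
    ∃ c > 0, ∀ t ∈ box d, ‖ψ t‖ ≤ Real.exp (-(c * Q t)) := by
  have hQ0 : Tendsto Q (𝓝 0) (𝓝 0) := by
    have := hQ.continuous.tendsto 0
    rwa [hQ.apply_zero hd] at this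
  -- near the origin the expansion gives the bound with `c = 1 / 2`
  have hnear : ∀ᶠ t in 𝓝 (0 : Fin d → ℝ), ‖ψ t‖ ≤ Real.exp (-(1 / 2 * Q t)) := by
    filter_upwards [hQ.expansion.bound (show (0 : ℝ) < 1 / 2 by norm_num),
      hQ0.eventually_le_const one_pos] with t ht ht1
    rw [Real.norm_of_nonneg (hQ.nonneg t)] at ht
    have h1 : ‖((1 - Q t : ℝ) : ℂ)‖ = 1 - Q t := by
      rw [Complex.norm_real, Real.norm_of_nonneg (by linarith)]
    have h2 : ‖ψ t‖ ≤ ‖ψ t - (1 - Q t : ℝ)‖ + ‖((1 - Q t : ℝ) : ℂ)‖ := norm_le_norm_sub_add _ _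
    have h3 := Real.add_one_le_exp (-(1 / 2 * Q t))
    linarith
  obtain ⟨U, hU, hUo, hU0⟩ := eventually_nhds_iff.1 hnear
  -- away from it, compactness gives a bound by a constant less than one
  set S : Set (Fin d → ℝ) := (Set.univ.pi fun _ => Set.Icc (-Real.pi) Real.pi) \ U with hS
  have hScomp : IsCompact S := (isCompact_univ_pi fun _ => isCompact_Icc).diff hUo
  have hSlt : ∀ t ∈ S, ‖ψ t‖ < 1 := fun t ht =>
    hlt t (fun i => abs_le.2 (ht.1 i (Set.mem_univ i))) fun h0 => ht.2 (h0 ▸ hU0)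
  obtain ⟨δ, hδ, hδS⟩ : ∃ δ > 0, ∀ t ∈ S, ‖ψ t‖ ≤ 1 - δ := by
    rcases S.eq_empty_or_nonempty with hemp | hne
    · exact ⟨1, one_pos, by simp [hemp]⟩
    · obtain ⟨t₀, ht₀, hmax⟩ := hScomp.exists_isMaxOn hne hψ.norm.continuousOn
      refine ⟨1 - ‖ψ t₀‖, by linarith [hSlt t₀ ht₀], fun t ht => ?_⟩
      have : ‖ψ t‖ ≤ ‖ψ t₀‖ := hmax ht
      linarith
  obtain ⟨M, hM⟩ := hScomp.exists_bound_of_continuousOn hQ.continuous.continuousOn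
  set M' := max M 1 with hM'
  have hM'pos : 0 < M' := lt_max_of_lt_right one_pos
  refine ⟨min (1 / 2) (δ / M'), by positivity, fun t ht => ?_⟩
  by_cases htU : t ∈ U
  · refine (hU t htU).trans (Real.exp_le_exp.2 (neg_le_neg ?_))
    gcongr
    · exact hQ.nonneg t
    · exact min_le_left _ _
  · have htS : t ∈ S := ⟨fun i hi => Set.Ioc_subset_Icc_self (ht i hi), htU⟩
    have h1 : Q t ≤ M' := (Real.le_norm_self _).trans ((hM t htS).trans (le_max_left _ _))
    have h2 : min (1 / 2) (δ / M') * Q t ≤ δ := by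
      calc _ ≤ δ / M' * M' := by
            gcongr
            · exact hQ.nonneg t
            · exact min_le_right _ _
        _ = δ := by field_simp
    have h3 := Real.add_one_le_exp (-(min (1 / 2) (δ / M') * Q t))
    linarith [hδS t htS]

lemma tendsto_pow (hQ : HasExpansion ψ Q) {r : ℕ → ℝ} (hrpos : ∀ᶠ k in atTop, 0 < r k)
    (hr : ∀ k, r k ^ d = k) (hrtop : Tendsto r atTop atTop) (s : Fin d → ℝ) :
    Tendsto (fun k => ψ ((r k)⁻¹ • s) ^ k) atTop (𝓝 (Complex.exp (-Q s))) := by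
  have ht : Tendsto (fun k => (r k)⁻¹ • s) atTop (𝓝 0) := by
    have := (tendsto_inv_atTop_zero.comp hrtop).smul_const s
    rwa [zero_smul] at this
  have hQs : ∀ᶠ k : ℕ in atTop, (k : ℝ) * Q ((r k)⁻¹ • s) = Q s := by
    filter_upwards [hrpos] with k hk
    rw [hQ.homogeneous _ (inv_pos.2 hk), inv_pow, hr]
    have : (k : ℝ) ≠ 0 := by rw [← hr]; positivity
    field_simp
  have h1 := ((isBigO_refl (fun k : ℕ => (k : ℝ)) atTop).mul_isLittleO
    (hQ.expansion.comp_tendsto ht).norm_left)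
  have h2 : Tendsto (fun k : ℕ => (k : ℝ) *
      ‖ψ ((r k)⁻¹ • s) - (1 - Q ((r k)⁻¹ • s) : ℝ)‖) atTop (𝓝 0) := by
    refine (isLittleO_one_iff ℝ).1 ((h1.congr' (Eventually.of_forall fun _ => rfl) hQs).trans_isBigO
      (isBigO_const_const _ one_ne_zero _))
  have h3 : Tendsto (fun k : ℕ => (k : ℂ) *
      (ψ ((r k)⁻¹ • s) - (1 - Q ((r k)⁻¹ • s) : ℝ))) atTop (𝓝 0) := by
    rw [tendsto_zero_iff_norm_tendsto_zero]
    simpa using h2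
  have h4 : Tendsto (fun k : ℕ => (k : ℂ) * (ψ ((r k)⁻¹ • s) - 1)) atTop (𝓝 (-Q s)) := by
    have := h3.sub_const (Q s : ℂ)
    rw [zero_sub] at this
    refine this.congr' ?_
    filter_upwards [hQs] with k hk
    rw [← hk]
    push_cast
    ring
  have h5 := Complex.tendsto_one_add_pow_exp_of_tendsto h4
  simpa using h5

end HasExpansion

variable {Ω : Type*} [mΩ : MeasurableSpace Ω] {P : Measure Ω} [IsProbabilityMeasure P] {d : ℕ}
  {ξ : ℕ → Ω → Fin d → ℤ}

lemma measurable_phase (x : Fin d → ℤ) : Measurable fun t : Fin d → ℝ => phase t x := by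
  unfold phase
  fun_prop

lemma continuous_phi {X : Ω → Fin d → ℤ} (hX : Measurable X) : Continuous (phi P X) := by
  simp_rw [funext (phi_eq_integral (P := P) hX)]
  refine continuous_of_dominated (bound := fun _ => 1) (fun t => ?_)
    (fun t => ae_of_all _ fun ω => (norm_exp_mul_I_eq_one _).le) (integrable_const _)
    (ae_of_all _ fun ω => ?_)
  · have : Measurable fun ω => phase t (X ω) :=
      (Measurable.of_discrete (f := fun y : Fin d → ℤ => phase t y)).comp hX
    exact Measurable.aestronglyMeasurable (by fun_prop)
  · unfold phase
    fun_prop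

/-- The integrand of the inversion formula for `(2 π)^d k P(S(k) = x)`, in the variable
`s = k^{1/d} t`. -/
noncomputable def scaledIntegrand (P : Measure Ω) (X : Ω → Fin d → ℤ) (x : Fin d → ℤ) (k : ℕ)
    (s : Fin d → ℝ) : ℂ :=
  (box d).indicator (fun t => phi P X t ^ k * Complex.exp (-(phase t x) * Complex.I))
    (((k : ℝ) ^ (d : ℝ)⁻¹)⁻¹ • s)

lemma integral_scaledIntegrand (h : IsIIDSequence P ξ) (hd : d ≠ 0) (x : Fin d → ℤ) (k : ℕ) :
    ∫ s, scaledIntegrand P (ξ 0) x k s =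
      (((2 * Real.pi) ^ d * (k * (hitProb P ξ k x).toReal) : ℝ) : ℂ) := by
  have h1 := Measure.integral_comp_inv_smul_of_nonneg (volume : Measure (Fin d → ℝ))
    ((box d).indicator fun t => phi P (ξ 0) t ^ k * Complex.exp (-(phase t x) * Complex.I))
    (R := (k : ℝ) ^ (d : ℝ)⁻¹) (by positivity)
  rw [integral_indicator measurableSet_box, hitProb_fourier h, Module.finrank_fin_fun,
    Real.rpow_inv_natCast_pow (Nat.cast_nonneg k) hd] at h1
  refine h1.trans ?_
  rw [Complex.real_smul]
  push_cast
  ring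

omit [IsProbabilityMeasure P] in
lemma norm_scaledIntegrand_le {X : Ω → Fin d → ℤ} {Q : (Fin d → ℝ) → ℝ}
    (hQ : HasExpansion (phi P X) Q) (hd : d ≠ 0) {c : ℝ}
    (hc : ∀ t ∈ box d, ‖phi P X t‖ ≤ Real.exp (-(c * Q t))) (x : Fin d → ℤ) {k : ℕ} (hk : k ≠ 0)
    (s : Fin d → ℝ) : ‖scaledIntegrand P X x k s‖ ≤ Real.exp (-(c * Q s)) := by
  have hk' : (0 : ℝ) < k := by exact_mod_cast Nat.pos_of_ne_zero hk
  unfold scaledIntegrand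
  by_cases hs : ((k : ℝ) ^ (d : ℝ)⁻¹)⁻¹ • s ∈ box d
  · rw [Set.indicator_of_mem hs, norm_mul, ← Complex.ofReal_neg, norm_exp_mul_I_eq_one, mul_one,
      norm_pow]
    refine (pow_le_pow_left₀ (norm_nonneg _) (hc _ hs) k).trans_eq ?_
    rw [← Real.exp_nat_mul, hQ.homogeneous _ (by positivity), inv_pow,
      Real.rpow_inv_natCast_pow hk'.le hd]
    congr 1
    field_simp
  · rw [Set.indicator_of_notMem hs, norm_zero]
    exact (Real.exp_pos _).le

/-- The local limit theorem, by dominated convergence in the scaled inversion formula. -/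
theorem HasExpansion.logRecurrent {Q : (Fin d → ℝ) → ℝ} (hQ : HasExpansion (phi P (ξ 0)) Q)
    (hd : d ≠ 0) (h : IsIIDSequence P ξ) (hap : StronglyAperiodic P (ξ 0)) :
    ∃ C, LogRecurrent P ξ (((2 * Real.pi) ^ d)⁻¹ * ∫ t, Real.exp (-Q t)) C := by
  obtain ⟨c, hc0, hc⟩ := hQ.exists_norm_le hd (continuous_phi (h.measurable 0))
    fun t ht ht0 => norm_phi_lt_one (h.measurable 0) hap ht ht0
  have hpi : 0 < (2 * Real.pi) ^ d := by positivity
  have hrpos : ∀ᶠ k : ℕ in atTop, 0 < (k : ℝ) ^ (d : ℝ)⁻¹ := by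
    filter_upwards [eventually_gt_atTop 0] with k hk
    positivity
  have hrtop : Tendsto (fun k : ℕ => (k : ℝ) ^ (d : ℝ)⁻¹) atTop atTop :=
    (tendsto_rpow_atTop (by positivity)).comp tendsto_natCast_atTop_atTop
  have hlim : ∀ x s, Tendsto (fun k => scaledIntegrand P (ξ 0) x k s) atTop
      (𝓝 (Complex.exp (-Q s))) := by
    intro x s
    have ht : Tendsto (fun k : ℕ => ((k : ℝ) ^ (d : ℝ)⁻¹)⁻¹ • s) atTop (𝓝 0) := by
      have := (tendsto_inv_atTop_zero.comp hrtop).smul_const s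
      rwa [zero_smul] at this
    have hbox : box d ∈ 𝓝 (0 : Fin d → ℝ) := set_pi_mem_nhds Set.finite_univ fun i _ =>
      Ioc_mem_nhds (by simp [Real.pi_pos]) (by simp [Real.pi_pos])
    have h1 := hQ.tendsto_pow hrpos
      (fun k => Real.rpow_inv_natCast_pow (Nat.cast_nonneg k) hd) hrtop s
    have hcont : Continuous fun t : Fin d → ℝ => Complex.exp (-(phase t x) * Complex.I) := by
      unfold phase
      fun_prop
    have h2 := (hcont.tendsto 0).comp ht
    have h3 := h1.mul h2
    simp only [phase, Pi.zero_apply, zero_mul, Finset.sum_const_zero, Complex.ofReal_zero,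
      neg_zero, Complex.exp_zero, mul_one] at h3
    refine h3.congr' ?_
    filter_upwards [ht.eventually hbox] with k hk
    rw [scaledIntegrand, Set.indicator_of_mem hk]
    rfl
  have hmeas : ∀ x k, AEStronglyMeasurable (scaledIntegrand P (ξ 0) x k) volume := by
    intro x k
    have hφ : Measurable (phi P (ξ 0)) := (continuous_phi (h.measurable 0)).measurable
    have hp := measurable_phase x
    have : Measurable ((box d).indicator fun t => phi P (ξ 0) t ^ k *
        Complex.exp (-(phase t x) * Complex.I)) :=
      Measurable.indicator (by fun_prop) measurableSet_box
    exact (this.comp (measurable_const_smul _)).aestronglyMeasurable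
  refine ⟨((2 * Real.pi) ^ d)⁻¹ * ∫ t, Real.exp (-(c * Q t)), ?_, fun k x => ?_, fun x => ?_⟩
  · exact mul_pos (inv_pos.2 hpi) (integral_exp_pos hQ.integrable)
  · rcases eq_or_ne k 0 with rfl | hk
    · simp only [Nat.cast_zero, zero_mul]
      exact mul_nonneg (inv_nonneg.2 hpi.le) (integral_nonneg fun t => (Real.exp_pos _).le)
    · have h1 := norm_integral_le_of_norm_le (hQ.integrable_mul hd hc0)
        (ae_of_all _ (norm_scaledIntegrand_le hQ hd hc x hk))
      rw [integral_scaledIntegrand h hd, Complex.norm_real, Real.norm_of_nonneg (by positivity)]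
        at h1
      rw [le_inv_mul_iff₀ hpi]
      exact h1
  · have h1 := tendsto_integral_filter_of_dominated_convergence
      (fun t => Real.exp (-(c * Q t))) (Eventually.of_forall (hmeas x))
      ((eventually_ne_atTop 0).mono fun k hk =>
        ae_of_all _ (norm_scaledIntegrand_le hQ hd hc x hk))
      (hQ.integrable_mul hd hc0) (ae_of_all _ (hlim x))
    have h2 : ∫ s, Complex.exp (-Q s) = ((∫ s, Real.exp (-Q s) : ℝ) : ℂ) := by
      rw [← integral_complex_ofReal]
      push_cast
      rfl
    rw [h2] at h1
    simp_rw [integral_scaledIntegrand h hd] at h1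
    have h3 := (Complex.continuous_re.tendsto _).comp h1
    have h4 := h3.const_mul ((2 * Real.pi) ^ d)⁻¹
    refine h4.congr fun k => ?_
    simp only [Function.comp, Complex.ofReal_re]
    field_simp

end

section

/-! ### The one-dimensional case -/

variable {Ω : Type*} [mΩ : MeasurableSpace Ω] {P : Measure Ω}

lemma integral_exp_neg_mul_abs {γ : ℝ} (hγ : 0 < γ) :
    ∫ t : Fin 1 → ℝ, Real.exp (-(γ * |t 0|)) = 2 / γ := by
  have h1 := (volume_preserving_funUnique (Fin 1) ℝ).integral_comp'
    (fun s : ℝ => Real.exp (-(γ * |s|)))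
  have h2 : ∫ s : ℝ, Real.exp (-(γ * |s|)) = 2 / γ := by
    rw [integral_comp_abs (f := fun s : ℝ => Real.exp (-(γ * s)))]
    have h3 := integral_exp_mul_Ioi (neg_lt_zero.2 hγ) 0
    simp only [neg_mul, mul_zero, Real.exp_zero] at h3
    rw [h3]
    field_simp
  rw [← h2, ← h1]
  rfl

lemma ConditionA1.hasExpansion {X : Ω → Fin 1 → ℤ} {γ : ℝ} (hA : ConditionA1 P X γ) :
    HasExpansion (phi P X) (fun t => γ * |t 0|) where
  continuous := by fun_prop
  nonneg t := mul_nonneg hA.pos.le (abs_nonneg _)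
  homogeneous r hr t := by
    simp only [Pi.smul_apply, smul_eq_mul, abs_mul, abs_of_pos hr]
    ring
  integrable := by
    by_contra hint
    have h1 := integral_exp_neg_mul_abs hA.pos
    rw [integral_undef hint] at h1
    exact (div_pos two_pos hA.pos).ne h1
  expansion := by
    have hnorm : ∀ t : Fin 1 → ℝ, ‖WithLp.toLp 2 t‖ = |t 0| := fun t => by
      simp [EuclideanSpace.norm_eq, Real.sqrt_sq_eq_abs]
    have ht : Tendsto (fun t : Fin 1 → ℝ => (WithLp.toLp 2 t : EuclideanSpace ℝ (Fin 1)))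
        (𝓝 0) (𝓝 0) := (PiLp.continuous_toLp 2 _).tendsto' _ _ rfl
    have h1 := hA.expansion.comp_tendsto ht
    simp only [Function.comp_def, hnorm] at h1
    exact h1.const_mul_right hA.pos.ne'

/-! ### The two-dimensional case -/

lemma norm_exp_sub_le_cube {u : ℝ} (hu : |u| ≤ 1) :
    ‖Complex.exp (u * Complex.I) - 1 - u * Complex.I + u ^ 2 / 2‖ ≤ |u| ^ 3 := by
  have hn : ‖(u : ℂ) * Complex.I‖ = |u| := by simp
  have h1 := Complex.exp_bound (x := u * Complex.I) (by rwa [hn]) (n := 3) (by norm_num)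
  rw [hn] at h1
  have h2 : ∑ m ∈ Finset.range 3, ((u : ℂ) * Complex.I) ^ m / (m.factorial : ℂ) =
      1 + u * Complex.I - u ^ 2 / 2 := by
    simp [Finset.sum_range_succ, mul_pow]
    ring
  rw [h2] at h1
  have h3 : |u| ^ 3 * (((3 : ℕ).succ : ℝ) * (((3 : ℕ).factorial : ℝ) * (3 : ℕ))⁻¹) ≤ |u| ^ 3 := by
    have : 0 ≤ |u| ^ 3 := by positivity
    norm_num [Nat.factorial]
    linarith
  refine le_trans (le_of_eq ?_) (h1.trans h3)
  congr 1
  ring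

lemma norm_exp_sub_le_sq (u : ℝ) :
    ‖Complex.exp (u * Complex.I) - 1 - u * Complex.I + u ^ 2 / 2‖ ≤ 4 * |u| ^ 2 := by
  rcases le_total |u| 1 with hu | hu
  · refine (norm_exp_sub_le_cube hu).trans ?_
    nlinarith [abs_nonneg u, sq_nonneg |u|]
  · have h1 : ‖(u : ℂ) * Complex.I‖ = |u| := by simp
    have h2 : ‖(u : ℂ) ^ 2 / 2‖ = |u| ^ 2 / 2 := by simp
    calc _ ≤ ‖Complex.exp (u * Complex.I)‖ + ‖(1 : ℂ)‖ + ‖(u : ℂ) * Complex.I‖ +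
          ‖(u : ℂ) ^ 2 / 2‖ :=
          (norm_add_le _ _).trans (by
            gcongr; exact (norm_sub_le _ _).trans (by gcongr; exact norm_sub_le _ _))
      _ ≤ _ := by
          rw [norm_exp_mul_I_eq_one, norm_one, h1, h2]
          nlinarith

/-- The quadratic form `t ↦ t · Σ t / 2` of the covariance matrix. -/
noncomputable def covForm (P : Measure Ω) (X : Ω → Fin 2 → ℤ) (t : Fin 2 → ℝ) : ℝ :=
  (covMatrix P X 0 0 * t 0 ^ 2 + 2 * covMatrix P X 0 1 * (t 0 * t 1) +
    covMatrix P X 1 1 * t 1 ^ 2) / 2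

namespace ConditionA2

variable {X : Ω → Fin 2 → ℤ}

lemma memLp (hA : ConditionA2 P X) (hX : Measurable X) (i : Fin 2) :
    MemLp (fun ω => (X ω i : ℝ)) 2 P := by
  have hm : Measurable fun ω => (X ω i : ℝ) :=
    (Measurable.of_discrete (f := fun y : Fin 2 → ℤ => (y i : ℝ))).comp hX
  refine (memLp_two_iff_integrable_sq hm.aestronglyMeasurable).2
    (hA.secondMoment.mono' (hm.pow_const 2).aestronglyMeasurable (ae_of_all _ fun ω => ?_))
  rw [EuclideanSpace.norm_sq_eq, Real.norm_of_nonneg (sq_nonneg _)]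
  refine le_trans ?_ (Finset.single_le_sum (fun j _ => sq_nonneg _) (Finset.mem_univ i))
  simp [latticeToReal]

lemma covMatrix_apply (hA : ConditionA2 P X) (i j : Fin 2) :
    covMatrix P X i j = ∫ ω, (X ω i : ℝ) * X ω j ∂P := by
  simp [covMatrix, covariance, hA.centred]

lemma integral_phase (hA : ConditionA2 P X) (hX : Measurable X) [IsProbabilityMeasure P]
    (t : Fin 2 → ℝ) : ∫ ω, phase t (X ω) ∂P = 0 := by
  have hi : ∀ i, Integrable (fun ω => (X ω i : ℝ)) P := fun i =>
    (hA.memLp hX i).integrable one_le_two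
  simp only [phase, Fin.sum_univ_two]
  rw [integral_add ((hi 0).const_mul _) ((hi 1).const_mul _), integral_const_mul,
    integral_const_mul, hA.centred, hA.centred]
  simp

lemma phase_sq (t : Fin 2 → ℝ) (x : Fin 2 → ℤ) : phase t x ^ 2 =
    t 0 ^ 2 * ((x 0 : ℝ) * x 0) + 2 * (t 0 * t 1) * ((x 0 : ℝ) * x 1) +
      t 1 ^ 2 * ((x 1 : ℝ) * x 1) := by
  simp only [phase, Fin.sum_univ_two]
  ring

lemma integrable_phase_sq (hA : ConditionA2 P X) (hX : Measurable X) (t : Fin 2 → ℝ) :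
    Integrable (fun ω => phase t (X ω) ^ 2) P := by
  have hi : ∀ i j, Integrable (fun ω => (X ω i : ℝ) * X ω j) P := fun i j =>
    (hA.memLp hX i).integrable_mul (hA.memLp hX j)
  simp_rw [phase_sq]
  exact (((hi 0 0).const_mul _).add ((hi 0 1).const_mul _)).add ((hi 1 1).const_mul _)

lemma integral_phase_sq (hA : ConditionA2 P X) (hX : Measurable X) (t : Fin 2 → ℝ) :
    ∫ ω, phase t (X ω) ^ 2 ∂P = 2 * covForm P X t := by
  have hi : ∀ i j, Integrable (fun ω => (X ω i : ℝ) * X ω j) P := fun i j =>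
    (hA.memLp hX i).integrable_mul (hA.memLp hX j)
  have h01 : Integrable (fun ω => t 0 ^ 2 * ((X ω 0 : ℝ) * X ω 0) +
      2 * (t 0 * t 1) * ((X ω 0 : ℝ) * X ω 1)) P :=
    ((hi 0 0).const_mul _).add ((hi 0 1).const_mul _)
  simp_rw [phase_sq]
  rw [integral_add h01 ((hi 1 1).const_mul _),
    integral_add ((hi 0 0).const_mul _) ((hi 0 1).const_mul _), integral_const_mul,
    integral_const_mul, integral_const_mul, covForm, hA.covMatrix_apply, hA.covMatrix_apply,
    hA.covMatrix_apply]
  ring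

lemma covForm_nonneg (hA : ConditionA2 P X) (hX : Measurable X) (t : Fin 2 → ℝ) :
    0 ≤ covForm P X t := by
  have h1 := hA.integral_phase_sq hX t
  have h2 : 0 ≤ ∫ ω, phase t (X ω) ^ 2 ∂P := integral_nonneg fun ω => sq_nonneg _
  linarith

lemma det_covMatrix : (covMatrix P X).det =
    covMatrix P X 0 0 * covMatrix P X 1 1 - covMatrix P X 0 1 ^ 2 := by
  have h : covMatrix P X 1 0 = covMatrix P X 0 1 := by simp [covMatrix, covariance_comm]
  rw [Matrix.det_fin_two, h]
  ring

lemma covMatrix_pos (hA : ConditionA2 P X) (hX : Measurable X) :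
    0 < covMatrix P X 0 0 ∧ 0 < (covMatrix P X).det := by
  have hq : ∀ x y : ℝ, 0 ≤ covMatrix P X 0 0 * x ^ 2 + 2 * covMatrix P X 0 1 * (x * y) +
      covMatrix P X 1 1 * y ^ 2 := fun x y => by
    have := hA.covForm_nonneg hX ![x, y]
    simp only [covForm, Matrix.cons_val_zero, Matrix.cons_val_one] at this
    linarith
  have hdet := hA.nonsingular
  rw [det_covMatrix] at hdet ⊢
  set a := covMatrix P X 0 0
  set b := covMatrix P X 0 1
  set e := covMatrix P X 1 1
  have ha : 0 < a := by
    have h0 : 0 ≤ a := by simpa using hq 1 0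
    refine lt_of_le_of_ne h0 fun ha0 => ?_
    have hb : b ≠ 0 := fun hb => hdet (by rw [← ha0, hb]; ring)
    have h1 := hq (-(e + 1) / (2 * b)) 1
    rw [← ha0] at h1
    have h2 : 2 * b * (-(e + 1) / (2 * b) * 1) = -(e + 1) := by field_simp
    rw [h2] at h1
    linarith
  refine ⟨ha, lt_of_le_of_ne ?_ hdet.symm⟩
  have h1 := hq b (-a)
  have h2 : 0 ≤ a * (a * e - b ^ 2) := by linarith
  exact nonneg_of_mul_nonneg_right h2 ha

lemma sq_add_sq_le_covForm (hA : ConditionA2 P X) (hX : Measurable X) :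
    ∃ C, ∀ t, t 0 ^ 2 + t 1 ^ 2 ≤ C * covForm P X t := by
  obtain ⟨ha, hd⟩ := hA.covMatrix_pos hX
  refine ⟨2 * (covMatrix P X 0 0 + covMatrix P X 1 1) / (covMatrix P X).det, fun t => ?_⟩
  rw [div_mul_eq_mul_div, le_div_iff₀ hd, det_covMatrix, covForm]
  nlinarith [sq_nonneg (covMatrix P X 0 0 * t 0 + covMatrix P X 0 1 * t 1),
    sq_nonneg (covMatrix P X 0 1 * t 0 + covMatrix P X 1 1 * t 1)]

/-- The second order expansion of the characteristic function. The remainder of the exponential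
series, divided by the square of the size of `t`, is dominated by a second moment and tends to
zero. -/
lemma phi_expansion (hA : ConditionA2 P X) (hX : Measurable X) [IsProbabilityMeasure P] :
    (fun t => phi P X t - (1 - covForm P X t : ℝ)) =o[𝓝 0]
      fun t : Fin 2 → ℝ => (|t 0| + |t 1|) ^ 2 := by
  set ρ : ℝ → ℂ := fun u => Complex.exp (u * Complex.I) - 1 - u * Complex.I + u ^ 2 / 2 with hρ
  set N : Ω → ℝ := fun ω => |(X ω 0 : ℝ)| + |(X ω 1 : ℝ)| with hN
  have hphm : ∀ t, Measurable fun ω => phase t (X ω) := fun t =>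
    (Measurable.of_discrete (f := fun y : Fin 2 → ℤ => phase t y)).comp hX
  have hρm : ∀ t, Measurable fun ω => ρ (phase t (X ω)) := fun t => by
    have := hphm t
    fun_prop
  have hphase : ∀ t ω, |phase t (X ω)| ≤ (|t 0| + |t 1|) * N ω := fun t ω => by
    simp only [phase, Fin.sum_univ_two, hN]
    refine (abs_add_le _ _).trans ?_
    rw [abs_mul, abs_mul]
    nlinarith [abs_nonneg (t 0), abs_nonneg (t 1), abs_nonneg (X ω 0 : ℝ), abs_nonneg (X ω 1 : ℝ),
      mul_nonneg (abs_nonneg (t 0)) (abs_nonneg (X ω 1 : ℝ)),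
      mul_nonneg (abs_nonneg (t 1)) (abs_nonneg (X ω 0 : ℝ))]
  have hNint : Integrable (fun ω => 4 * N ω ^ 2) P :=
    ((hA.memLp hX 0).abs.add (hA.memLp hX 1).abs).integrable_sq.const_mul 4
  have heq : ∀ t, phi P X t - (1 - covForm P X t : ℝ) = ∫ ω, ρ (phase t (X ω)) ∂P := fun t => by
    have hL2 : MemLp (fun ω => phase t (X ω)) 2 P :=
      (memLp_two_iff_integrable_sq (hphm t).aestronglyMeasurable).2 (hA.integrable_phase_sq hX t)
    have h1 : Integrable (fun ω => Complex.exp (phase t (X ω) * Complex.I)) P := by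
      refine (integrable_const (1 : ℝ)).mono' ?_ (ae_of_all _ fun ω =>
        (norm_exp_mul_I_eq_one _).le)
      have := hphm t
      exact Measurable.aestronglyMeasurable (by fun_prop)
    have h2 : Integrable (fun ω => (phase t (X ω) : ℂ) * Complex.I) P :=
      (hL2.integrable one_le_two).ofReal.mul_const _
    have h3 : Integrable (fun ω => (phase t (X ω) : ℂ) ^ 2 / 2) P := by
      have := ((hA.integrable_phase_sq hX t).ofReal (𝕜 := ℂ)).div_const 2
      simpa using this
    have h4 : ∫ ω, (phase t (X ω) : ℂ) * Complex.I ∂P = 0 := by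
      rw [integral_mul_const, integral_complex_ofReal, hA.integral_phase hX]
      simp
    have h5 : ∫ ω, (phase t (X ω) : ℂ) ^ 2 / 2 ∂P = (covForm P X t : ℂ) := by
      have h6 : ∀ ω, (phase t (X ω) : ℂ) ^ 2 / 2 = ((phase t (X ω) ^ 2 / 2 : ℝ) : ℂ) := fun ω => by
        push_cast
        rfl
      simp_rw [h6]
      rw [integral_complex_ofReal, integral_div, hA.integral_phase_sq hX,
        mul_div_cancel_left₀ _ two_ne_zero]
    have h7 : Integrable (fun ω => Complex.exp (phase t (X ω) * Complex.I) - 1) P :=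
      h1.sub (integrable_const 1)
    have h8 : Integrable (fun ω => Complex.exp (phase t (X ω) * Complex.I) - 1 -
        phase t (X ω) * Complex.I) P := h7.sub h2
    change _ = ∫ ω, (Complex.exp (phase t (X ω) * Complex.I) - 1 - phase t (X ω) * Complex.I +
      (phase t (X ω) : ℂ) ^ 2 / 2) ∂P
    rw [integral_add h8 h3, integral_sub h7 h2, integral_sub h1 (integrable_const 1), h4, h5,
      ← phi_eq_integral hX]
    simp
    ring
  set G : (Fin 2 → ℝ) → Ω → ℝ := fun t ω =>
    ‖ρ (phase t (X ω))‖ / (|t 0| + |t 1|) ^ 2 with hG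
  have hsize : Tendsto (fun t : Fin 2 → ℝ => |t 0| + |t 1|) (𝓝 0) (𝓝 0) := by
    have : Continuous fun t : Fin 2 → ℝ => |t 0| + |t 1| := by fun_prop
    exact this.tendsto' _ _ (by simp)
  have hlim : Tendsto (fun t => ∫ ω, G t ω ∂P) (𝓝 0) (𝓝 (∫ _, 0 ∂P)) := by
    refine tendsto_integral_filter_of_dominated_convergence (fun ω => 4 * N ω ^ 2)
      (Eventually.of_forall fun t => ((hρm t).norm.div_const _).aestronglyMeasurable)
      (Eventually.of_forall fun t => ae_of_all _ fun ω => ?_) hNint (ae_of_all _ fun ω => ?_)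
    · rw [Real.norm_of_nonneg (by positivity)]
      refine div_le_of_le_mul₀ (by positivity) (by positivity) ?_
      calc ‖ρ (phase t (X ω))‖ ≤ 4 * |phase t (X ω)| ^ 2 := norm_exp_sub_le_sq _
        _ ≤ 4 * ((|t 0| + |t 1|) * N ω) ^ 2 := by gcongr; exact hphase t ω
        _ = _ := by ring
    · have h1 : Tendsto (fun t : Fin 2 → ℝ => (|t 0| + |t 1|) * N ω ^ 3) (𝓝 0) (𝓝 0) := by
        simpa using hsize.mul_const (N ω ^ 3)
      have h2 : Tendsto (fun t : Fin 2 → ℝ => (|t 0| + |t 1|) * N ω) (𝓝 0) (𝓝 0) := by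
        simpa using hsize.mul_const (N ω)
      refine squeeze_zero' (Eventually.of_forall fun t => by positivity) ?_ h1
      filter_upwards [h2.eventually_le_const one_pos] with t ht
      have hN0 : 0 ≤ N ω := by positivity
      refine div_le_of_le_mul₀ (by positivity) (by positivity) ?_
      calc ‖ρ (phase t (X ω))‖ ≤ |phase t (X ω)| ^ 3 :=
            norm_exp_sub_le_cube ((hphase t ω).trans ht)
        _ ≤ ((|t 0| + |t 1|) * N ω) ^ 3 := by gcongr; exact hphase t ω
        _ = _ := by ring
  rw [integral_zero] at hlim
  refine isLittleO_iff.2 fun ε hε => ?_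
  filter_upwards [hlim.eventually_le_const hε] with t ht
  have hGρ : ∀ ω, ‖ρ (phase t (X ω))‖ = (|t 0| + |t 1|) ^ 2 * G t ω := fun ω => by
    rcases eq_or_ne (|t 0| + |t 1|) 0 with h0 | h0
    · have h1 := hphase t ω
      rw [h0, zero_mul] at h1
      have h2 : phase t (X ω) = 0 := abs_nonpos_iff.1 h1
      rw [h0, h2]
      simp [hρ]
    · simp only [hG]
      field_simp
  rw [heq, Real.norm_of_nonneg (by positivity)]
  refine (norm_integral_le_integral_norm _).trans ?_
  simp_rw [hGρ]
  rw [integral_const_mul, mul_comm]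
  gcongr

lemma integral_exp_neg_covForm (hA : ConditionA2 P X) (hX : Measurable X) :
    ∫ t, Real.exp (-covForm P X t) = 2 * Real.pi / √(covMatrix P X).det := by
  obtain ⟨ha, hd⟩ := hA.covMatrix_pos hX
  set a := covMatrix P X 0 0 with ha'
  set b := covMatrix P X 0 1 with hb'
  set D := (covMatrix P X).det with hD
  have hsa : 0 < √a := Real.sqrt_pos.2 ha
  have hsd : 0 < √D := Real.sqrt_pos.2 hd
  -- completing the square diagonalizes the form by a triangular matrix
  set M : Matrix (Fin 2) (Fin 2) ℝ := !![√a, b / √a; 0, √D / √a] with hM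
  have hMdet : M.det = √D := by
    rw [hM, Matrix.det_fin_two_of]
    field_simp
    ring
  have hform : ∀ t, covForm P X t = (Matrix.toLin' M t 0 ^ 2 + Matrix.toLin' M t 1 ^ 2) / 2 := by
    intro t
    have h0 : Matrix.toLin' M t 0 = √a * t 0 + b / √a * t 1 := by
      simp [hM, Matrix.toLin'_apply, Matrix.mulVec, dotProduct, Fin.sum_univ_two]
    have h1 : Matrix.toLin' M t 1 = √D / √a * t 1 := by
      simp [hM, Matrix.toLin'_apply, Matrix.mulVec, dotProduct, Fin.sum_univ_two]
    have hdet : covMatrix P X 1 1 = (D + b ^ 2) / a := by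
      rw [hD, det_covMatrix]
      field_simp
      ring
    have ea : √a ^ 2 = a := Real.sq_sqrt ha.le
    have eD : √D ^ 2 = D := Real.sq_sqrt hd.le
    rw [h0, h1, covForm, hdet]
    have e1 : (√a * t 0 + b / √a * t 1) ^ 2 =
        √a ^ 2 * t 0 ^ 2 + 2 * b * (t 0 * t 1) + b ^ 2 / √a ^ 2 * t 1 ^ 2 := by
      field_simp
      ring
    have e2 : (√D / √a * t 1) ^ 2 = √D ^ 2 / √a ^ 2 * t 1 ^ 2 := by
      field_simp
    rw [e1, e2, ea, eD]
    ring
  have hgauss : ∫ s : Fin 2 → ℝ, Real.exp (-((s 0 ^ 2 + s 1 ^ 2) / 2)) = 2 * Real.pi := by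
    have h1 : ∀ s : Fin 2 → ℝ, Real.exp (-((s 0 ^ 2 + s 1 ^ 2) / 2)) =
        ∏ i, Real.exp (-(1 / 2) * s i ^ 2) := fun s => by
      rw [Fin.prod_univ_two, ← Real.exp_add]
      ring_nf
    simp_rw [h1]
    rw [integral_fintype_prod_volume_eq_prod (fun (_ : Fin 2) (u : ℝ) =>
      Real.exp (-(1 / 2) * u ^ 2))]
    simp only [integral_gaussian, Fin.prod_univ_two]
    rw [Real.mul_self_sqrt (by positivity)]
    ring
  have hmap := Real.map_matrix_volume_pi_eq_smul_volume_pi (M := M) (by rw [hMdet]; exact hsd.ne')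
  have hcont : Continuous fun s : Fin 2 → ℝ => Real.exp (-((s 0 ^ 2 + s 1 ^ 2) / 2)) := by
    fun_prop
  have h2 := integral_map (μ := (volume : Measure (Fin 2 → ℝ)))
    (φ := Matrix.toLin' M) (LinearMap.continuous_of_finiteDimensional _).measurable.aemeasurable
    (f := fun s : Fin 2 → ℝ => Real.exp (-((s 0 ^ 2 + s 1 ^ 2) / 2)))
    hcont.aestronglyMeasurable
  simp_rw [hform]
  rw [← h2, hmap, integral_smul_measure, hgauss, hMdet,
    ENNReal.toReal_ofReal (abs_nonneg _), abs_of_pos (inv_pos.2 hsd), smul_eq_mul]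
  field_simp

lemma hasExpansion (hA : ConditionA2 P X) (hX : Measurable X) [IsProbabilityMeasure P] :
    HasExpansion (phi P X) (covForm P X) where
  continuous := by
    unfold covForm
    fun_prop
  nonneg := hA.covForm_nonneg hX
  homogeneous r hr t := by
    simp only [covForm, Pi.smul_apply, smul_eq_mul]
    ring
  integrable := by
    by_contra hint
    have h1 := hA.integral_exp_neg_covForm hX
    rw [integral_undef hint] at h1
    have h2 := Real.sqrt_pos.2 (hA.covMatrix_pos hX).2
    have := Real.pi_pos
    exact (by positivity : 0 < 2 * Real.pi / √(covMatrix P X).det).ne h1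
  expansion := by
    obtain ⟨C, hC⟩ := hA.sq_add_sq_le_covForm hX
    refine (hA.phi_expansion hX).trans_isBigO (IsBigO.of_bound (2 * C)
      (Eventually.of_forall fun t => ?_))
    rw [Real.norm_of_nonneg (by positivity), Real.norm_of_nonneg (hA.covForm_nonneg hX t)]
    have h1 := hC t
    have h2 : (|t 0| + |t 1|) ^ 2 ≤ 2 * (t 0 ^ 2 + t 1 ^ 2) := by
      rw [← sq_abs (t 0), ← sq_abs (t 1)]
      nlinarith [sq_nonneg (|t 0| - |t 1|)]
    linarith

end ConditionA2

/-! ### The intersection local times -/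

omit mΩ in
lemma visits_eq_localTime {d : ℕ} (ξ : ℕ → Ω → Fin d → ℤ) (n : ℕ) (x : Fin d → ℤ) (ω : Ω) :
    visits ξ 1 (n + 1) x ω = localTime ξ n x ω := by
  rw [visits, localTime, Nat.cast_sum, Finset.Ico_add_one_right_eq_Icc]
  exact Finset.sum_congr rfl fun k _ => by split_ifs <;> simp

/-- The pattern in which the origin and `w` occur `α` times each. -/
def doublePattern {d : ℕ} (w : Fin d → ℤ) (α : ℕ) : Fin α ⊕ Fin α → Fin d → ℤ :=
  Sum.elim (fun _ => 0) fun _ => w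

omit mΩ in
lemma shiftedIntersection_eq {d : ℕ} (ξ : ℕ → Ω → Fin d → ℤ) (w : Fin d → ℤ) (α n : ℕ) (ω : Ω) :
    shiftedIntersection ξ w α n ω = (tupleInter ξ (doublePattern w α) n ω).toReal := by
  rw [shiftedIntersection, tupleInter, ENNReal.tsum_toReal_eq]
  · refine tsum_congr fun x => ?_
    simp [doublePattern, visits_eq_localTime]
  · intro x
    simp only [visits_eq_localTime]
    exact ENNReal.prod_ne_top fun i _ => ENNReal.natCast_ne_top _

lemma ae_tendsto_shiftedIntersection [IsProbabilityMeasure P] {d : ℕ} (hd : d ≠ 0)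
    {ξ : ℕ → Ω → Fin d → ℤ} (h : IsIIDSequence P ξ) (hap : StronglyAperiodic P (ξ 0))
    {Q : (Fin d → ℝ) → ℝ} (hQ : HasExpansion (phi P (ξ 0)) Q) {g : ℝ}
    (hg : ((2 * Real.pi) ^ d)⁻¹ * ∫ t, Real.exp (-Q t) = g⁻¹) {α : ℕ} (hα : 1 ≤ α)
    (w : Fin d → ℤ) :
    ∀ᵐ ω ∂P, Tendsto (fun n : ℕ => shiftedIntersection ξ w α n ω /
        ((n : ℝ) * Real.log (n : ℝ) ^ (2 * α - 1))) atTop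
      (𝓝 (Real.Gamma (2 * (α : ℝ) + 1) / g ^ (2 * α - 1))) := by
  obtain ⟨C, hC⟩ := hQ.logRecurrent hd h hap
  have hcard : Fintype.card (Fin α ⊕ Fin α) = 2 * α := by simp; ring
  have key := hC.ae_tendsto_tupleInter h (doublePattern w α) (by omega)
  rw [hcard, hg] at key
  have hΓ : Real.Gamma (2 * (α : ℝ) + 1) = (2 * α).factorial := by
    rw [← Real.Gamma_nat_eq_factorial]
    push_cast
    rfl
  rw [hΓ, div_eq_mul_inv _ (g ^ _), ← inv_pow]
  filter_upwards [key] with ω hω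
  simpa only [shiftedIntersection_eq] using hω

end

end RandomWalkLocalTime

theorem mainTheorem5 {Ω : Type*} [MeasurableSpace Ω] (P : Measure Ω) [IsProbabilityMeasure P]
    (α : ℕ) (hα : 1 ≤ α) :
    (∀ (ξ : ℕ → Ω → Fin 1 → ℤ) (γ : ℝ),
      RandomWalkLocalTime.IsIIDSequence P ξ →
      RandomWalkLocalTime.StronglyAperiodic P (ξ 0) →
      RandomWalkLocalTime.ConditionA1 P (ξ 0) γ →
      ∀ w : Fin 1 → ℤ, ∀ᵐ ω ∂P,
        Tendsto (fun n : ℕ => RandomWalkLocalTime.shiftedIntersection ξ w α n ω /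
            ((n : ℝ) * Real.log (n : ℝ) ^ (2 * α - 1)))
          atTop (𝓝 (Real.Gamma (2 * (α : ℝ) + 1) / (Real.pi * γ) ^ (2 * α - 1)))) ∧
    (∀ ξ : ℕ → Ω → Fin 2 → ℤ,
      RandomWalkLocalTime.IsIIDSequence P ξ →
      RandomWalkLocalTime.StronglyAperiodic P (ξ 0) →
      RandomWalkLocalTime.ConditionA2 P (ξ 0) →
      ∀ w : Fin 2 → ℤ, ∀ᵐ ω ∂P,
        Tendsto (fun n : ℕ => RandomWalkLocalTime.shiftedIntersection ξ w α n ω /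
            ((n : ℝ) * Real.log (n : ℝ) ^ (2 * α - 1)))
          atTop (𝓝 (Real.Gamma (2 * (α : ℝ) + 1) /
            (2 * Real.pi * √((RandomWalkLocalTime.covMatrix P (ξ 0)).det)) ^ (2 * α - 1)))) := by
  refine ⟨fun ξ γ hξ hap hA w => ?_, fun ξ hξ hap hA w => ?_⟩
  · refine RandomWalkLocalTime.ae_tendsto_shiftedIntersection one_ne_zero hξ hap hA.hasExpansion
      ?_ hα w
    rw [RandomWalkLocalTime.integral_exp_neg_mul_abs hA.pos]
    have hγ := hA.pos
    have hpi := Real.pi_pos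
    field_simp
  · have hX := hξ.measurable 0
    refine RandomWalkLocalTime.ae_tendsto_shiftedIntersection two_ne_zero hξ hap
      (hA.hasExpansion hX) ?_ hα w
    rw [hA.integral_exp_neg_covForm hX]
    have hd := Real.sqrt_pos.2 (hA.covMatrix_pos hX).2
    have hpi := Real.pi_pos
    field_simp
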